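/- Let $(\Omega,\mathcal F,P)$ be a probability space, $T>0$, $H\in(\tfrac12,1)$, and let $B^1,\dots,B^m$ be fractional Brownian motions with Hurst parameter $H$ and almost surely continuous paths (no assumption is made on their joint law). Write $|y|=\sum_i|y^i|$ for vectors and $|A|=\sum_{i,j}|a^{ij}|$ for matrices. Let $X_0$ be an $\mathbb R^d$-valued random variable and let $\sigma:\Omega\times[0,T]\times\mathbb R^d\to\mathbb R^{d\times m}$, $b:\Omega\times[0,T]\times\mathbb R^d\to\mathbb R^d$ be coefficients that satisfy the following conditions almost surely, with constants and exponents that do not depend on $\omega$, for all $s,t\in[0,T]$ and $x,y\in\mathbb R^d$: (A) $\sigma(t,x)$ is differentiable in $x$, $|\sigma(t,x)-\sigma(t,y)|\le M|x-y|$; for every $R>0$ and all $k$, $|\partial_{x_k}\sigma(t,x)-\partial_{x_k}\sigma(t,y)|\le M_R|x-y|^{\kappa}$ whenever $|x|,|y|\le R$, where $\tfrac1H-1<\kappa\le1$; and for all $k$, $|\sigma(t,x)-\sigma(s,x)|+|\partial_{x_k}\sigma(t,x)-\partial_{x_k}\sigma(s,x)|\le M|t-s|^{\beta}$; (B) for every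 $R>0$, $|b(t,x)-b(t,y)|\le L_R|x-y|$ whenever $|x|,|y|\le R$; and $|b(t,x)|\le L(1+|x|)$; (C) $|\sigma(t,x)|\le C(1+|x|)$; (D) $|b(t,x)-b(s,x)|\le C|t-s|^{\gamma}$ with $2H-1<\gamma\le1$, and the exponent in (A) satisfies $H<\beta\le1$. Let $X$ be a solution of $$X^i_t=X^i_0+\sum_{j=1}^m\int_0^t\sigma^{ij}(s,X_s)\,dB^j_s+\int_0^tb^i(s,X_s)\,ds,\qquad t\in[0,T],\ i=1,\dots,d,$$ meaning that almost surely, for some $\nu>1-H$, the path $s\mapsto X_s$ and the integrands $s\mapsto\sigma^{ij}(s,X_s)$ are Hölder continuous of order $\nu$ on $[0,T]$ and the equation holds with the pathwise integral $$\int_a^bf\,dg=(-1)^{\alpha'}\int_a^b\big(D^{\alpha'}_{a+}f\big)(s)\,\big(D^{1-\alpha'}_{b-}(g-g(b))\big)(s)\,ds$$ defined through left and right Weyl fractional derivatives, $\alpha'\in(1-H,\nu)$. For $N\ge1$ put $\delta=T/N$, $\tau_n=n\delta$, $n_u=\max\{n:\tau_n\le u\}$, $t_u=\tau_{n_u}$.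 Let $\widetilde Y^\delta_0=X_0$, $\widetilde Y^{\delta}_{\tau_{n+1}}=\widetilde Y^{\delta}_{\tau_n}+b(\tau_n,\widetilde Y^\delta_{\tau_n})\delta+\sigma(\tau_n,\widetilde Y^\delta_{\tau_n})(B_{\tau_{n+1}}-B_{\tau_n})$, and let $Y^\delta_t=\widetilde Y^\delta_{\tau_n}+b(\tau_n,\widetilde Y^\delta_{\tau_n})(t-\tau_n)+\sigma(\tau_n,\widetilde Y^\delta_{\tau_n})(B_t-B_{\tau_n})$ for $t\in[\tau_n,\tau_{n+1}]$. Fix $\alpha\in(1-H,\tfrac12)$ and set $$U_\delta=\sup_{0\le s\le T}\Big(|X_s-Y^\delta_s|+\int_0^{t_s}|X_s-Y^\delta_s-X_u+Y^\delta_u|\,(s-u)^{-\alpha-1}\,du\Big).$$ Then: (i) for every sufficiently small $\rho>0$ there is a finite random variable $C(\omega)$ such that for every $\varepsilon>0$ there exist $\delta_0>0$ and an event $\Omega_{\varepsilon,\delta_0,\rho}$ with $P(\Omega_{\varepsilon,\delta_0,\rho})>1-\varepsilon$ for which $$U_\delta(\omega)\le C(\omega)\,\delta^{2H-1-\rho}\qquad\text{for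 all }\omega\in\Omega_{\varepsilon,\delta_0,\rho}\text{ and all }\delta=T/N<\delta_0;$$ in particular $C(\omega)$ depends on neither $\delta$ nor $\varepsilon$; (ii) if, in addition, $b$ and $\sigma$ are bounded, then for every $\rho\in(0,2H-1)$ there is a finite random variable $C(\omega)$, not depending on $\delta$, such that almost surely $U_\delta\le C(\omega)\,\delta^{2H-1-\rho}$ for all $\delta=T/N$, $N\ge1$. -/

import Mathlib

open MeasureTheory ProbabilityTheory Set
open scoped NNReal ENNReal

namespace FBMEuler

noncomputable section

/-- The norm `|y| = ∑ i, |y i|` of a vector. -/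
def vecNorm {d : ℕ} (y : Fin d → ℝ) : ℝ := ∑ i, |y i|

/-- The norm `|A| = ∑ i j, |A i j|` of a `d × m` matrix. -/
def matNorm {d m : ℕ} (A : Fin d → Fin m → ℝ) : ℝ := ∑ i, ∑ j, |A i j|

/-- `B` is (a version with almost surely continuous paths of) a fractional Brownian motion
with Hurst parameter `H`: a centered Gaussian process on `[0, ∞)` with covariance
`(t ^ (2H) + s ^ (2H) - |t - s| ^ (2H)) / 2`. The law of a centered Gaussian process is given by
its covariance, so the stationarity of the increments is a consequence.
The values of `B` at negative times are irrelevant. -/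
structure IsFBM {Ω : Type*} [MeasurableSpace Ω] (P : Measure Ω) (H : ℝ) (B : ℝ → Ω → ℝ) :
    Prop where
  gaussian : IsGaussianProcess (fun (t : ℝ≥0) (ω : Ω) => B (t : ℝ) ω) P
  centered : ∀ t : ℝ, 0 ≤ t → ∫ ω, B t ω ∂P = 0
  covariance : ∀ s t : ℝ, 0 ≤ s → 0 ≤ t →
    ∫ ω, B t ω * B s ω ∂P = (t ^ (2 * H) + s ^ (2 * H) - |t - s| ^ (2 * H)) / 2
  continuous_paths : ∀ᵐ ω ∂P, ContinuousOn (fun t : ℝ => B t ω) (Ici 0)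

/-- Left-sided fractional (Weyl) derivative of order `α` at `s > a`:
`D_{a+}^α f (s) = 1/Γ(1-α) * (f(s)/(s-a)^α + α ∫_a^s (f(s)-f(u))/(s-u)^(α+1) du)`. -/
def fracDerivLeft (α : ℝ) (f : ℝ → ℝ) (a s : ℝ) : ℝ :=
  (1 / Real.Gamma (1 - α)) *
    (f s / (s - a) ^ α + α * ∫ u in a..s, (f s - f u) / (s - u) ^ (α + 1))

/-- Right-sided fractional (Weyl) derivative of order `1 - α` at `s < b` of `g - g b`, without its
complex phase factor `(-1)^(1-α)`. -/
def fracDerivRight (α : ℝ) (g : ℝ → ℝ) (b s : ℝ) : ℝ :=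
  (1 / Real.Gamma α) *
    ((g s - g b) / (b - s) ^ (1 - α) +
      (1 - α) * ∫ u in s..b, (g s - g u) / (u - s) ^ (2 - α))

/-- The pathwise (generalized Stieltjes) integral `∫_a^b f dg`, that is
`(-1)^α ∫_a^b D_{a+}^α f (s) * D_{b-}^{1-α} (g - g b) (s) ds`. The two phase factors
`(-1)^α` and `(-1)^(1-α)` multiply to `-1`. -/
def pathInt (α : ℝ) (f g : ℝ → ℝ) (a b : ℝ) : ℝ :=
  -∫ s in a..b, fracDerivLeft α f a s * fracDerivRight α g b s

/-- `f` is Hölder continuous of order `ν` on `[0, T]`. -/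
def HolderOnIcc (T ν : ℝ) (f : ℝ → ℝ) : Prop :=
  ∃ K : ℝ, ∀ s ∈ Icc 0 T, ∀ t ∈ Icc 0 T, |f t - f s| ≤ K * |t - s| ^ ν

/-- The path `x` solves
`x_t = x0 + ∑ j, ∫_0^t σ^{·j}(u, x_u) dB^j_u + ∫_0^t b(u, x_u) du` on `[0, T]`:
for some `ν` with `ν + H > 1`, the path and the integrands of the pathwise integrals are Hölder
continuous of order `ν`, and the equation holds with the pathwise integrals taken by means of
fractional derivatives of some order `α` in `(1 - H, ν)`. -/
def IsPathSolution {d m : ℕ} (H T : ℝ) (σ : ℝ → (Fin d → ℝ) → Fin d → Fin m → ℝ)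
    (b : ℝ → (Fin d → ℝ) → Fin d → ℝ) (x0 : Fin d → ℝ) (B : Fin m → ℝ → ℝ)
    (x : ℝ → Fin d → ℝ) : Prop :=
  ∃ ν α : ℝ, 1 - H < α ∧ α < ν ∧ ν ≤ 1 ∧
    (∀ i, HolderOnIcc T ν (fun t => x t i)) ∧
    (∀ i j, HolderOnIcc T ν (fun t => σ t (x t) i j)) ∧
    ∀ t ∈ Icc 0 T, ∀ i,
      x t i = x0 i + ∑ j, pathInt α (fun u => σ u (x u) i j) (B j) 0 t +
        ∫ u in (0 : ℝ)..t, b u (x u) i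

/-- The partial derivative `∂_{x_k} σ(t, x)` of a matrix-valued coefficient. -/
def partialX {d m : ℕ} (σ : ℝ → (Fin d → ℝ) → Fin d → Fin m → ℝ) (k : Fin d) (t : ℝ)
    (x : Fin d → ℝ) : Fin d → Fin m → ℝ :=
  fun i j => fderiv ℝ (fun z => σ t z i j) x (Pi.single k 1)

/-- Regularity of a realization of the diffusion coefficient, with global constant `M`,
local constants `ML R` and exponents `β`, `κ`. -/
structure CondA {d m : ℕ} (T M : ℝ) (ML : ℝ → ℝ) (β κ : ℝ)
    (σ : ℝ → (Fin d → ℝ) → Fin d → Fin m → ℝ) : Prop where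
  differentiable : ∀ t ∈ Icc 0 T, ∀ i j, Differentiable ℝ (fun z => σ t z i j)
  lipschitz : ∀ t ∈ Icc 0 T, ∀ x y,
    matNorm (σ t x - σ t y) ≤ M * vecNorm (x - y)
  holder_deriv : ∀ R : ℝ, 0 < R → ∀ t ∈ Icc 0 T, ∀ x y, vecNorm x ≤ R → vecNorm y ≤ R →
    ∀ k, matNorm (partialX σ k t x - partialX σ k t y) ≤ ML R * vecNorm (x - y) ^ κ
  holder_time : ∀ s ∈ Icc 0 T, ∀ t ∈ Icc 0 T, ∀ x,
    matNorm (σ t x - σ s x) ≤ M * |t - s| ^ β ∧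
    ∀ k, matNorm (σ t x - σ s x) + matNorm (partialX σ k t x - partialX σ k s x)
      ≤ M * |t - s| ^ β

/-- Regularity and growth of a realization of the drift coefficient, with local Lipschitz constants `LL R`
and linear growth constant `L`. -/
structure CondB {d : ℕ} (T L : ℝ) (LL : ℝ → ℝ) (b : ℝ → (Fin d → ℝ) → Fin d → ℝ) :
    Prop where
  lipschitz : ∀ R : ℝ, 0 < R → ∀ t ∈ Icc 0 T, ∀ x y, vecNorm x ≤ R → vecNorm y ≤ R →
    vecNorm (b t x - b t y) ≤ LL R * vecNorm (x - y)
  growth : ∀ t ∈ Icc 0 T, ∀ x, vecNorm (b t x) ≤ L * (1 + vecNorm x)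

/-- Linear growth of the diffusion coefficient. -/
def CondC {d m : ℕ} (T C : ℝ) (σ : ℝ → (Fin d → ℝ) → Fin d → Fin m → ℝ) : Prop :=
  ∀ t ∈ Icc 0 T, ∀ x, matNorm (σ t x) ≤ C * (1 + vecNorm x)

/-- Hölder continuity of order `γ` of the drift coefficient in time, uniformly in space. -/
def CondD {d : ℕ} (T C γ : ℝ) (b : ℝ → (Fin d → ℝ) → Fin d → ℝ) : Prop :=
  ∀ s ∈ Icc 0 T, ∀ t ∈ Icc 0 T, ∀ x, vecNorm (b t x - b s x) ≤ C * |t - s| ^ γ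

/-- The discrete Euler approximations at the points `n * δ`. -/
def eulerGrid {d m : ℕ} (σ : ℝ → (Fin d → ℝ) → Fin d → Fin m → ℝ)
    (b : ℝ → (Fin d → ℝ) → Fin d → ℝ) (x0 : Fin d → ℝ) (B : Fin m → ℝ → ℝ) (δ : ℝ) :
    ℕ → Fin d → ℝ
  | 0 => x0
  | n + 1 => fun i =>
      eulerGrid σ b x0 B δ n i +
        b (n * δ) (eulerGrid σ b x0 B δ n) i * δ +
        ∑ j, σ (n * δ) (eulerGrid σ b x0 B δ n) i j * (B j ((n + 1) * δ) - B j (n * δ))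

/-- The index `n_t = max {n : n * δ ≤ t}`. -/
def gridIndex (δ t : ℝ) : ℕ := ⌊t / δ⌋₊

/-- The last grid point before `t`. -/
def gridPoint (δ t : ℝ) : ℝ := gridIndex δ t * δ

/-- The continuous interpolation `Y^δ` of the Euler approximations. -/
def euler {d m : ℕ} (σ : ℝ → (Fin d → ℝ) → Fin d → Fin m → ℝ)
    (b : ℝ → (Fin d → ℝ) → Fin d → ℝ) (x0 : Fin d → ℝ) (B : Fin m → ℝ → ℝ) (δ t : ℝ) :
    Fin d → ℝ :=
  fun i =>
    eulerGrid σ b x0 B δ (gridIndex δ t) i +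
      b (gridPoint δ t) (eulerGrid σ b x0 B δ (gridIndex δ t)) i * (t - gridPoint δ t) +
      ∑ j, σ (gridPoint δ t) (eulerGrid σ b x0 B δ (gridIndex δ t)) i j *
        (B j t - B j (gridPoint δ t))

/-- The error
`U_δ = sup_{0 ≤ s ≤ T} (|x_s - y_s| + ∫_0^{t_s} |x_s - y_s - x_u + y_u| (s-u)^(-α-1) du)`
as an extended nonnegative number, where `t_s` is the last grid point before `s`. -/
def errorNorm {d : ℕ} (α T δ : ℝ) (x y : ℝ → Fin d → ℝ) : ℝ≥0∞ :=
  ⨆ s ∈ Icc 0 T,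
    (ENNReal.ofReal (vecNorm (x s - y s)) +
      ∫⁻ u in Ioo 0 (gridPoint δ s),
        ENNReal.ofReal (vecNorm (x s - y s - x u + y u) * (s - u) ^ (-α - 1)))

end

end FBMEuler

/-!
# Convergence rate of the Euler scheme for equations driven by fractional Brownian motion

The estimate is pathwise. Fix `1 / 2 < μ < H` with `κ * μ + μ > 1` and a realization in which the
driver `g` is `μ`-Hölder; the paths of fractional Brownian motion have this regularity, with a
measurable constant, by Gaussian scaling of the moments and dyadic chaining
(`IsFBM.exists_holder`).

*The equation.* For smooth `f` and `g` the pathwise integral is `∫ f g'`, since the fractional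
integral and the fractional derivative are inverse to each other (`pathInt_eq_of_deriv`).
Approximation by Steklov averages, which keep the Hölder constants, gives Young's estimate
`|∫_s^t f dg - f s (g t - g s)| ≤ C (t - s) ^ (ν + λ)` in general (`young_bound`). Hence the local
error `x t - x s - σ(s, x s) (g t - g s) - (t - s) b(s, x s)` of a solution `x` is of some order
larger than one (`IsPathSolution.isDavieSolution`), and everything that follows uses this property
only.

*A priori bounds.* A solution on a fine grid, and an Euler approximation on any grid, solves a
discrete Young equation `z (n + 1) = z n + F n (g (n + 1) - g n) + drift` with integrand of linear
growth in `z`. A discrete sewing estimate (`discrete_sewing_bound`) and a self-improving bound on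
short windows give size and Hölder bounds for `z` that do not depend on the mesh
(`DiscreteYoung.exists_bound`). With these bounds, sewing shows that the local errors of the
solution are of order `2 μ`, with explicit constants (`localError_le`).

*The error.* At the grid points, the difference `z = x - y` of the solution and the Euler
approximation solves a discrete Young equation again: the integrand is `σ(·, x) - σ(·, y)`, whose
increments are controlled by the four-point estimate (`CondA.four_point`), and the inhomogeneity
is the local error per unit of time, of size `δ ^ (2 μ - 1)`. Since the bounds of
`DiscreteYoung.exists_bound` are linear in the data and `z` starts from zero, `z` is of order
`δ ^ (2 μ - 1)` in the `μ`-Hölder norm; a direct estimate inside the steps of the grid extends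
this to all times (`exists_error_bound`). As `α < 1 / 2 < μ`, the `μ`-Hölder norm dominates the
error functional (`errorNorm_le`).

Letting `μ` be close to `H` gives the rate `2 * H - 1 - ρ` almost surely, for every `ρ` and all
step sizes (`exists_ae_errorNorm_le`). The a priori bounds come from linear growth of the
coefficients alone, without localization, so one event of full measure serves all `ε`.
-/

namespace FBMEuler

/-! ### Sewing estimates -/

/-- The constant `1 / (1 - 2 ^ (1 - θ))` of the sewing estimates, finite for `θ > 1`. -/
noncomputable def sewingConst (θ : ℝ) : ℝ := 1 / (1 - 2 ^ (1 - θ))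

lemma two_rpow_one_sub_lt_one {θ : ℝ} (hθ : 1 < θ) : (2 : ℝ) ^ (1 - θ) < 1 :=
  Real.rpow_lt_one_of_one_lt_of_neg (by norm_num) (by linarith)

lemma sewingConst_pos {θ : ℝ} (hθ : 1 < θ) : 0 < sewingConst θ := by
  have := two_rpow_one_sub_lt_one hθ
  unfold sewingConst
  apply one_div_pos.2
  linarith

lemma sewingConst_eq {θ : ℝ} (hθ : 1 < θ) :
    sewingConst θ = 2 ^ (1 - θ) * sewingConst θ + 1 := by
  have := two_rpow_one_sub_lt_one hθ
  unfold sewingConst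
  field_simp [(by linarith : (1 : ℝ) - 2 ^ (1 - θ) ≠ 0)]
  ring

lemma two_mul_half_rpow {θ x : ℝ} (hx : 0 ≤ x) :
    2 * (x / 2) ^ θ = 2 ^ (1 - θ) * x ^ θ := by
  rw [Real.div_rpow hx (by norm_num), Real.rpow_sub (by norm_num), Real.rpow_one]
  ring

/-- If a two-parameter function is additive up to `W (t - s) ^ θ` and negligible on short
intervals, with some constant `K'` that is irrelevant for the conclusion, then it is bounded by
`W (t - s) ^ θ`, up to a constant that depends on `θ` only. -/
theorem sewing_bound {E : Type*} [NormedAddCommGroup E] {J : ℝ → ℝ → E} {a b W θ K' θ' : ℝ}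
    (hθ : 1 < θ) (hθ' : 1 < θ')
    (hδ : ∀ s u t, a ≤ s → s ≤ u → u ≤ t → t ≤ b → ‖J s t - J s u - J u t‖ ≤ W * (t - s) ^ θ)
    (hJ : ∀ s t, a ≤ s → s ≤ t → t ≤ b → ‖J s t‖ ≤ K' * (t - s) ^ θ')
    {s t : ℝ} (hs : a ≤ s) (hst : s ≤ t) (ht : t ≤ b) :
    ‖J s t‖ ≤ sewingConst θ * W * (t - s) ^ θ := by
  have key : ∀ n : ℕ, ∀ s t, a ≤ s → s ≤ t → t ≤ b →
      ‖J s t‖ ≤ sewingConst θ * W * (t - s) ^ θ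
        + ((2 : ℝ) ^ (1 - θ')) ^ n * (K' * (t - s) ^ θ') := by
    intro n
    induction n with
    | zero =>
      intro s t hs hst ht
      have h0 := hδ s s t hs le_rfl hst ht
      have hW : 0 ≤ W * (t - s) ^ θ := (norm_nonneg _).trans h0
      have := hJ s t hs hst ht
      have := mul_nonneg (sewingConst_pos hθ).le hW
      simp only [pow_zero, one_mul]
      nlinarith
    | succ n ih =>
      intro s t hs hst ht
      have e1 : (s + t) / 2 - s = (t - s) / 2 := by ring
      have e2 : t - (s + t) / 2 = (t - s) / 2 := by ring
      have h0 := hδ s ((s + t) / 2) t hs (by linarith) (by linarith) ht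
      have h1 := ih s ((s + t) / 2) hs (by linarith) (by linarith)
      have h2 := ih ((s + t) / 2) t (by linarith) (by linarith) ht
      rw [e1] at h1
      rw [e2] at h2
      have h3 : ‖J s t‖ ≤ ‖J s t - J s ((s + t) / 2) - J ((s + t) / 2) t‖
          + ‖J s ((s + t) / 2)‖ + ‖J ((s + t) / 2) t‖ := by
        have := norm_add₃_le (a := J s t - J s ((s + t) / 2) - J ((s + t) / 2) t)
          (b := J s ((s + t) / 2)) (c := J ((s + t) / 2) t)
        rwa [show J s t - J s ((s + t) / 2) - J ((s + t) / 2) t + J s ((s + t) / 2)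
          + J ((s + t) / 2) t = J s t by abel] at this
      have e3 := two_mul_half_rpow (θ := θ) (sub_nonneg.2 hst)
      have e4 := two_mul_half_rpow (θ := θ') (sub_nonneg.2 hst)
      have e5 := sewingConst_eq hθ
      calc ‖J s t‖ ≤ W * (t - s) ^ θ + sewingConst θ * W * (2 * ((t - s) / 2) ^ θ)
            + ((2 : ℝ) ^ (1 - θ')) ^ n * K' * (2 * ((t - s) / 2) ^ θ') := by linarith
        _ = (2 ^ (1 - θ) * sewingConst θ + 1) * W * (t - s) ^ θ
            + ((2 : ℝ) ^ (1 - θ')) ^ (n + 1) * (K' * (t - s) ^ θ') := by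
          rw [e3, e4]; ring
        _ = _ := by rw [← e5]
  have hlim : Filter.Tendsto (fun n : ℕ => sewingConst θ * W * (t - s) ^ θ
        + ((2 : ℝ) ^ (1 - θ')) ^ n * (K' * (t - s) ^ θ')) Filter.atTop
      (nhds (sewingConst θ * W * (t - s) ^ θ + 0 * (K' * (t - s) ^ θ'))) :=
    ((tendsto_pow_atTop_nhds_zero_of_lt_one (by positivity)
      (two_rpow_one_sub_lt_one hθ')).mul_const _).const_add _
  have := ge_of_tendsto' hlim (fun n => key n s t hs hst ht)
  simpa using this

/-- The sewing estimate on a grid of mesh `δ`: the sum of `A l (l + 1)` over the steps between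
`i` and `k` differs from `A i k` by the additivity defect of `A` at the scale `(k - i) δ`. -/
theorem discrete_sewing_bound {E : Type*} [NormedAddCommGroup E] {A : ℕ → ℕ → E} {p q : ℕ}
    {δ W θ : ℝ} (hθ : 1 < θ) (hδ : 0 ≤ δ) (hW : 0 ≤ W)
    (hA : ∀ i j k, p ≤ i → i ≤ j → j ≤ k → k ≤ q →
      ‖A i k - A i j - A j k‖ ≤ W * (((k : ℝ) - i) * δ) ^ θ)
    {i k : ℕ} (hi : p ≤ i) (hik : i ≤ k) (hk : k ≤ q) :
    ‖∑ l ∈ Finset.Ico i k, A l (l + 1) - A i k‖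
      ≤ 2 * sewingConst θ * W * (((k : ℝ) - i) * δ) ^ θ := by
  have hdiag : ∀ i, p ≤ i → i ≤ q → A i i = 0 := by
    intro i hi hq
    have := hA i i i hi le_rfl le_rfl hq
    rw [sub_self (i : ℝ), zero_mul, Real.zero_rpow (by linarith), mul_zero] at this
    simpa using this
  induction hn : k - i using Nat.strong_induction_on generalizing i k with
  | _ n ih =>
  rcases hik.eq_or_lt with rfl | hlt
  · rw [hdiag i hi hk, sub_self, zero_mul, Real.zero_rpow (by linarith)]
    simp
  obtain ⟨j, hj1, hj2, hj3⟩ : ∃ j, i ≤ j ∧ j + 1 ≤ k ∧ j - i = (k - i - 1) / 2 :=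
    ⟨i + (k - i - 1) / 2, by omega, by omega, by omega⟩
  have hx : 0 ≤ ((k : ℝ) - i) * δ := mul_nonneg (sub_nonneg.2 (by exact_mod_cast hik)) hδ
  have m : ∀ u v : ℕ, u ≤ v → 2 * (v - u) ≤ k - i →
      (((v : ℝ) - u) * δ) ^ θ ≤ (((k : ℝ) - i) * δ / 2) ^ θ := by
    intro u v huv h2
    have h3 : (2 : ℝ) * (v - u) ≤ k - i := by
      rw [← Nat.cast_sub huv, ← Nat.cast_sub hik]; exact_mod_cast h2
    apply Real.rpow_le_rpow (mul_nonneg (sub_nonneg.2 (by exact_mod_cast huv)) hδ) _ (by linarith)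
    nlinarith
  have h1 := ih (j - i) (by omega) hi hj1 (by omega) rfl
  have h2 := ih (k - (j + 1)) (by omega) (by omega : p ≤ j + 1) hj2 hk rfl
  have d1 := hA i (j + 1) k hi (by omega) hj2 hk
  have d2 := hA i j (j + 1) hi hj1 (by omega) (by omega)
  have d2' : W * ((((j + 1 : ℕ) : ℝ) - i) * δ) ^ θ ≤ W * (((k : ℝ) - i) * δ) ^ θ := by
    have h5 : (i : ℝ) ≤ ((j + 1 : ℕ) : ℝ) := by exact_mod_cast (by omega : i ≤ j + 1)
    have h6 : ((j + 1 : ℕ) : ℝ) ≤ k := by exact_mod_cast hj2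
    have h7 := mul_nonneg (sub_nonneg.2 h5) hδ
    gcongr
  have m1 := m i j hj1 (by omega)
  have m2 := m (j + 1) k hj2 (by omega)
  have hS := sewingConst_pos hθ
  have hsum : ∑ l ∈ Finset.Ico i k, A l (l + 1) = ∑ l ∈ Finset.Ico i j, A l (l + 1)
      + A j (j + 1) + ∑ l ∈ Finset.Ico (j + 1) k, A l (l + 1) := by
    rw [← Finset.sum_Ico_consecutive _ (by omega : i ≤ j + 1) hj2,
      Finset.sum_Ico_succ_top hj1]
  have hdec : ∑ l ∈ Finset.Ico i k, A l (l + 1) - A i k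
      = (∑ l ∈ Finset.Ico i j, A l (l + 1) - A i j)
        + (∑ l ∈ Finset.Ico (j + 1) k, A l (l + 1) - A (j + 1) k)
        - (A i k - A i (j + 1) - A (j + 1) k) - (A i (j + 1) - A i j - A j (j + 1)) := by
    rw [hsum]; abel
  rw [hdec]
  refine (norm_sub_le _ _).trans ((add_le_add_left (norm_sub_le _ _) _).trans ?_)
  refine (add_le_add_left (add_le_add_left (norm_add_le _ _) _) _).trans ?_
  have e3 := two_mul_half_rpow (θ := θ) hx
  have e5 := sewingConst_eq hθ
  have c1 := mul_le_mul_of_nonneg_left m1 (by positivity : 0 ≤ 2 * sewingConst θ * W)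
  have c2 := mul_le_mul_of_nonneg_left m2 (by positivity : 0 ≤ 2 * sewingConst θ * W)
  calc _ ≤ 2 * sewingConst θ * W * (2 * (((k : ℝ) - i) * δ / 2) ^ θ)
        + 2 * (W * (((k : ℝ) - i) * δ) ^ θ) := by linarith
    _ = 2 * (2 ^ (1 - θ) * sewingConst θ + 1) * W * (((k : ℝ) - i) * δ) ^ θ := by
      rw [e3]; ring
    _ = _ := by rw [← e5]

/-! ### Discrete Young equations -/

/-- A bound that improves itself by `Q ↦ c + Q / 2`, starting from some finite bound, holds with
the fixed point `2 c`. -/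
lemma le_two_mul_of_improve {ι : Type*} {x w : ι → ℝ} {c Q₀ : ℝ} (hw : ∀ i, 0 ≤ w i)
    (hQ₀ : 0 ≤ Q₀) (hc : 0 ≤ c) (h0 : ∀ i, x i ≤ Q₀ * w i)
    (h : ∀ Q, 0 ≤ Q → (∀ i, x i ≤ Q * w i) → ∀ i, x i ≤ (c + Q / 2) * w i) (i : ι) :
    x i ≤ 2 * c * w i := by
  have key : ∀ n : ℕ, ∀ i, x i ≤ (2 * c + Q₀ * (1 / 2) ^ n) * w i := by
    intro n
    induction n with
    | zero =>
      intro i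
      have := mul_nonneg hc (hw i)
      have := h0 i
      rw [pow_zero]
      linarith
    | succ n ih =>
      intro i
      refine (h _ (by positivity) ih i).trans (le_of_eq ?_)
      ring
  have hlim : Filter.Tendsto (fun n : ℕ => (2 * c + Q₀ * (1 / 2) ^ n) * w i) Filter.atTop
      (nhds ((2 * c + Q₀ * 0) * w i)) :=
    (((tendsto_pow_atTop_nhds_zero_of_lt_one (by norm_num) (by norm_num)).const_mul
      _).const_add _).mul_const _
  have := ge_of_tendsto' hlim (fun n => key n i)
  simpa using this

section DiscreteYoung

variable {E G : Type*} [NormedAddCommGroup E] [NormedSpace ℝ E]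
  [NormedAddCommGroup G] [NormedSpace ℝ G]

/-- A discrete equation `z (n + 1) = z n + F n (g (n + 1) - g n) + drift` on a grid of mesh `δ`
with `N` steps, driven by a grid function `g` that is Hölder continuous of order `μ`. The
integrand `F` is controlled by the size `‖z‖ + η` of the solution, and its increments by those of
`z`, up to a term of Hölder order `κ`. The parameter `η` is the size of the inhomogeneity: it is
`1` for an equation with coefficients of linear growth, and the size of the local errors for the
difference of two such equations. -/
structure DiscreteYoung (μ κ M K δ : ℝ) (N : ℕ) (η : ℝ) (z : ℕ → E) (F : ℕ → G →L[ℝ] E)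
    (g : ℕ → G) : Prop where
  driver : ∀ i j, i ≤ j → j ≤ N → ‖g j - g i‖ ≤ K * (((j : ℝ) - i) * δ) ^ μ
  step : ∀ n < N, ‖z (n + 1) - z n - F n (g (n + 1) - g n)‖ ≤ M * (‖z n‖ + η) * δ
  bound : ∀ n ≤ N, ‖F n‖ ≤ M * (‖z n‖ + η)
  incr : ∀ i j, i ≤ j → j ≤ N →
    ‖F j - F i‖ ≤ M * (‖z j - z i‖ + (‖z i‖ + η) * (((j : ℝ) - i) * δ) ^ κ)

lemma grid_nonneg {δ : ℝ} (hδ : 0 ≤ δ) {i j : ℕ} (h : i ≤ j) : 0 ≤ ((j : ℝ) - i) * δ :=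
  mul_nonneg (sub_nonneg.2 (by exact_mod_cast h)) hδ

/-- One improvement step for the Hölder constant on a window of length at most `h`: the constant
`Q` contributes to the new one only with a factor that is small with `h`. -/
lemma DiscreteYoung.improve {μ κ M K δ η : ℝ} {N : ℕ} {z : ℕ → E} {F : ℕ → G →L[ℝ] E}
    {g : ℕ → G} (hz : DiscreteYoung μ κ M K δ N η z F g) (hμ1 : μ ≤ 1) (hκ : 0 < κ)
    (hκμ : κ ≤ μ) (hθ : 1 < κ + μ) (hM : 0 ≤ M) (hK : 0 ≤ K) (hδ : 0 ≤ δ) (hη : 0 ≤ η)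
    {h : ℝ} (h0 : 0 < h) (h1 : h ≤ 1) {p q : ℕ} (hq : q ≤ N)
    (hpq : ((q : ℝ) - p) * δ ≤ h) {Q : ℝ} (hQ : 0 ≤ Q)
    (H : ∀ i j, p ≤ i → i ≤ j → j ≤ q → ‖z j - z i‖ ≤ Q * (((j : ℝ) - i) * δ) ^ μ)
    {i j : ℕ} (hi : p ≤ i) (hij : i ≤ j) (hj : j ≤ q) :
    ‖z j - z i‖ ≤ ((M * K + 2 * sewingConst (κ + μ) * (M * K) + M) * (‖z p‖ + η)
      + (M * K + 4 * sewingConst (κ + μ) * (M * K) + M) * h ^ κ * Q)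
        * (((j : ℝ) - i) * δ) ^ μ := by
  set S := ‖z p‖ + η with hS
  have hS0 : 0 ≤ S := by positivity
  have hsc := sewingConst_pos hθ
  have hμ0 : 0 < μ := by linarith
  have hhμκ : h ^ μ ≤ h ^ κ := Real.rpow_le_rpow_of_exponent_ge h0 h1 hκμ
  have hhμ1 : h ^ μ ≤ 1 := Real.rpow_le_one h0.le h1 hμ0.le
  have len : ∀ i j, p ≤ i → i ≤ j → j ≤ q → ((j : ℝ) - i) * δ ≤ h := by
    intro i j hi hij hj
    refine le_trans ?_ hpq
    have a1 : (p : ℝ) ≤ i := by exact_mod_cast hi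
    have a2 : (j : ℝ) ≤ q := by exact_mod_cast hj
    gcongr
  have size : ∀ i, p ≤ i → i ≤ q → ‖z i‖ + η ≤ S + Q * h ^ κ := by
    intro i hi hiq
    have a1 := H p i le_rfl hi hiq
    have a2 : (((i : ℝ) - p) * δ) ^ μ ≤ h ^ μ :=
      Real.rpow_le_rpow (grid_nonneg hδ hi) (len p i le_rfl hi hiq) hμ0.le
    have a3 : ‖z i‖ ≤ ‖z p‖ + ‖z i - z p‖ := norm_le_norm_add_norm_sub' _ _
    have a4 : Q * (((i : ℝ) - p) * δ) ^ μ ≤ Q * h ^ κ := by gcongr; exact a2.trans hhμκ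
    linarith
  set W := M * K * (S + 2 * Q) with hW
  have hhκ : 0 < h ^ κ := Real.rpow_pos_of_pos h0 _
  have hhκ1 : h ^ κ ≤ 1 := Real.rpow_le_one h0.le h1 hκ.le
  have hW0 : 0 ≤ W := by positivity
  have hsew := discrete_sewing_bound (A := fun i j => F i (g j - g i)) (W := W) hθ hδ hW0
    (p := p) (q := q) ?_ hi hij hj
  swap
  · intro i j k hi hij hjk hk
    have e1 : F i (g k - g i) - F i (g j - g i) - F j (g k - g j) = -(F j - F i) (g k - g j) := by
      rw [sub_apply, ← map_sub]
      simp only [sub_sub_sub_cancel_right]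
      abel
    simp only [e1, norm_neg]
    have x0 := grid_nonneg hδ hij
    have y0 := grid_nonneg hδ hjk
    have z0 := grid_nonneg hδ (hij.trans hjk)
    have xz : ((j : ℝ) - i) * δ ≤ ((k : ℝ) - i) * δ := by
      have : (j : ℝ) ≤ k := by exact_mod_cast hjk
      gcongr
    have yz : ((k : ℝ) - j) * δ ≤ ((k : ℝ) - i) * δ := by
      have : (i : ℝ) ≤ j := by exact_mod_cast hij
      gcongr
    have hF : ‖F j - F i‖ ≤ M * (S + 2 * Q) * (((k : ℝ) - i) * δ) ^ κ := by
      refine (hz.incr i j hij (by omega)).trans ?_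
      have b1 := H i j hi hij (by omega)
      have b2 : (((j : ℝ) - i) * δ) ^ κ ≤ (((k : ℝ) - i) * δ) ^ κ :=
        Real.rpow_le_rpow x0 xz hκ.le
      have b3 : (((j : ℝ) - i) * δ) ^ μ ≤ (((k : ℝ) - i) * δ) ^ κ :=
        (Real.rpow_le_rpow_of_exponent_ge' x0 ((len i j hi hij (by omega)).trans h1) hκ.le
          hκμ).trans b2
      have b4 := size i hi (by omega)
      have b5 : Q * h ^ κ ≤ Q := mul_le_of_le_one_right hQ hhκ1
      calc M * (‖z j - z i‖ + (‖z i‖ + η) * (((j : ℝ) - i) * δ) ^ κ)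
          ≤ M * (Q * (((k : ℝ) - i) * δ) ^ κ + (S + Q) * (((k : ℝ) - i) * δ) ^ κ) := by
            refine mul_le_mul_of_nonneg_left (add_le_add (b1.trans (by gcongr)) ?_) hM
            exact mul_le_mul (by linarith) b2 (Real.rpow_nonneg x0 _) (by positivity)
        _ = _ := by ring
    calc ‖(F j - F i) (g k - g j)‖ ≤ ‖F j - F i‖ * ‖g k - g j‖ :=
          ContinuousLinearMap.le_opNorm _ _
      _ ≤ (M * (S + 2 * Q) * (((k : ℝ) - i) * δ) ^ κ)
          * (K * (((k : ℝ) - i) * δ) ^ μ) := by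
        gcongr
        refine (hz.driver j k hjk (by omega)).trans ?_
        gcongr
      _ = W * (((k : ℝ) - i) * δ) ^ (κ + μ) := by
        rw [Real.rpow_add' z0 (by linarith)]; ring
  have hsum : z j - z i = (∑ l ∈ Finset.Ico i j, F l (g (l + 1) - g l) - F i (g j - g i))
      + F i (g j - g i) + ∑ l ∈ Finset.Ico i j, (z (l + 1) - z l - F l (g (l + 1) - g l)) := by
    rw [Finset.sum_sub_distrib, Finset.sum_Ico_sub z hij]
    abel
  have x0 := grid_nonneg hδ hij
  have xh := len i j hi hij hj
  have xκ : (((j : ℝ) - i) * δ) ^ κ ≤ h ^ κ := Real.rpow_le_rpow x0 xh hκ.le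
  have t1 : ‖F i (g j - g i)‖ ≤ M * K * (S + Q * h ^ κ) * (((j : ℝ) - i) * δ) ^ μ := by
    refine (ContinuousLinearMap.le_opNorm _ _).trans ?_
    calc ‖F i‖ * ‖g j - g i‖
        ≤ (M * (S + Q * h ^ κ)) * (K * (((j : ℝ) - i) * δ) ^ μ) := by
          have := size i hi (hij.trans hj)
          have := hz.bound i (by omega)
          refine mul_le_mul (this.trans (by gcongr)) (hz.driver i j hij (by omega))
            (norm_nonneg _) (by positivity)
      _ = _ := by ring
  have t2 : ‖∑ l ∈ Finset.Ico i j, (z (l + 1) - z l - F l (g (l + 1) - g l))‖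
      ≤ M * (S + Q * h ^ κ) * (((j : ℝ) - i) * δ) ^ μ := by
    calc _ ≤ ∑ l ∈ Finset.Ico i j, M * (S + Q * h ^ κ) * δ := by
          refine (norm_sum_le _ _).trans (Finset.sum_le_sum fun l hl => ?_)
          rw [Finset.mem_Ico] at hl
          refine (hz.step l (by omega)).trans ?_
          have := size l (by omega) (by omega)
          gcongr
      _ = M * (S + Q * h ^ κ) * (((j : ℝ) - i) * δ) := by
          rw [Finset.sum_const, Nat.card_Ico, nsmul_eq_mul, Nat.cast_sub hij]; ring
      _ ≤ _ := by
          have : ((j : ℝ) - i) * δ ≤ (((j : ℝ) - i) * δ) ^ μ := by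
            simpa using Real.rpow_le_rpow_of_exponent_ge' x0 (xh.trans h1) hμ0.le hμ1
          gcongr
  have t3 : 2 * sewingConst (κ + μ) * W * (((j : ℝ) - i) * δ) ^ (κ + μ)
      ≤ 2 * sewingConst (κ + μ) * (M * K) * (S + 2 * Q * h ^ κ) * (((j : ℝ) - i) * δ) ^ μ := by
    rw [Real.rpow_add' x0 (by linarith), hW]
    calc 2 * sewingConst (κ + μ) * (M * K * (S + 2 * Q))
          * ((((j : ℝ) - i) * δ) ^ κ * (((j : ℝ) - i) * δ) ^ μ)
        ≤ 2 * sewingConst (κ + μ) * (M * K * (S + 2 * Q))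
          * (h ^ κ * (((j : ℝ) - i) * δ) ^ μ) := by gcongr
      _ = 2 * sewingConst (κ + μ) * (M * K) * (S * h ^ κ + 2 * Q * h ^ κ)
          * (((j : ℝ) - i) * δ) ^ μ := by ring
      _ ≤ 2 * sewingConst (κ + μ) * (M * K) * (S + 2 * Q * h ^ κ)
          * (((j : ℝ) - i) * δ) ^ μ := by
          gcongr
          exact mul_le_of_le_one_right hS0 hhκ1
  rw [hsum]
  refine norm_add₃_le.trans ((add_le_add_three (hsew.trans t3) t1 t2).trans (le_of_eq ?_))
  ring

/-- On a window whose length is so small that the factor in `DiscreteYoung.improve` is at most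
`1 / 2`, the Hölder constant is bounded by the size at the left endpoint of the window. -/
lemma DiscreteYoung.window {μ κ M K δ η : ℝ} {N : ℕ} {z : ℕ → E} {F : ℕ → G →L[ℝ] E}
    {g : ℕ → G} (hz : DiscreteYoung μ κ M K δ N η z F g) (hμ1 : μ ≤ 1) (hκ : 0 < κ)
    (hκμ : κ ≤ μ) (hθ : 1 < κ + μ) (hM : 0 ≤ M) (hK : 0 ≤ K) (hδ : 0 < δ) (hη : 0 ≤ η)
    {h : ℝ} (h0 : 0 < h) (h1 : h ≤ 1)
    (hh : (M * K + 4 * sewingConst (κ + μ) * (M * K) + M) * h ^ κ ≤ 1 / 2)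
    {p q : ℕ} (hq : q ≤ N) (hpq : ((q : ℝ) - p) * δ ≤ h)
    {i j : ℕ} (hi : p ≤ i) (hij : i ≤ j) (hj : j ≤ q) :
    ‖z j - z i‖ ≤ 2 * ((M * K + 2 * sewingConst (κ + μ) * (M * K) + M) * (‖z p‖ + η))
        * (((j : ℝ) - i) * δ) ^ μ := by
  have hsc := sewingConst_pos hθ
  let ι := {u : ℕ × ℕ // p ≤ u.1 ∧ u.1 ≤ u.2 ∧ u.2 ≤ q}
  let x : ι → ℝ := fun u => ‖z u.1.2 - z u.1.1‖
  let w : ι → ℝ := fun u => (((u.1.2 : ℝ) - u.1.1) * δ) ^ μ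
  have hw : ∀ u, 0 ≤ w u := fun u => Real.rpow_nonneg (grid_nonneg hδ.le u.2.2.1) _
  -- on a finite grid some Hölder bound holds for trivial reasons
  obtain ⟨Q₀, hQ₀, hb⟩ : ∃ Q₀ : ℝ, 0 ≤ Q₀ ∧ ∀ u, x u ≤ Q₀ * w u := by
    refine ⟨(∑ a ∈ Finset.range (q + 1), ∑ b ∈ Finset.range (q + 1), ‖z b - z a‖) / δ ^ μ,
      by positivity, ?_⟩
    rintro ⟨⟨a, b⟩, ha, hab, hb⟩
    simp only [x, w]
    simp only at ha hab hb
    rcases hab.eq_or_lt with rfl | hlt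
    · have : 0 ≤ (((a : ℝ) - a) * δ) ^ μ := Real.rpow_nonneg (by simp) _
      simp only [sub_self, norm_zero, zero_mul] at *
      positivity
    · have e1 : ‖z b - z a‖ ≤
          ∑ a ∈ Finset.range (q + 1), ∑ b ∈ Finset.range (q + 1), ‖z b - z a‖ := by
        refine le_trans ?_ (Finset.single_le_sum (fun a _ => Finset.sum_nonneg fun b _ =>
          norm_nonneg _) (Finset.mem_range.2 (by omega : a < q + 1)))
        exact Finset.single_le_sum (f := fun b => ‖z b - z a‖) (fun b _ => norm_nonneg _)
          (Finset.mem_range.2 (by omega : b < q + 1))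
      have e2 : δ ^ μ ≤ (((b : ℝ) - a) * δ) ^ μ := by
        have : (1 : ℝ) ≤ b - a := by
          rw [← Nat.cast_sub hab]; exact_mod_cast (by omega : 1 ≤ b - a)
        apply Real.rpow_le_rpow hδ.le _ (by linarith)
        nlinarith
      have e3 : 0 < δ ^ μ := Real.rpow_pos_of_pos hδ _
      calc ‖z b - z a‖ ≤ _ := e1
        _ = (∑ a ∈ Finset.range (q + 1), ∑ b ∈ Finset.range (q + 1), ‖z b - z a‖) / δ ^ μ
            * δ ^ μ := by field_simp
        _ ≤ _ := by gcongr
  refine le_two_mul_of_improve (x := x) (w := w) hw hQ₀ (by positivity) hb ?_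
    ⟨(i, j), hi, hij, hj⟩
  intro Q hQ hQb u
  refine (hz.improve hμ1 hκ hκμ hθ hM hK hδ.le hη h0 h1 hq hpq hQ
    (fun i j hi hij hj => hQb ⟨(i, j), hi, hij, hj⟩) u.2.1 u.2.2.1 u.2.2.2).trans ?_
  refine mul_le_mul_of_nonneg_right ?_ (hw u)
  have := mul_le_mul_of_nonneg_right hh hQ
  linarith

/-- A solution of a discrete Young equation is bounded and Hölder continuous, with constants
that do not depend on the mesh of the grid and that are linear in the size of the data. -/
theorem DiscreteYoung.exists_bound {μ κ M K T : ℝ} (hμ1 : μ ≤ 1) (hκ : 0 < κ)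
    (hκμ : κ ≤ μ) (hθ : 1 < κ + μ) (hM : 0 ≤ M) (hK : 0 ≤ K) (hT : 0 ≤ T) :
    ∃ C : ℝ, 1 ≤ C ∧ ∀ (δ : ℝ) (N : ℕ) (η : ℝ) (z : ℕ → E) (F : ℕ → G →L[ℝ] E) (g : ℕ → G),
      0 < δ → N * δ ≤ T → 0 ≤ η → DiscreteYoung μ κ M K δ N η z F g →
      (∀ n ≤ N, ‖z n‖ + η ≤ C * (‖z 0‖ + η)) ∧
      ∀ i j, i ≤ j → j ≤ N → ‖z j - z i‖ ≤ C * (‖z 0‖ + η) * (((j : ℝ) - i) * δ) ^ μ := by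
  have hsc := sewingConst_pos hθ
  have hμ0 : 0 < μ := by linarith
  set c₁ := M * K + 2 * sewingConst (κ + μ) * (M * K) + M with hc₁
  set c₂ := M * K + 4 * sewingConst (κ + μ) * (M * K) + M with hc₂
  have hc₁0 : 0 ≤ c₁ := by positivity
  have hc₂0 : 0 ≤ c₂ := by positivity
  obtain ⟨h, h0, h1, hh⟩ : ∃ h : ℝ, 0 < h ∧ h ≤ 1 ∧ c₂ * h ^ κ ≤ 1 / 2 := by
    refine ⟨(1 / (2 * (c₂ + 1))) ^ (1 / κ), by positivity, ?_, ?_⟩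
    · apply Real.rpow_le_one (by positivity) _ (by positivity)
      rw [div_le_one (by positivity)]; linarith
    · rw [← Real.rpow_mul (by positivity), one_div_mul_cancel hκ.ne', Real.rpow_one]
      rw [mul_one_div, div_le_div_iff₀ (by positivity) (by positivity)]; linarith
  set Γ := 1 + 2 * c₁ + M * K * T ^ μ + M * T with hΓ
  have hΓ1 : 1 ≤ Γ := by
    have : 0 ≤ 2 * c₁ + M * K * T ^ μ + M * T := by positivity
    linarith
  set D := Γ ^ (2 * T / h + 1) with hD
  have hD1 : 1 ≤ D := Real.one_le_rpow hΓ1 (by positivity)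
  refine ⟨D + 2 * c₁ * D + 2 * D * (h ^ μ)⁻¹, ?_, ?_⟩
  · have : 0 ≤ 2 * c₁ * D + 2 * D * (h ^ μ)⁻¹ := by positivity
    linarith
  intro δ N η z F g hδ hN hη hz
  -- growth over a window of length at most `h`, or of a single step
  have grow : ∀ p q, p ≤ q → q ≤ N → ((q : ℝ) - p) * δ ≤ h ∨ q = p + 1 →
      ‖z q‖ + η ≤ Γ * (‖z p‖ + η) := by
    intro p q hpq hq hor
    have hS : 0 ≤ ‖z p‖ + η := by positivity
    have a0 : ‖z q‖ ≤ ‖z p‖ + ‖z q - z p‖ := norm_le_norm_add_norm_sub' _ _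
    rcases hor with hle | rfl
    · have a1 := hz.window hμ1 hκ hκμ hθ hM hK hδ hη h0 h1 hh hq hle le_rfl hpq le_rfl
      have a2 : (((q : ℝ) - p) * δ) ^ μ ≤ 1 :=
        Real.rpow_le_one (grid_nonneg hδ.le hpq) (hle.trans h1) hμ0.le
      have a3 := mul_le_of_le_one_right (by positivity : 0 ≤ 2 * (c₁ * (‖z p‖ + η))) a2
      have a4 : 0 ≤ (M * K * T ^ μ + M * T) * (‖z p‖ + η) := by positivity
      rw [hΓ]
      linarith
    · have b1 := hz.step p (by omega)
      have b2 := hz.driver p (p + 1) (by omega) hq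
      have b3 := hz.bound p (by omega)
      have hδT : δ ≤ T := by
        have : (1 : ℝ) ≤ N := by exact_mod_cast (by omega : 1 ≤ N)
        nlinarith
      have b4 : ((((p + 1 : ℕ) : ℝ) - p) * δ) ^ μ ≤ T ^ μ := by
        push_cast
        rw [add_sub_cancel_left, one_mul]
        exact Real.rpow_le_rpow hδ.le hδT hμ0.le
      have b5 : ‖F p (g (p + 1) - g p)‖ ≤ M * (‖z p‖ + η) * (K * T ^ μ) := by
        refine (ContinuousLinearMap.le_opNorm _ _).trans ?_
        refine mul_le_mul b3 (b2.trans (by gcongr)) (norm_nonneg _) (by positivity)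
      have b6 : ‖z (p + 1) - z p‖ ≤ ‖z (p + 1) - z p - F p (g (p + 1) - g p)‖
          + ‖F p (g (p + 1) - g p)‖ := norm_le_norm_sub_add _ _
      have b7 : M * (‖z p‖ + η) * δ ≤ M * (‖z p‖ + η) * T := by gcongr
      have b8 : 0 ≤ 2 * c₁ * (‖z p‖ + η) := by positivity
      rw [hΓ]
      linarith
  have size : ∀ n, n ≤ N → ‖z n‖ + η ≤ Γ ^ (2 * (n * δ) / h + 1) * (‖z 0‖ + η) := by
    intro n
    induction n using Nat.strong_induction_on with
    | _ n ih =>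
    intro hn
    set k := max 1 ⌊h / δ⌋₊ with hk
    have hk1 : 1 ≤ k := le_max_left _ _
    have hor : (k : ℝ) * δ ≤ h ∨ k = 1 := by
      rcases le_total 1 ⌊h / δ⌋₊ with hf | hf
      · left
        rw [hk, max_eq_right hf, ← le_div_iff₀ hδ]
        exact Nat.floor_le (by positivity)
      · right
        rw [hk, max_eq_left hf]
    have hk2 : h / 2 ≤ k * δ := by
      have a1 : h / δ < ⌊h / δ⌋₊ + 1 := Nat.lt_floor_add_one _
      have a2 : (⌊h / δ⌋₊ : ℝ) ≤ k := by exact_mod_cast le_max_right _ _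
      have a3 : (1 : ℝ) ≤ k := by exact_mod_cast hk1
      rw [div_lt_iff₀ hδ] at a1
      nlinarith
    have hz0 : 0 ≤ ‖z 0‖ + η := by positivity
    rcases le_or_gt n k with hnk | hnk
    · have : ((n : ℝ) - (0 : ℕ)) * δ ≤ h ∨ n = 0 + 1 ∨ n = 0 := by
        rcases hor with ho | ho
        · left
          have : (n : ℝ) ≤ k := by exact_mod_cast hnk
          rw [Nat.cast_zero, sub_zero]
          nlinarith
        · right; omega
      have a1 : ‖z n‖ + η ≤ Γ * (‖z 0‖ + η) := by
        rcases this with ho | ho | ho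
        · exact grow 0 n (by omega) hn (Or.inl ho)
        · exact grow 0 n (by omega) hn (Or.inr ho)
        · rw [ho]; exact le_mul_of_one_le_left hz0 hΓ1
      refine a1.trans (mul_le_mul_of_nonneg_right ?_ hz0)
      conv_lhs => rw [← Real.rpow_one Γ]
      apply Real.rpow_le_rpow_of_exponent_le hΓ1
      have : 0 ≤ 2 * (n * δ) / h := by positivity
      linarith
    · have hc : (((n - k : ℕ) : ℝ)) = n - k := Nat.cast_sub hnk.le
      have a1 := ih (n - k) (by omega) (by omega)
      have a2 := grow (n - k) n (by omega) hn (by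
        rcases hor with ho | ho
        · left; rw [hc]; simpa using ho
        · right; omega)
      refine a2.trans ?_
      calc Γ * (‖z (n - k)‖ + η)
          ≤ Γ ^ (1 : ℝ) * (Γ ^ (2 * ((n - k : ℕ) * δ) / h + 1) * (‖z 0‖ + η)) := by
            rw [Real.rpow_one]; gcongr
        _ = Γ ^ (1 + (2 * ((n - k : ℕ) * δ) / h + 1)) * (‖z 0‖ + η) := by
            rw [Real.rpow_add (by linarith : 0 < Γ) 1]; ring
        _ ≤ _ := by
            refine mul_le_mul_of_nonneg_right ?_ hz0
            apply Real.rpow_le_rpow_of_exponent_le hΓ1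
            have : 1 + 2 * ((n - k : ℕ) * δ) / h ≤ 2 * (n * δ) / h := by
              rw [hc, ← sub_nonneg]
              have : 2 * (n * δ) / h - (1 + 2 * (((n : ℝ) - k) * δ) / h)
                = 2 * (k * δ - h / 2) / h := by field_simp; ring
              rw [this]
              apply div_nonneg _ h0.le
              linarith
            linarith
  have size' : ∀ n, n ≤ N → ‖z n‖ + η ≤ D * (‖z 0‖ + η) := by
    intro n hn
    refine (size n hn).trans (mul_le_mul_of_nonneg_right ?_ (by positivity))
    apply Real.rpow_le_rpow_of_exponent_le hΓ1
    have : (n : ℝ) ≤ N := by exact_mod_cast hn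
    gcongr
    exact le_trans (by gcongr) hN
  have hz0 : 0 ≤ ‖z 0‖ + η := by positivity
  have hhμ : 0 < h ^ μ := Real.rpow_pos_of_pos h0 _
  refine ⟨fun n hn => (size' n hn).trans (mul_le_mul_of_nonneg_right ?_ hz0), ?_⟩
  · have : 0 ≤ 2 * c₁ * D + 2 * D * (h ^ μ)⁻¹ := by positivity
    linarith
  intro i j hij hj
  have x0 := Real.rpow_nonneg (grid_nonneg hδ.le hij) μ
  rcases le_total (((j : ℝ) - i) * δ) h with hle | hle
  · have a1 := hz.window hμ1 hκ hκμ hθ hM hK hδ hη h0 h1 hh hj hle le_rfl hij le_rfl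
    refine a1.trans (mul_le_mul_of_nonneg_right ?_ x0)
    have a2 := mul_le_mul_of_nonneg_left (size' i (hij.trans hj))
      (by positivity : 0 ≤ 2 * c₁)
    have a3 : 0 ≤ (D + 2 * D * (h ^ μ)⁻¹) * (‖z 0‖ + η) := by positivity
    linarith
  · have a1 := size' i (hij.trans hj)
    have a2 := size' j hj
    have a3 : ‖z j - z i‖ ≤ ‖z j‖ + ‖z i‖ := norm_sub_le _ _
    have a4 : 1 ≤ (h ^ μ)⁻¹ * (((j : ℝ) - i) * δ) ^ μ := by
      rw [inv_mul_eq_div, one_le_div hhμ]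
      exact Real.rpow_le_rpow h0.le hle hμ0.le
    calc ‖z j - z i‖ ≤ 2 * D * (‖z 0‖ + η) * 1 := by linarith
      _ ≤ 2 * D * (‖z 0‖ + η) * ((h ^ μ)⁻¹ * (((j : ℝ) - i) * δ) ^ μ) := by gcongr
      _ = 2 * D * (h ^ μ)⁻¹ * (‖z 0‖ + η) * (((j : ℝ) - i) * δ) ^ μ := by ring
      _ ≤ _ := by
        have : 0 ≤ D + 2 * c₁ * D := by positivity
        gcongr
        linarith

end DiscreteYoung

/-! ### Fractional derivatives -/

/-- The right-sided derivative is a left-sided one after time reversal. -/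
lemma fracDerivRight_eq (α : ℝ) (g : ℝ → ℝ) (b s : ℝ) :
    fracDerivRight α g b s = fracDerivLeft (1 - α) (fun v => g (b - v) - g b) 0 (b - s) := by
  unfold fracDerivRight fracDerivLeft
  have h : ∫ u in (0 : ℝ)..(b - s),
      (g (b - (b - s)) - g b - (g (b - u) - g b)) / (b - s - u) ^ (1 - α + 1)
      = ∫ u in s..b, (g s - g u) / (u - s) ^ (2 - α) := by
    have := intervalIntegral.integral_comp_sub_left (a := 0) (b := b - s)
      (fun u => (g s - g u) / (u - s) ^ (2 - α)) b
    rw [sub_sub_cancel, sub_zero] at this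
    rw [← this]
    congr 1
    ext u
    congr 1
    · rw [sub_sub_cancel]; ring
    · congr 1 <;> ring
  rw [h]
  simp only [sub_sub_cancel, sub_zero]

lemma rpow_sub_intervalIntegrable {r : ℝ} (hr : -1 < r) (s : ℝ) :
    IntervalIntegrable (fun u => (s - u) ^ r) volume 0 s := by
  have := (intervalIntegral.intervalIntegrable_rpow' (a := 0) (b := s) hr).comp_sub_left s
  simpa using this.symm

lemma integral_rpow_sub {r : ℝ} (hr : -1 < r) (s : ℝ) :
    ∫ u in (0 : ℝ)..s, (s - u) ^ r = s ^ (r + 1) / (r + 1) := by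
  rw [intervalIntegral.integral_comp_sub_left (fun u => u ^ r) s, sub_self, sub_zero,
    integral_rpow (Or.inl hr), Real.zero_rpow (by linarith), sub_zero]

lemma abs_fracDeriv_integrand_le {α ν K b : ℝ} {f : ℝ → ℝ}
    (hf : ∀ s ∈ Icc 0 b, ∀ t ∈ Icc 0 b, |f t - f s| ≤ K * |t - s| ^ ν)
    {s u : ℝ} (hsb : s ≤ b) (hu : 0 ≤ u) (hus : u < s) :
    |(f s - f u) / (s - u) ^ (α + 1)| ≤ K * (s - u) ^ (ν - α - 1) := by
  have hpos : 0 < s - u := sub_pos.2 hus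
  have h1 := hf u ⟨hu, by linarith⟩ s ⟨by linarith, hsb⟩
  rw [abs_of_pos hpos] at h1
  have h2 : 0 < (s - u) ^ (α + 1) := Real.rpow_pos_of_pos hpos _
  rw [abs_div, abs_of_pos h2, div_le_iff₀ h2, mul_assoc, ← Real.rpow_add hpos]
  rwa [show ν - α - 1 + (α + 1) = ν by ring]

/-- The fractional derivative of a function that is Hölder continuous of an order larger than `α`
has at most the integrable singularity `s ^ (-α)` at `0`. -/
lemma abs_fracDerivLeft_le {α ν K A b : ℝ} {f : ℝ → ℝ} (hα0 : 0 < α) (hα1 : α < 1) (hαν : α < ν)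
    (hf : ∀ s ∈ Icc 0 b, ∀ t ∈ Icc 0 b, |f t - f s| ≤ K * |t - s| ^ ν)
    {s : ℝ} (hs : 0 < s) (hsb : s ≤ b) (hA : |f s| ≤ A) :
    |fracDerivLeft α f 0 s| ≤ (1 / Real.Gamma (1 - α)) *
      (A * s ^ (-α) + α * (K * (s ^ (ν - α) / (ν - α)))) := by
  have hG : 0 < Real.Gamma (1 - α) := Real.Gamma_pos_of_pos (by linarith)
  unfold fracDerivLeft
  rw [abs_mul, abs_of_pos (one_div_pos.2 hG), sub_zero]
  refine mul_le_mul_of_nonneg_left ?_ (one_div_pos.2 hG).le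
  refine (abs_add_le _ _).trans (add_le_add ?_ ?_)
  · rw [abs_div, abs_of_pos (Real.rpow_pos_of_pos hs _), Real.rpow_neg hs.le, div_eq_mul_inv]
    have := Real.rpow_pos_of_pos hs α
    gcongr
  · rw [abs_mul, abs_of_pos hα0]
    refine mul_le_mul_of_nonneg_left ?_ hα0.le
    have e : K * (s ^ (ν - α) / (ν - α)) = ∫ u in (0 : ℝ)..s, K * (s - u) ^ (ν - α - 1) := by
      rw [intervalIntegral.integral_const_mul, integral_rpow_sub (by linarith)]
      ring_nf
    rw [e, ← Real.norm_eq_abs]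
    refine intervalIntegral.norm_integral_le_of_norm_le hs.le ?_
      ((rpow_sub_intervalIntegrable (by linarith) s).const_mul K)
    filter_upwards [compl_mem_ae_iff.2 (measure_singleton s)] with u hu hu'
    rw [Real.norm_eq_abs]
    exact abs_fracDeriv_integrand_le hf hsb hu'.1.le (lt_of_le_of_ne hu'.2 hu)

lemma stronglyMeasurable_fracDerivLeft_aux (α : ℝ) {f : ℝ → ℝ} (hf : Continuous f) :
    StronglyMeasurable fun s => (1 / Real.Gamma (1 - α)) *
      (f s / (s - 0) ^ α + α * ∫ u, {z : ℝ × ℝ | 0 < z.2 ∧ z.2 ≤ z.1}.indicator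
        (fun z => (f z.1 - f z.2) / (z.1 - z.2) ^ (α + 1)) (s, u)) := by
  refine StronglyMeasurable.const_mul (StronglyMeasurable.add ?_
    (StronglyMeasurable.const_mul ?_ _)) _
  · exact (by fun_prop : Measurable fun s => f s / (s - 0) ^ α).stronglyMeasurable
  · refine StronglyMeasurable.integral_prod_right' (ν := volume) (f := fun z : ℝ × ℝ =>
      {z : ℝ × ℝ | 0 < z.2 ∧ z.2 ≤ z.1}.indicator
        (fun z => (f z.1 - f z.2) / (z.1 - z.2) ^ (α + 1)) z) ?_
    refine Measurable.stronglyMeasurable (Measurable.indicator (by fun_prop) ?_)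
    exact (measurableSet_lt measurable_const measurable_snd).inter
      (measurableSet_le measurable_snd measurable_fst)

lemma aestronglyMeasurable_fracDerivLeft (α : ℝ) {f : ℝ → ℝ} (hf : Continuous f) (b : ℝ) :
    AEStronglyMeasurable (fracDerivLeft α f 0) (volume.restrict (Ioc 0 b)) := by
  refine (stronglyMeasurable_fracDerivLeft_aux α hf).aestronglyMeasurable.congr ?_
  filter_upwards [ae_restrict_mem measurableSet_Ioc] with s hs
  unfold fracDerivLeft
  rw [intervalIntegral.integral_of_le hs.1.le, ← integral_indicator measurableSet_Ioc]
  rfl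

lemma intervalIntegrable_fracDeriv_bound {α ν : ℝ} (hα1 : α < 1) (hαν : α < ν) (A K b : ℝ) :
    IntervalIntegrable (fun s : ℝ => (1 / Real.Gamma (1 - α)) *
      (A * s ^ (-α) + α * (K * (s ^ (ν - α) / (ν - α))))) volume 0 b := by
  have h1 : IntervalIntegrable (fun s : ℝ => s ^ (-α)) volume 0 b :=
    intervalIntegral.intervalIntegrable_rpow' (by linarith)
  have h2 : IntervalIntegrable (fun s : ℝ => s ^ (ν - α)) volume 0 b :=
    intervalIntegral.intervalIntegrable_rpow' (by linarith)
  exact ((h1.const_mul A).add (((h2.div_const _).const_mul K).const_mul α)).const_mul _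

lemma integrableOn_fracDerivLeft {α ν K b : ℝ} {f : ℝ → ℝ} (hα0 : 0 < α) (hα1 : α < 1)
    (hαν : α < ν) (hb : 0 ≤ b) (hfc : Continuous f)
    (hf : ∀ s ∈ Icc 0 b, ∀ t ∈ Icc 0 b, |f t - f s| ≤ K * |t - s| ^ ν) :
    IntegrableOn (fracDerivLeft α f 0) (Ioc 0 b) := by
  obtain ⟨A, hA⟩ := (isCompact_Icc (a := (0 : ℝ)) (b := b)).exists_bound_of_continuousOn
    hfc.continuousOn
  refine Integrable.mono' ((intervalIntegrable_iff_integrableOn_Ioc_of_le hb).1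
    (intervalIntegrable_fracDeriv_bound hα1 hαν A K b))
    (aestronglyMeasurable_fracDerivLeft α hfc b) ?_
  filter_upwards [ae_restrict_mem measurableSet_Ioc] with s hs
  exact abs_fracDerivLeft_le hα0 hα1 hαν hf hs.1 hs.2 (hA s (Ioc_subset_Icc_self hs))

/-- A continuously differentiable function is Lipschitz on `[0, b]`. The exponent `1` is written
out to match the assumptions of the estimates for Hölder continuous functions. -/
lemma exists_lipschitz_of_deriv {f f' : ℝ → ℝ} (hf : ∀ t, HasDerivAt f (f' t) t)
    (hf' : Continuous f') (b : ℝ) : ∃ K, 0 ≤ K ∧ (∀ t ∈ Icc 0 b, |f' t| ≤ K) ∧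
      ∀ s ∈ Icc 0 b, ∀ t ∈ Icc 0 b, |f t - f s| ≤ K * |t - s| ^ (1 : ℝ) := by
  obtain ⟨K, hK⟩ := (isCompact_Icc (a := (0 : ℝ)) (b := b)).exists_bound_of_continuousOn
    hf'.continuousOn
  refine ⟨max K 0, le_max_right _ _, fun t ht => (hK t ht).trans (le_max_left _ _), ?_⟩
  intro s hs t ht
  rw [Real.rpow_one]
  exact (convex_Icc (0 : ℝ) b).norm_image_sub_le_of_norm_hasDerivWithin_le
    (fun x _ => (hf x).hasDerivWithinAt) (fun x hx => (hK x hx).trans (le_max_left _ _)) hs ht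

/-- For a continuously differentiable function, the left-sided derivative of order `α` is the
fractional integral of order `1 - α` of the derivative, plus a boundary term. -/
lemma fracDerivLeft_eq_of_deriv {α : ℝ} (hα1 : α < 1) {f f' : ℝ → ℝ}
    (hf : ∀ t, HasDerivAt f (f' t) t) (hf' : Continuous f') {s : ℝ} (hs : 0 < s) :
    fracDerivLeft α f 0 s = (1 / Real.Gamma (1 - α)) *
      (f 0 * s ^ (-α) + ∫ u in (0 : ℝ)..s, f' u * (s - u) ^ (-α)) := by
  obtain ⟨K, hK0, hK', hK⟩ := exists_lipschitz_of_deriv hf hf' s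
  have hfc : Continuous f := continuous_iff_continuousAt.2 fun t => (hf t).continuousAt
  have hI1 : IntervalIntegrable (fun u => f' u * (s - u) ^ (-α)) volume 0 s :=
    (rpow_sub_intervalIntegrable (by linarith) s).continuousOn_mul hf'.continuousOn
  have hI2 : IntervalIntegrable (fun u => (f s - f u) / (s - u) ^ (α + 1)) volume 0 s := by
    refine ((rpow_sub_intervalIntegrable (r := 1 - α - 1) (by linarith) s).const_mul
      K).mono_fun ?_ ?_
    · exact (by fun_prop : Measurable fun u => (f s - f u) / (s - u) ^ (α + 1)).aestronglyMeasurable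
    · rw [uIoc_of_le hs.le]
      filter_upwards [ae_restrict_mem measurableSet_Ioc,
        ae_restrict_of_ae (compl_mem_ae_iff.2 (measure_singleton s))] with u hu hu'
      rw [Real.norm_eq_abs, Real.norm_eq_abs]
      exact (abs_fracDeriv_integrand_le hK le_rfl hu.1.le (lt_of_le_of_ne hu.2 hu')).trans
        (le_abs_self _)
  have hG : ∫ u in (0 : ℝ)..s, (-(f' u * (s - u) ^ (-α)) + α * ((f s - f u) / (s - u) ^ (α + 1)))
      = (f s - f s) * (s - s) ^ (-α) - (f s - f 0) * (s - 0) ^ (-α) := by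
    refine intervalIntegral.integral_eq_sub_of_hasDerivAt_of_le hs.le
      (f := fun u => (f s - f u) * (s - u) ^ (-α)) ?_ ?_ (hI1.neg.add (hI2.const_mul α))
    · intro u hu
      rcases hu.2.eq_or_lt with rfl | hlt
      · -- the difference quotient absorbs the singularity at the right endpoint
        have hz : (f u - f u) * (u - u) ^ (-α) = 0 := by simp
        have hlim : Filter.Tendsto (fun v => K * |u - v| ^ (1 - α))
            (nhdsWithin u (Icc 0 u)) (nhds 0) := by
          have : ContinuousAt (fun v => K * |u - v| ^ (1 - α)) u := by
            refine continuousAt_const.mul (ContinuousAt.rpow_const (by fun_prop) ?_)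
            right; linarith
          have h2 := this.tendsto
          rw [sub_self, abs_zero, Real.zero_rpow (by linarith), mul_zero] at h2
          exact h2.mono_left nhdsWithin_le_nhds
        rw [ContinuousWithinAt, hz]
        refine squeeze_zero_norm' ?_ hlim
        filter_upwards [self_mem_nhdsWithin] with v hv
        rcases hv.2.eq_or_lt with rfl | hvu
        · simp only [sub_self, zero_mul, norm_zero, abs_zero]; positivity
        · have hp : 0 < u - v := sub_pos.2 hvu
          have h3 := hK v hv u ⟨hs.le, le_rfl⟩
          rw [Real.rpow_one, abs_of_pos hp] at h3
          rw [Real.norm_eq_abs, abs_mul, abs_of_pos (Real.rpow_pos_of_pos hp _), abs_of_pos hp,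
            sub_eq_add_neg 1 α, Real.rpow_add hp, Real.rpow_one, ← mul_assoc]
          have := Real.rpow_pos_of_pos hp (-α)
          gcongr
      · refine ContinuousAt.continuousWithinAt (ContinuousAt.mul (by fun_prop) ?_)
        exact ContinuousAt.rpow_const (by fun_prop) (Or.inl (sub_pos.2 hlt).ne')
    · intro u hu
      have hp : 0 < s - u := sub_pos.2 hu.2
      have h1 : HasDerivAt (fun u => f s - f u) (-f' u) u := (hf u).const_sub (f s)
      have h2 : HasDerivAt (fun u => (s - u) ^ (-α)) (-1 * (-α) * (s - u) ^ (-α - 1)) u :=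
        ((hasDerivAt_id u).const_sub s).rpow_const (Or.inl hp.ne')
      refine (h1.mul h2).congr_deriv ?_
      rw [div_eq_mul_inv, ← Real.rpow_neg hp.le, show -(α + 1) = -α - 1 by ring]
      ring
  have hI1' : IntervalIntegrable (fun u => -(f' u * (s - u) ^ (-α))) volume 0 s := hI1.neg
  rw [intervalIntegral.integral_add hI1' (hI2.const_mul α), intervalIntegral.integral_neg,
    intervalIntegral.integral_const_mul, sub_self, zero_mul, sub_zero] at hG
  unfold fracDerivLeft
  rw [sub_zero, div_eq_mul_inv (f s), ← Real.rpow_neg hs.le]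
  congr 1
  linarith

/-! ### The pathwise integral of smooth functions -/

/-- Exchange of the order of integration over the triangle `0 < s < u ≤ b`. -/
lemma integral_triangle_swap {p q k : ℝ → ℝ} {b : ℝ} (hb : 0 ≤ b)
    (hint : Integrable (fun z : ℝ × ℝ => (Ioc 0 b).indicator p z.1 * (Ioc 0 b).indicator q z.2 *
      (Ioo 0 b).indicator k (z.2 - z.1)) (volume.prod volume)) :
    ∫ s in (0 : ℝ)..b, p s * ∫ u in s..b, q u * k (u - s)
      = ∫ u in (0 : ℝ)..b, q u * ∫ s in (0 : ℝ)..u, p s * k (u - s) ∧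
    IntervalIntegrable (fun u => q u * ∫ s in (0 : ℝ)..u, p s * k (u - s)) volume 0 b := by
  have hint' := hint.integral_prod_right
  have hswap := integral_integral_swap (f := fun s u => (Ioc 0 b).indicator p s *
    (Ioc 0 b).indicator q u * (Ioo 0 b).indicator k (u - s)) hint
  have hL : ∀ s, (∫ u, (Ioc 0 b).indicator p s * (Ioc 0 b).indicator q u *
      (Ioo 0 b).indicator k (u - s))
      = (Ioc 0 b).indicator (fun s => p s * ∫ u in s..b, q u * k (u - s)) s := by
    intro s
    by_cases hs : s ∈ Ioc 0 b
    · simp only [indicator_of_mem hs, mul_assoc]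
      rw [integral_const_mul, intervalIntegral.integral_of_le hs.2,
        ← integral_indicator measurableSet_Ioc]
      congr 2
      ext u
      by_cases hu : u ∈ Ioc s b
      · rw [indicator_of_mem hu, indicator_of_mem (show u ∈ Ioc 0 b from ⟨hs.1.trans hu.1, hu.2⟩),
          indicator_of_mem]
        exact ⟨sub_pos.2 hu.1, by linarith [hs.1, hu.2]⟩
      · rw [indicator_of_notMem hu]
        by_cases hub : u ≤ b
        · rw [indicator_of_notMem (s := Ioo 0 b), mul_zero]
          intro h
          exact hu ⟨sub_pos.1 h.1, hub⟩
        · rw [indicator_of_notMem (s := Ioc 0 b), zero_mul]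
          exact fun h => hub h.2
    · simp [indicator_of_notMem hs]
  have hR : ∀ u, (∫ s, (Ioc 0 b).indicator p s * (Ioc 0 b).indicator q u *
      (Ioo 0 b).indicator k (u - s))
      = (Ioc 0 b).indicator (fun u => q u * ∫ s in (0 : ℝ)..u, p s * k (u - s)) u := by
    intro u
    by_cases hu : u ∈ Ioc 0 b
    · simp only [indicator_of_mem hu, mul_comm _ (q u), mul_assoc]
      rw [integral_const_mul, intervalIntegral.integral_of_le hu.1.le, integral_Ioc_eq_integral_Ioo,
        ← integral_indicator measurableSet_Ioo]
      congr 2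
      ext s
      by_cases hs : s ∈ Ioo 0 u
      · rw [indicator_of_mem hs,
          indicator_of_mem (show s ∈ Ioc 0 b from ⟨hs.1, hs.2.le.trans hu.2⟩), indicator_of_mem]
        exact ⟨sub_pos.2 hs.2, by linarith [hs.1, hu.2]⟩
      · rw [indicator_of_notMem hs]
        by_cases hs0 : 0 < s
        · rw [indicator_of_notMem (s := Ioo 0 b), mul_zero]
          intro h
          exact hs ⟨hs0, sub_pos.1 h.1⟩
        · rw [indicator_of_notMem (s := Ioc 0 b), zero_mul]
          exact fun h => hs0 h.1
    · simp [indicator_of_notMem hu]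
  simp only [hL, hR] at hswap hint'
  rw [integral_indicator measurableSet_Ioc, integral_indicator measurableSet_Ioc] at hswap
  rw [intervalIntegral.integral_of_le hb, intervalIntegral.integral_of_le hb, hswap]
  exact ⟨rfl, (intervalIntegrable_iff_integrableOn_Ioc_of_le hb).2
    ((integrable_indicator_iff measurableSet_Ioc).1 hint')⟩

lemma integrable_triangle_of_bdd_right {p q k : ℝ → ℝ} {b C : ℝ}
    (hp : IntegrableOn p (Ioc 0 b)) (hk : IntegrableOn k (Ioo 0 b)) (hq : Measurable q)
    (hC : ∀ u ∈ Ioc 0 b, |q u| ≤ C) :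
    Integrable (fun z : ℝ × ℝ => (Ioc 0 b).indicator p z.1 * (Ioc 0 b).indicator q z.2 *
      (Ioo 0 b).indicator k (z.2 - z.1)) (volume.prod volume) := by
  have h1 := ((hp.integrable_indicator measurableSet_Ioc).convolution_integrand
    (ContinuousLinearMap.mul ℝ ℝ) (hk.integrable_indicator measurableSet_Ioo)).swap
  have h2 := h1.bdd_mul (c := |C|) (f := fun z : ℝ × ℝ => (Ioc 0 b).indicator q z.2)
    (((hq.indicator measurableSet_Ioc).comp measurable_snd).aestronglyMeasurable)
    (Filter.Eventually.of_forall fun z => by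
      by_cases hz : z.2 ∈ Ioc 0 b
      · rw [indicator_of_mem hz]; exact (hC _ hz).trans (le_abs_self _)
      · rw [indicator_of_notMem hz, norm_zero]; positivity)
  refine h2.congr (Filter.Eventually.of_forall fun z => ?_)
  simp only [Function.comp, Prod.fst_swap, Prod.snd_swap, ContinuousLinearMap.mul_apply']
  ring

lemma integrable_triangle_of_bdd_left {p q k : ℝ → ℝ} {b C : ℝ}
    (hq : IntegrableOn q (Ioc 0 b)) (hk : IntegrableOn k (Ioo 0 b)) (hp : Measurable p)
    (hC : ∀ u ∈ Ioc 0 b, |p u| ≤ C) :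
    Integrable (fun z : ℝ × ℝ => (Ioc 0 b).indicator p z.1 * (Ioc 0 b).indicator q z.2 *
      (Ioo 0 b).indicator k (z.2 - z.1)) (volume.prod volume) := by
  have h1 := ((hq.integrable_indicator measurableSet_Ioc).convolution_integrand
    (ContinuousLinearMap.mul ℝ ℝ) (hk.integrable_indicator measurableSet_Ioo).comp_neg)
  have h2 := h1.bdd_mul (c := |C|) (f := fun z : ℝ × ℝ => (Ioc 0 b).indicator p z.1)
    (((hp.indicator measurableSet_Ioc).comp measurable_fst).aestronglyMeasurable)
    (Filter.Eventually.of_forall fun z => by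
      by_cases hz : z.1 ∈ Ioc 0 b
      · rw [indicator_of_mem hz]; exact (hC _ hz).trans (le_abs_self _)
      · rw [indicator_of_notMem hz, norm_zero]; positivity)
  refine h2.congr (Filter.Eventually.of_forall fun z => ?_)
  simp only [ContinuousLinearMap.mul_apply', neg_sub]
  ring

/-- The Beta integral that makes fractional integration of orders `α` and `1 - α` inverse to
differentiation. -/
lemma integral_rpow_mul_rpow_sub {α : ℝ} (hα0 : 0 < α) (hα1 : α < 1) {w : ℝ} (hw : 0 < w) :
    ∫ s in (0 : ℝ)..w, s ^ (-α) * (w - s) ^ (α - 1) = Real.Gamma (1 - α) * Real.Gamma α := by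
  have h1 : ∫ x in (0 : ℝ)..1, x ^ (-α) * (1 - x) ^ (α - 1)
      = Real.Gamma (1 - α) * Real.Gamma α := by
    have h2 := beta_eq_betaIntegralReal (1 - α) α (by linarith) hα0
    rw [beta, sub_add_cancel, Real.Gamma_one, div_one] at h2
    rw [h2, Complex.betaIntegral]
    have h3 : ∫ x in (0 : ℝ)..1, (x : ℂ) ^ (((1 - α : ℝ) : ℂ) - 1) * (1 - (x : ℂ)) ^ ((α : ℂ) - 1)
        = ∫ x in (0 : ℝ)..1, ((x ^ (-α) * (1 - x) ^ (α - 1) : ℝ) : ℂ) := by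
      apply intervalIntegral.integral_congr
      intro x hx
      rw [uIcc_of_le zero_le_one] at hx
      beta_reduce
      rw [Complex.ofReal_mul, Complex.ofReal_cpow hx.1, Complex.ofReal_cpow (by linarith [hx.2])]
      push_cast
      congr 2
      ring
    rw [h3, intervalIntegral.integral_ofReal, Complex.ofReal_re]
  rw [← h1]
  have h4 := intervalIntegral.integral_comp_mul_left (a := 0) (b := 1)
    (fun s => s ^ (-α) * (w - s) ^ (α - 1)) hw.ne'
  rw [mul_zero, mul_one, smul_eq_mul] at h4
  rw [eq_comm, inv_mul_eq_div, div_eq_iff hw.ne'] at h4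
  rw [h4, ← intervalIntegral.integral_mul_const]
  apply intervalIntegral.integral_congr_Ioo_of_le zero_le_one
  intro x hx
  have hx1 : 0 < 1 - x := sub_pos.2 hx.2
  beta_reduce
  rw [show w - w * x = w * (1 - x) by ring, Real.mul_rpow hw.le hx.1.le,
    Real.mul_rpow hw.le hx1.le]
  have : w ^ (-α) * w ^ (α - 1) * w = 1 := by
    rw [← Real.rpow_add hw, ← Real.rpow_add_one hw.ne', show -α + (α - 1) + 1 = 0 by ring,
      Real.rpow_zero]
  linear_combination (x ^ (-α) * (1 - x) ^ (α - 1)) * this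

lemma integrableOn_rpow_Ioo {r : ℝ} (hr : -1 < r) {b : ℝ} (hb : 0 ≤ b) :
    IntegrableOn (fun x : ℝ => x ^ r) (Ioo 0 b) :=
  ((intervalIntegrable_iff_integrableOn_Ioo_of_le hb).1
    (intervalIntegral.intervalIntegrable_rpow' hr))

/-- The fractional derivative of order `1 - α` of a continuously differentiable function, up to
sign, is the fractional integral of order `α` of the derivative. -/
lemma fracDerivRight_eq_of_deriv {α : ℝ} (hα0 : 0 < α) {g g' : ℝ → ℝ}
    (hg : ∀ t, HasDerivAt g (g' t) t) (hg' : Continuous g') {b s : ℝ} (hs : s < b) :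
    fracDerivRight α g b s = -((1 / Real.Gamma α) * ∫ u in s..b, g' u * (u - s) ^ (α - 1)) := by
  rw [fracDerivRight_eq, fracDerivLeft_eq_of_deriv (by linarith)
    (f' := fun v => -g' (b - v)) ?_ (by fun_prop) (sub_pos.2 hs)]
  · have h1 := intervalIntegral.integral_comp_sub_left (a := 0) (b := b - s)
      (fun u => g' u * (u - s) ^ (α - 1)) b
    rw [sub_sub_cancel, sub_zero] at h1
    rw [← h1]
    simp only [sub_sub_cancel, sub_zero, sub_self, zero_mul, zero_add, neg_mul,
      intervalIntegral.integral_neg, mul_neg, neg_sub]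
    congr 3
    ext u
    rw [show b - s - u = b - u - s by ring]
  · intro t
    have := ((hg (b - t)).comp t ((hasDerivAt_id t).const_sub b)).sub_const (g b)
    simpa using this

/-- The fractional integral of order `α` inverts the fractional derivative of order `α`, by Abel's
Beta integral. -/
lemma integral_fracDerivLeft_mul_rpow {α : ℝ} (hα0 : 0 < α) (hα1 : α < 1) {f f' : ℝ → ℝ}
    (hf : ∀ t, HasDerivAt f (f' t) t) (hf' : Continuous f') {w : ℝ} (hw : 0 < w) :
    ∫ s in (0 : ℝ)..w, fracDerivLeft α f 0 s * (w - s) ^ (α - 1) = Real.Gamma α * f w := by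
  have hG : 0 < Real.Gamma (1 - α) := Real.Gamma_pos_of_pos (by linarith)
  obtain ⟨K, hK0, hK', hK⟩ := exists_lipschitz_of_deriv hf hf' w
  have hint := integrable_triangle_of_bdd_left (p := f') (q := fun s => (w - s) ^ (α - 1))
    (k := fun x => x ^ (-α)) (b := w) (C := K)
    ((intervalIntegrable_iff_integrableOn_Ioc_of_le hw.le).1
      (rpow_sub_intervalIntegrable (by linarith) w))
    (integrableOn_rpow_Ioo (by linarith) hw.le) hf'.measurable
    (fun u hu => hK' u (Ioc_subset_Icc_self hu))
  obtain ⟨hswap, hI2⟩ := integral_triangle_swap hw.le hint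
  have hL : ∫ s in (0 : ℝ)..w, f' s * ∫ u in s..w, (w - u) ^ (α - 1) * (u - s) ^ (-α)
      = Real.Gamma (1 - α) * Real.Gamma α * (f w - f 0) := by
    rw [← intervalIntegral.integral_eq_sub_of_hasDerivAt (fun x _ => hf x)
      (hf'.intervalIntegrable 0 w), ← intervalIntegral.integral_const_mul]
    refine intervalIntegral.integral_congr_Ioo_of_le hw.le fun s hs => ?_
    have h2 := intervalIntegral.integral_comp_sub_right (a := s) (b := w)
      (fun y => y ^ (-α) * (w - s - y) ^ (α - 1)) s
    rw [sub_self, integral_rpow_mul_rpow_sub hα0 hα1 (sub_pos.2 hs.2)] at h2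
    rw [← h2, mul_comm]
    congr 2
    ext u
    rw [sub_sub_sub_cancel_right, mul_comm]
  rw [hL] at hswap
  have hI1 : IntervalIntegrable (fun s => s ^ (-α) * (w - s) ^ (α - 1)) volume 0 w := by
    -- a non-integrable function would have integral zero
    by_contra h
    have h1 := integral_rpow_mul_rpow_sub hα0 hα1 hw
    rw [intervalIntegral.integral_undef h] at h1
    exact (mul_pos hG (Real.Gamma_pos_of_pos hα0)).ne h1
  have hcongr : ∫ s in (0 : ℝ)..w, fracDerivLeft α f 0 s * (w - s) ^ (α - 1)
      = ∫ s in (0 : ℝ)..w, (1 / Real.Gamma (1 - α)) * (f 0 * (s ^ (-α) * (w - s) ^ (α - 1))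
        + (w - s) ^ (α - 1) * ∫ r in (0 : ℝ)..s, f' r * (s - r) ^ (-α)) := by
    refine intervalIntegral.integral_congr_Ioo_of_le hw.le fun s hs => ?_
    rw [fracDerivLeft_eq_of_deriv hα1 hf hf' hs.1]
    ring
  rw [hcongr, intervalIntegral.integral_const_mul,
    intervalIntegral.integral_add (hI1.const_mul _) hI2, intervalIntegral.integral_const_mul,
    integral_rpow_mul_rpow_sub hα0 hα1 hw, ← hswap]
  field_simp
  ring

/-- For continuously differentiable functions, the pathwise integral is `∫ f g'`. -/
theorem pathInt_eq_of_deriv {α : ℝ} (hα0 : 0 < α) (hα1 : α < 1) {f f' g g' : ℝ → ℝ}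
    (hf : ∀ t, HasDerivAt f (f' t) t) (hf' : Continuous f')
    (hg : ∀ t, HasDerivAt g (g' t) t) (hg' : Continuous g') {b : ℝ} (hb : 0 ≤ b) :
    pathInt α f g 0 b = ∫ u in (0 : ℝ)..b, f u * g' u := by
  have hG : 0 < Real.Gamma α := Real.Gamma_pos_of_pos hα0
  have hfc : Continuous f := continuous_iff_continuousAt.2 fun t => (hf t).continuousAt
  obtain ⟨K, hK0, hK', hK⟩ := exists_lipschitz_of_deriv hf hf' b
  obtain ⟨D, hD0, hD', hD⟩ := exists_lipschitz_of_deriv hg hg' b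
  have hp := integrableOn_fracDerivLeft hα0 hα1 hα1 hb hfc hK
  obtain ⟨hswap, -⟩ := integral_triangle_swap hb (integrable_triangle_of_bdd_right (q := g')
    (k := fun x => x ^ (α - 1)) hp (integrableOn_rpow_Ioo (by linarith) hb) hg'.measurable
    (fun u hu => hD' u (Ioc_subset_Icc_self hu)))
  unfold pathInt
  have h1 : ∫ s in (0 : ℝ)..b, fracDerivLeft α f 0 s * fracDerivRight α g b s
      = ∫ s in (0 : ℝ)..b, -(1 / Real.Gamma α) *
        (fracDerivLeft α f 0 s * ∫ u in s..b, g' u * (u - s) ^ (α - 1)) := by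
    refine intervalIntegral.integral_congr_Ioo_of_le hb fun s hs => ?_
    rw [fracDerivRight_eq_of_deriv hα0 hg hg' hs.2]
    ring
  rw [h1, intervalIntegral.integral_const_mul, hswap, neg_mul, neg_neg,
    ← intervalIntegral.integral_const_mul]
  refine intervalIntegral.integral_congr_Ioo_of_le hb fun u hu => ?_
  rw [integral_fracDerivLeft_mul_rpow hα0 hα1 hf hf' hu.1]
  field_simp

/-! ### The pathwise integral of Hölder continuous functions -/

/-- The Steklov average of `f` over `[t, t + ε]`. -/
noncomputable def steklov (ε : ℝ) (f : ℝ → ℝ) (t : ℝ) : ℝ := ε⁻¹ * ∫ u in t..(t + ε), f u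

lemma hasDerivAt_steklov {f : ℝ → ℝ} (hf : Continuous f) (ε t : ℝ) :
    HasDerivAt (steklov ε f) (ε⁻¹ * (f (t + ε) - f t)) t := by
  have h : ∀ x, HasDerivAt (fun x => ∫ u in (0 : ℝ)..x, f u) (f x) x := fun x =>
    intervalIntegral.integral_hasDerivAt_right (hf.intervalIntegrable _ _)
      (hf.stronglyMeasurableAtFilter _ _) hf.continuousAt
  have h1 : HasDerivAt (fun t => (∫ u in (0 : ℝ)..(t + ε), f u) - ∫ u in (0 : ℝ)..t, f u)
      (f (t + ε) - f t) t := ((h (t + ε)).comp_add_const t ε).sub (h t)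
  refine (h1.const_mul ε⁻¹).congr_of_eventuallyEq (Filter.Eventually.of_forall fun x => ?_)
  simp only [steklov]
  rw [intervalIntegral.integral_interval_sub_left (hf.intervalIntegrable _ _)
    (hf.intervalIntegrable _ _)]

lemma steklov_sub {f : ℝ → ℝ} (hf : Continuous f) (ε s t : ℝ) :
    steklov ε f t - steklov ε f s = ε⁻¹ * ∫ r in (0 : ℝ)..ε, (f (t + r) - f (s + r)) := by
  have h : ∀ t, ∫ u in t..(t + ε), f u = ∫ r in (0 : ℝ)..ε, f (t + r) := by
    intro t
    rw [intervalIntegral.integral_comp_add_left, add_zero]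
  unfold steklov
  rw [h, h, ← mul_sub, intervalIntegral.integral_sub]
  · exact (hf.comp (continuous_const.add continuous_id)).intervalIntegrable _ _
  · exact (hf.comp (continuous_const.add continuous_id)).intervalIntegrable _ _

lemma abs_average_le {h : ℝ → ℝ} {ε C : ℝ} (hε : 0 < ε) (hC : ∀ r ∈ Ioc 0 ε, |h r| ≤ C) :
    |ε⁻¹ * ∫ r in (0 : ℝ)..ε, h r| ≤ C := by
  have h1 : ‖∫ r in (0 : ℝ)..ε, h r‖ ≤ C * |ε - 0| := by
    apply intervalIntegral.norm_integral_le_of_norm_le_const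
    rwa [uIoc_of_le hε.le]
  rw [sub_zero, abs_of_pos hε] at h1
  rw [abs_mul, abs_of_pos (inv_pos.2 hε), inv_mul_le_iff₀ hε, mul_comm]
  exact h1

/-- Averaging does not increase the Hölder constant. -/
lemma steklov_holder {f : ℝ → ℝ} (hfc : Continuous f) {K ν ε : ℝ} (hε : 0 < ε)
    (hf : ∀ s t, |f t - f s| ≤ K * |t - s| ^ ν) (s t : ℝ) :
    |steklov ε f t - steklov ε f s| ≤ K * |t - s| ^ ν := by
  rw [steklov_sub hfc]
  refine abs_average_le hε fun r _ => ?_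
  simpa using hf (s + r) (t + r)

lemma steklov_close {f : ℝ → ℝ} (hfc : Continuous f) {K ν ε : ℝ} (hK : 0 ≤ K) (hν : 0 ≤ ν)
    (hε : 0 < ε) (hf : ∀ s t, |f t - f s| ≤ K * |t - s| ^ ν) (t : ℝ) :
    |steklov ε f t - f t| ≤ K * ε ^ ν := by
  have h : steklov ε f t - f t = ε⁻¹ * ∫ r in (0 : ℝ)..ε, (f (t + r) - f t) := by
    have hc : Continuous fun r => f (t + r) := by fun_prop
    rw [intervalIntegral.integral_sub (hc.intervalIntegrable _ _) (by simp),
      intervalIntegral.integral_const,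
      intervalIntegral.integral_comp_add_left, add_zero, sub_zero, smul_eq_mul, mul_sub,
      inv_mul_cancel_left₀ hε.ne']
    rfl
  rw [h]
  refine abs_average_le hε fun r hr => (hf t (t + r)).trans ?_
  rw [add_sub_cancel_left, abs_of_pos hr.1]
  exact mul_le_mul_of_nonneg_left (Real.rpow_le_rpow hr.1.le hr.2 hν) hK

lemma continuous_of_holder {f : ℝ → ℝ} {K ν : ℝ} (hν : 0 < ν)
    (hf : ∀ s t, |f t - f s| ≤ K * |t - s| ^ ν) : Continuous f := by
  rw [continuous_iff_continuousAt]
  intro s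
  have hlim : Filter.Tendsto (fun t => K * |t - s| ^ ν) (nhds s) (nhds 0) := by
    have : ContinuousAt (fun t => K * |t - s| ^ ν) s :=
      continuousAt_const.mul (ContinuousAt.rpow_const (by fun_prop) (Or.inr hν.le))
    have h2 := this.tendsto
    rwa [sub_self, abs_zero, Real.zero_rpow hν.ne', mul_zero] at h2
  rw [ContinuousAt, tendsto_iff_dist_tendsto_zero]
  exact squeeze_zero (fun _ => dist_nonneg) (fun t => hf s t) hlim

/-- Fractional derivatives are continuous under pointwise convergence with uniform Hölder
bounds. -/
lemma tendsto_fracDerivLeft {α ν K : ℝ} (hαν : α < ν)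
    {F : ℕ → ℝ → ℝ} {f : ℝ → ℝ} (hFc : ∀ n, Continuous (F n))
    (hF : ∀ n s t, |F n t - F n s| ≤ K * |t - s| ^ ν)
    (hlim : ∀ t, Filter.Tendsto (fun n => F n t) Filter.atTop (nhds (f t)))
    {s : ℝ} (hs : 0 < s) :
    Filter.Tendsto (fun n => fracDerivLeft α (F n) 0 s) Filter.atTop
      (nhds (fracDerivLeft α f 0 s)) := by
  unfold fracDerivLeft
  refine Filter.Tendsto.const_mul _ (((hlim s).div_const _).add (Filter.Tendsto.const_mul _ ?_))
  refine intervalIntegral.tendsto_integral_filter_of_dominated_convergence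
    (fun u => K * (s - u) ^ (ν - α - 1)) ?_ ?_
    ((rpow_sub_intervalIntegrable (by linarith) s).const_mul K) ?_
  · refine Filter.Eventually.of_forall fun n => Measurable.aestronglyMeasurable ?_
    have := (hFc n).measurable
    fun_prop
  · refine Filter.Eventually.of_forall fun n => ?_
    rw [uIoc_of_le hs.le]
    filter_upwards [compl_mem_ae_iff.2 (measure_singleton s)] with u hu hu'
    exact abs_fracDeriv_integrand_le (fun s _ t _ => hF n s t) le_rfl hu'.1.le
      (lt_of_le_of_ne hu'.2 hu)
  · exact Filter.Eventually.of_forall fun u _ => ((hlim s).sub (hlim u)).div_const _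

/-- The pathwise integral is continuous under pointwise convergence with uniform Hölder bounds. -/
lemma tendsto_pathInt {α ν lam K K' b : ℝ} (hα0 : 0 < α) (hα1 : α < 1) (hαν : α < ν)
    (hlam : 1 - α < lam) (hb : 0 ≤ b) {F G : ℕ → ℝ → ℝ} {f g : ℝ → ℝ}
    (hFc : ∀ n, Continuous (F n)) (hF : ∀ n s t, |F n t - F n s| ≤ K * |t - s| ^ ν)
    (hFlim : ∀ t, Filter.Tendsto (fun n => F n t) Filter.atTop (nhds (f t)))
    {A : ℝ} (hA : ∀ n, ∀ t ∈ Icc 0 b, |F n t| ≤ A)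
    (hGc : ∀ n, Continuous (G n)) (hG : ∀ n s t, |G n t - G n s| ≤ K' * |t - s| ^ lam)
    (hGlim : ∀ t, Filter.Tendsto (fun n => G n t) Filter.atTop (nhds (g t))) :
    Filter.Tendsto (fun n => pathInt α (F n) (G n) 0 b) Filter.atTop
      (nhds (pathInt α f g 0 b)) := by
  have hΓ : 0 < Real.Gamma α := Real.Gamma_pos_of_pos hα0
  have hK' : 0 ≤ K' := by
    have := (abs_nonneg _).trans (hG 0 0 1)
    simpa using this
  set R := (1 / Real.Gamma α) *
    (K' * b ^ (lam - (1 - α)) + (1 - α) * (K' * (b ^ (lam - (1 - α)) / (lam - (1 - α))))) with hR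
  -- the factor `G n v - G n b` removes the boundary singularity of the right-sided derivative
  have hright : ∀ n, ∀ s, 0 < s → s < b → |fracDerivRight α (G n) b s| ≤ R := by
    intro n s hs hsb
    rw [fracDerivRight_eq]
    have hp : 0 < b - s := sub_pos.2 hsb
    have h1 := abs_fracDerivLeft_le (α := 1 - α) (ν := lam) (K := K') (b := b)
      (f := fun v => G n (b - v) - G n b) (A := K' * (b - s) ^ lam) (by linarith) (by linarith) hlam
      (fun s _ t _ => by
        have := hG n (b - s) (b - t)
        rw [show b - t - (b - s) = -(t - s) by ring, abs_neg] at this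
        simpa using this)
      hp (by linarith) (by
        have := hG n b (b - (b - s))
        rwa [show b - (b - s) - b = -(b - s) by ring, abs_neg, abs_of_pos hp] at this)
    refine h1.trans ?_
    rw [sub_sub_cancel, mul_assoc K', ← Real.rpow_add hp, ← sub_eq_add_neg]
    have h2 : (b - s) ^ (lam - (1 - α)) ≤ b ^ (lam - (1 - α)) :=
      Real.rpow_le_rpow hp.le (by linarith) (by linarith)
    have h3 : 0 < lam - (1 - α) := by linarith
    have h4 : 0 ≤ 1 - α := by linarith
    rw [hR]
    gcongr
  have hmeas : ∀ n, AEStronglyMeasurable (fracDerivRight α (G n) b)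
      (volume.restrict (Ioo 0 b)) := by
    intro n
    have h1 := aestronglyMeasurable_fracDerivLeft (1 - α) (f := fun v => G n (b - v) - G n b)
      (by have := hGc n; fun_prop) b
    have h2 : MeasurePreserving (fun s : ℝ => b - s) (volume.restrict (Ioo 0 b))
        (volume.restrict (Ioo 0 b)) := by
      have := (Measure.measurePreserving_sub_left (volume : Measure ℝ) b).restrict_preimage
        (measurableSet_Ioo (a := (0 : ℝ)) (b := b))
      convert this using 2
      ext x
      simp only [mem_Ioo, mem_preimage]
      constructor <;> rintro ⟨h, h'⟩ <;> constructor <;> linarith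
    have h3 := (h1.mono_measure
      (Measure.restrict_mono Ioo_subset_Ioc_self le_rfl)).comp_measurePreserving h2
    refine h3.congr (Filter.Eventually.of_forall fun s => ?_)
    rw [fracDerivRight_eq]
    rfl
  unfold pathInt
  refine Filter.Tendsto.neg ?_
  refine intervalIntegral.tendsto_integral_filter_of_dominated_convergence
    (fun s => (1 / Real.Gamma (1 - α)) *
      (A * s ^ (-α) + α * (K * (s ^ (ν - α) / (ν - α)))) * R) ?_ ?_
    ((intervalIntegrable_fracDeriv_bound hα1 hαν A K b).mul_const R) ?_
  · refine Filter.Eventually.of_forall fun n => ?_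
    rw [uIoc_of_le hb, ← restrict_Ioo_eq_restrict_Ioc]
    exact ((aestronglyMeasurable_fracDerivLeft α (hFc n) b).mono_measure
      (Measure.restrict_mono Ioo_subset_Ioc_self le_rfl)).mul (hmeas n)
  · refine Filter.Eventually.of_forall fun n => ?_
    rw [uIoc_of_le hb]
    filter_upwards [compl_mem_ae_iff.2 (measure_singleton b)] with s hs hs'
    rw [norm_mul]
    have h1 := abs_fracDerivLeft_le hα0 hα1 hαν (fun s _ t _ => hF n s t) hs'.1 hs'.2
      (hA n s ⟨hs'.1.le, hs'.2⟩)
    exact mul_le_mul h1 (hright n s hs'.1 (lt_of_le_of_ne hs'.2 hs)) (norm_nonneg _)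
      ((abs_nonneg _).trans h1)
  · rw [uIoc_of_le hb]
    filter_upwards [compl_mem_ae_iff.2 (measure_singleton b)] with s hs hs'
    refine (tendsto_fracDerivLeft hαν hFc hF hFlim hs'.1).mul ?_
    simp only [fracDerivRight_eq]
    refine tendsto_fracDerivLeft (K := K') hlam (fun n => ?_) (fun n s t => ?_)
      (fun t => (hGlim _).sub (hGlim _)) (sub_pos.2 (lt_of_le_of_ne hs'.2 hs))
    · have := hGc n
      fun_prop
    · have := hG n (b - s) (b - t)
      rw [show b - t - (b - s) = -(t - s) by ring, abs_neg] at this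
      simpa using this

/-- Young's estimate for smooth functions, with a constant that depends on their Hölder
constants only. -/
lemma young_bound_of_deriv {ν lam K K' : ℝ} (hν : 0 < ν) (hθ : 1 < ν + lam) (hlam : 0 < lam)
    {f g g' : ℝ → ℝ} (hfc : Continuous f) (hf : ∀ s t, |f t - f s| ≤ K * |t - s| ^ ν)
    (hg : ∀ t, HasDerivAt g (g' t) t) (hg' : Continuous g')
    (hgH : ∀ s t, |g t - g s| ≤ K' * |t - s| ^ lam) {s t : ℝ} (hst : s ≤ t) :
    |(∫ u in s..t, f u * g' u) - f s * (g t - g s)|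
      ≤ sewingConst (ν + lam) * (K * K') * (t - s) ^ (ν + lam) := by
  have hK : 0 ≤ K := by simpa using (abs_nonneg _).trans (hf 0 1)
  have hfi : ∀ s t, IntervalIntegrable (fun u => f u * g' u) volume s t :=
    (hfc.mul hg').intervalIntegrable
  have hFTC : ∀ s t, ∫ u in s..t, g' u = g t - g s := fun s t =>
    intervalIntegral.integral_eq_sub_of_hasDerivAt (fun x _ => hg x) (hg'.intervalIntegrable s t)
  obtain ⟨D, hD⟩ := (isCompact_Icc (a := s) (b := t)).exists_bound_of_continuousOn
    hg'.continuousOn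
  have := sewing_bound (J := fun s t => (∫ u in s..t, f u * g' u) - f s * (g t - g s))
    (a := s) (b := t) (W := K * K') (K' := K * D) (θ := ν + lam) (θ' := ν + 1) hθ
    (by linarith) ?_ ?_ le_rfl hst le_rfl
  · exact this
  · intro s u t _ hsu hut _
    have e : (∫ u in s..t, f u * g' u) - f s * (g t - g s)
        - ((∫ v in s..u, f v * g' v) - f s * (g u - g s))
        - ((∫ v in u..t, f v * g' v) - f u * (g t - g u)) = (f u - f s) * (g t - g u) := by
      rw [← intervalIntegral.integral_add_adjacent_intervals
        (hfi s u) (hfi u t)]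
      ring
    rw [e, norm_mul]
    have h1 := hf s u
    have h2 := hgH u t
    rw [abs_of_nonneg (sub_nonneg.2 hsu)] at h1
    rw [abs_of_nonneg (sub_nonneg.2 hut)] at h2
    have hK' : 0 ≤ K' := by simpa using (abs_nonneg _).trans (hgH 0 1)
    calc ‖f u - f s‖ * ‖g t - g u‖ ≤ (K * (u - s) ^ ν) * (K' * (t - u) ^ lam) :=
          mul_le_mul h1 h2 (norm_nonneg _) ((abs_nonneg _).trans h1)
      _ ≤ (K * (t - s) ^ ν) * (K' * (t - s) ^ lam) := by
          have := sub_nonneg.2 hsu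
          have := sub_nonneg.2 hut
          have := Real.rpow_nonneg (sub_nonneg.2 (hsu.trans hut)) ν
          gcongr
      _ = _ := by
          rw [Real.rpow_add' (by linarith) (by linarith)]; ring
  · intro s' t' hs' hst' ht'
    have e : (∫ u in s'..t', f u * g' u) - f s' * (g t' - g s')
        = ∫ u in s'..t', (f u - f s') * g' u := by
      rw [← hFTC, ← intervalIntegral.integral_const_mul, ← intervalIntegral.integral_sub
        (hfi _ _) ((hg'.intervalIntegrable _ _).const_mul _)]
      congr 1
      ext u
      ring
    rw [e]
    have h := intervalIntegral.norm_integral_le_of_norm_le_const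
      (f := fun u => (f u - f s') * g' u) (a := s') (b := t') (C := K * (t' - s') ^ ν * D) ?_
    · refine h.trans (le_of_eq ?_)
      rw [abs_of_nonneg (sub_nonneg.2 hst'), Real.rpow_add' (sub_nonneg.2 hst') (by linarith),
        Real.rpow_one]
      ring
    · intro u hu
      rw [uIoc_of_le hst'] at hu
      rw [norm_mul]
      have h1 := hf s' u
      rw [abs_of_nonneg (sub_nonneg.2 hu.1.le)] at h1
      have h0 := sub_nonneg.2 hu.1.le
      refine mul_le_mul (h1.trans ?_) (hD u ⟨by linarith [hu.1], by linarith [hu.2]⟩)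
        (norm_nonneg _) (mul_nonneg hK (Real.rpow_nonneg (by linarith) _))
      have := hu.2
      gcongr

/-- Young's estimate for the indefinite pathwise integral. The Steklov averages of `f` and `g` are
smooth with the same Hölder constants, and for them the pathwise integral is `∫ f g'`. -/
theorem young_bound_global {α ν lam K K' : ℝ} (hα0 : 0 < α) (hα1 : α < 1) (hαν : α < ν)
    (hlam : 1 - α < lam) {f g : ℝ → ℝ} (hf : ∀ s t, |f t - f s| ≤ K * |t - s| ^ ν)
    (hg : ∀ s t, |g t - g s| ≤ K' * |t - s| ^ lam) {s t : ℝ} (hs : 0 ≤ s) (hst : s ≤ t) :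
    |pathInt α f g 0 t - pathInt α f g 0 s - f s * (g t - g s)|
      ≤ sewingConst (ν + lam) * (K * K') * (t - s) ^ (ν + lam) := by
  have hν : 0 < ν := by linarith
  have hl0 : 0 < lam := by linarith
  have hK : 0 ≤ K := by simpa using (abs_nonneg _).trans (hf 0 1)
  have hK' : 0 ≤ K' := by simpa using (abs_nonneg _).trans (hg 0 1)
  have hfc := continuous_of_holder hν hf
  have hgc := continuous_of_holder hl0 hg
  let ε : ℕ → ℝ := fun n => 1 / ((n : ℝ) + 1)
  have hε : ∀ n, 0 < ε n := fun n => Nat.one_div_pos_of_nat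
  have hε1 : ∀ n, ε n ≤ 1 := fun n => by
    simp only [ε]
    rw [div_le_one (by positivity)]
    have : (0 : ℝ) ≤ n := n.cast_nonneg
    linarith
  have hst_lim : ∀ (h : ℝ → ℝ) (C p : ℝ), 0 < p → 0 ≤ C → Continuous h →
      (∀ s t, |h t - h s| ≤ C * |t - s| ^ p) → ∀ t,
      Filter.Tendsto (fun n => steklov (ε n) h t) Filter.atTop (nhds (h t)) := by
    intro h C p hp hC hc hh t
    rw [tendsto_iff_dist_tendsto_zero]
    refine squeeze_zero (fun _ => dist_nonneg) (fun n => steklov_close hc hC hp.le (hε n) hh t) ?_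
    have h1 : Filter.Tendsto ε Filter.atTop (nhds 0) := tendsto_one_div_add_atTop_nhds_zero_nat
    have h2 := (h1.rpow_const (Or.inr hp.le)).const_mul C
    rwa [Real.zero_rpow hp.ne', mul_zero] at h2
  let F : ℕ → ℝ → ℝ := fun n => steklov (ε n) f
  let G : ℕ → ℝ → ℝ := fun n => steklov (ε n) g
  have hFd := fun n => hasDerivAt_steklov hfc (ε n)
  have hGd := fun n => hasDerivAt_steklov hgc (ε n)
  have hFc : ∀ n, Continuous (F n) := fun n =>
    continuous_iff_continuousAt.2 fun t => (hFd n t).continuousAt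
  have hGc : ∀ n, Continuous (G n) := fun n =>
    continuous_iff_continuousAt.2 fun t => (hGd n t).continuousAt
  have hFH := fun n => steklov_holder hfc (hε n) hf
  have hGH := fun n => steklov_holder hgc (hε n) hg
  obtain ⟨A, hA⟩ := (isCompact_Icc (a := (0 : ℝ)) (b := t)).exists_bound_of_continuousOn
    hfc.continuousOn
  have hlim : ∀ r, 0 ≤ r → r ≤ t → Filter.Tendsto (fun n => pathInt α (F n) (G n) 0 r)
      Filter.atTop (nhds (pathInt α f g 0 r)) := by
    intro r hr hrt
    refine tendsto_pathInt hα0 hα1 hαν hlam hr hFc hFH (hst_lim f K ν hν hK hfc hf)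
      (A := A + K) (fun n u hu => ?_) hGc hGH (hst_lim g K' lam hl0 hK' hgc hg)
    have h1 := steklov_close hfc hK hν.le (hε n) hf u
    have h2 : K * ε n ^ ν ≤ K :=
      mul_le_of_le_one_right hK (Real.rpow_le_one (hε n).le (hε1 n) hν.le)
    have h3 : |f u| ≤ A := hA u ⟨hu.1, hu.2.trans hrt⟩
    have h4 := abs_sub_abs_le_abs_sub (F n u) (f u)
    have h5 : |F n u - f u| ≤ K * ε n ^ ν := h1
    linarith
  have hlim' := ((hlim t (hs.trans hst) le_rfl).sub (hlim s hs hst)).sub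
    ((hst_lim f K ν hν hK hfc hf s).mul
      ((hst_lim g K' lam hl0 hK' hgc hg t).sub (hst_lim g K' lam hl0 hK' hgc hg s)))
  refine le_of_tendsto' hlim'.abs fun n => ?_
  have hF' : Continuous fun x => (ε n)⁻¹ * (f (x + ε n) - f x) := by fun_prop
  have hG' : Continuous fun x => (ε n)⁻¹ * (g (x + ε n) - g x) := by fun_prop
  have hint : ∀ a b, IntervalIntegrable
      (fun u => steklov (ε n) f u * ((ε n)⁻¹ * (g (u + ε n) - g u))) volume a b :=
    ((hFc n).mul hG').intervalIntegrable
  have key := young_bound_of_deriv hν (by linarith) hl0 (hFc n) (hFH n) (hGd n) hG' (hGH n) hst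
  rw [pathInt_eq_of_deriv hα0 hα1 (hFd n) hF' (hGd n) hG' (hs.trans hst),
    pathInt_eq_of_deriv hα0 hα1 (hFd n) hF' (hGd n) hG' hs,
    intervalIntegral.integral_interval_sub_left (hint _ _) (hint _ _)]
  exact key

lemma pathInt_congr {α b : ℝ} {f f' g g' : ℝ → ℝ} (hb : 0 ≤ b) (hf : EqOn f f' (Icc 0 b))
    (hg : EqOn g g' (Icc 0 b)) : pathInt α f g 0 b = pathInt α f' g' 0 b := by
  unfold pathInt
  congr 1
  refine intervalIntegral.integral_congr fun s hs => ?_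
  rw [uIcc_of_le hb] at hs
  have h1 : fracDerivLeft α f 0 s = fracDerivLeft α f' 0 s := by
    unfold fracDerivLeft
    have : ∫ u in (0 : ℝ)..s, (f s - f u) / (s - u) ^ (α + 1)
        = ∫ u in (0 : ℝ)..s, (f' s - f' u) / (s - u) ^ (α + 1) := by
      refine intervalIntegral.integral_congr fun u hu => ?_
      rw [uIcc_of_le hs.1] at hu
      rw [hf hs, hf ⟨hu.1, hu.2.trans hs.2⟩]
    rw [this, hf hs]
  have h2 : fracDerivRight α g b s = fracDerivRight α g' b s := by
    unfold fracDerivRight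
    have : ∫ u in s..b, (g s - g u) / (u - s) ^ (2 - α)
        = ∫ u in s..b, (g' s - g' u) / (u - s) ^ (2 - α) := by
      refine intervalIntegral.integral_congr fun u hu => ?_
      rw [uIcc_of_le hs.2] at hu
      rw [hg hs, hg ⟨hs.1.trans hu.1, hu.2⟩]
    rw [this, hg hs, hg ⟨hb, le_rfl⟩]
  rw [h1, h2]

/-- Young's estimate for the pathwise integral of functions that are Hölder continuous on
`[0, T]`. -/
theorem young_bound {α ν lam K K' T : ℝ} (hα0 : 0 < α) (hα1 : α < 1) (hαν : α < ν)
    (hlam : 1 - α < lam) (hT : 0 ≤ T) {f g : ℝ → ℝ}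
    (hf : ∀ s ∈ Icc 0 T, ∀ t ∈ Icc 0 T, |f t - f s| ≤ K * |t - s| ^ ν)
    (hg : ∀ s ∈ Icc 0 T, ∀ t ∈ Icc 0 T, |g t - g s| ≤ K' * |t - s| ^ lam)
    {s t : ℝ} (hs : 0 ≤ s) (hst : s ≤ t) (ht : t ≤ T) :
    |pathInt α f g 0 t - pathInt α f g 0 s - f s * (g t - g s)|
      ≤ sewingConst (ν + lam) * (max K 0 * max K' 0) * (t - s) ^ (ν + lam) := by
  have ext : ∀ (h : ℝ → ℝ) (C p : ℝ), 0 ≤ p →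
      (∀ s ∈ Icc 0 T, ∀ t ∈ Icc 0 T, |h t - h s| ≤ C * |t - s| ^ p) →
      ∀ s t, |h (projIcc 0 T hT t) - h (projIcc 0 T hT s)| ≤ max C 0 * |t - s| ^ p := by
    intro h C p hp hh s t
    have h1 := hh _ (projIcc 0 T hT s).2 _ (projIcc 0 T hT t).2
    have h2 : |(projIcc 0 T hT t : ℝ) - projIcc 0 T hT s| ≤ |t - s| := abs_projIcc_sub_projIcc hT
    refine h1.trans ?_
    gcongr
    exact le_max_left _ _
  have key := young_bound_global hα0 hα1 hαν hlam (ext f K ν (by linarith) hf)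
    (ext g K' lam (by linarith) hg) hs hst
  have eqon : ∀ (h : ℝ → ℝ) (b : ℝ), b ≤ T →
      EqOn (fun s => h (projIcc 0 T hT s)) h (Icc 0 b) := by
    intro h b hb s hs
    beta_reduce
    rw [projIcc_of_mem hT ⟨hs.1, hs.2.trans hb⟩]
  rw [pathInt_congr (hs.trans hst) (eqon f t ht) (eqon g t ht),
    pathInt_congr hs (eqon f s (hst.trans ht)) (eqon g s (hst.trans ht)),
    projIcc_of_mem hT ⟨hs, hst.trans ht⟩, projIcc_of_mem hT ⟨hs.trans hst, ht⟩] at key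
  exact key

/-! ### Hölder continuity from dyadic increments -/

/-- The dyadic approximation of `x` from below at level `n`. -/
noncomputable def dyadicFloor (n : ℕ) (x : ℝ) : ℝ := (⌊2 ^ n * x⌋₊ : ℝ) / 2 ^ n

lemma dyadicFloor_le {n : ℕ} {x : ℝ} (hx : 0 ≤ x) : dyadicFloor n x ≤ x := by
  unfold dyadicFloor
  rw [div_le_iff₀ (by positivity), mul_comm x]
  exact Nat.floor_le (by positivity)

lemma dyadicFloor_gt (n : ℕ) (x : ℝ) : x - (1 / 2) ^ n < dyadicFloor n x := by
  unfold dyadicFloor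
  have := Nat.lt_floor_add_one (2 ^ n * x)
  rw [lt_div_iff₀ (by positivity), sub_mul, one_div, inv_pow, inv_mul_cancel₀ (by positivity)]
  linarith

lemma dyadicFloor_nonneg (n : ℕ) (x : ℝ) : 0 ≤ dyadicFloor n x := by
  unfold dyadicFloor; positivity

lemma tendsto_dyadicFloor {x : ℝ} (hx : 0 ≤ x) :
    Filter.Tendsto (fun n => dyadicFloor n x) Filter.atTop (nhds x) := by
  have h : Filter.Tendsto (fun n : ℕ => x - (1 / 2 : ℝ) ^ n) Filter.atTop (nhds (x - 0)) :=
    (tendsto_pow_atTop_nhds_zero_of_lt_one (by norm_num) (by norm_num)).const_sub x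
  rw [sub_zero] at h
  exact tendsto_of_tendsto_of_tendsto_of_le_of_le h tendsto_const_nhds
    (fun n => (dyadicFloor_gt n x).le) (fun n => dyadicFloor_le hx)

section Chaining

variable {f : ℝ → ℝ} {K r : ℝ}

lemma abs_dyadic_succ_le (hK : 0 ≤ K) (hr0 : 0 < r)
    (hinc : ∀ n k : ℕ, k < 2 ^ n → |f (((k : ℝ) + 1) / 2 ^ n) - f (k / 2 ^ n)| ≤ K * r ^ n)
    {x : ℝ} (hx0 : 0 ≤ x) (hx1 : x ≤ 1) (n : ℕ) :
    |f (dyadicFloor (n + 1) x) - f (dyadicFloor n x)| ≤ K * r ^ (n + 1) := by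
  set a := ⌊2 ^ n * x⌋₊ with ha
  have h0 : 0 ≤ 2 ^ n * x := by positivity
  have h1 : (a : ℝ) ≤ 2 ^ n * x := Nat.floor_le h0
  have h2 : 2 ^ n * x < a + 1 := Nat.lt_floor_add_one _
  have e : dyadicFloor n x = ((2 * a : ℕ) : ℝ) / 2 ^ (n + 1) := by
    unfold dyadicFloor
    rw [← ha, pow_succ]
    push_cast
    field_simp
  have h3 : ⌊2 ^ (n + 1) * x⌋₊ = 2 * a ∨ ⌊2 ^ (n + 1) * x⌋₊ = 2 * a + 1 := by
    rcases lt_or_ge (2 ^ (n + 1) * x) (2 * a + 1) with h | h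
    · left
      rw [Nat.floor_eq_iff (by positivity)]
      push_cast
      refine ⟨?_, h⟩
      rw [pow_succ]
      linarith
    · right
      rw [Nat.floor_eq_iff (by positivity)]
      push_cast
      refine ⟨h, ?_⟩
      rw [pow_succ]
      linarith
  rcases h3 with h3 | h3
  · have : dyadicFloor (n + 1) x = dyadicFloor n x := by
      rw [e]; unfold dyadicFloor; rw [h3]
    rw [this, sub_self, abs_zero]
    positivity
  · have : dyadicFloor (n + 1) x = (((2 * a : ℕ) : ℝ) + 1) / 2 ^ (n + 1) := by
      unfold dyadicFloor; rw [h3]; push_cast; rfl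
    rw [this, e]
    apply hinc
    have h4 : ((2 * a + 1 : ℕ) : ℝ) ≤ 2 ^ (n + 1) := by
      rw [← h3]
      refine (Nat.floor_le (by positivity)).trans ?_
      exact mul_le_of_le_one_right (by positivity) hx1
    have : 2 * a + 1 ≤ 2 ^ (n + 1) := by exact_mod_cast h4
    omega

/-- The chain of dyadic approximations of `x` from level `n` on has geometrically decaying
increments. -/
lemma abs_sub_dyadicFloor_le (hK : 0 ≤ K) (hr0 : 0 < r) (hr1 : r < 1)
    (hf : ContinuousOn f (Icc 0 1))
    (hinc : ∀ n k : ℕ, k < 2 ^ n → |f (((k : ℝ) + 1) / 2 ^ n) - f (k / 2 ^ n)| ≤ K * r ^ n)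
    {x : ℝ} (hx0 : 0 ≤ x) (hx1 : x ≤ 1) (n : ℕ) :
    |f x - f (dyadicFloor n x)| ≤ K / (1 - r) * r ^ (n + 1) := by
  have h1r : 0 < 1 - r := sub_pos.2 hr1
  have hKr : 0 ≤ K / (1 - r) := by positivity
  have key : ∀ m, |f (dyadicFloor (n + m) x) - f (dyadicFloor n x)|
      ≤ K / (1 - r) * (r ^ (n + 1) - r ^ (n + m + 1)) := by
    intro m
    induction m with
    | zero => simp
    | succ m ih =>
      have h1 := abs_dyadic_succ_le hK hr0 hinc hx0 hx1 (n + m)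
      have h2 := abs_sub_le (f (dyadicFloor (n + m + 1) x)) (f (dyadicFloor (n + m) x))
        (f (dyadicFloor n x))
      have h3 : K * r ^ (n + m + 1) = K / (1 - r) * (r ^ (n + m + 1) - r ^ (n + m + 1 + 1)) := by
        rw [pow_succ r (n + m + 1)]
        field_simp
      rw [← add_assoc n m 1]
      calc _ ≤ _ := h2
        _ ≤ K / (1 - r) * (r ^ (n + m + 1) - r ^ (n + m + 1 + 1))
          + K / (1 - r) * (r ^ (n + 1) - r ^ (n + m + 1)) := by linarith
        _ = _ := by ring
  have hlim : Filter.Tendsto (fun m => |f (dyadicFloor (n + m) x) - f (dyadicFloor n x)|)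
      Filter.atTop (nhds |f x - f (dyadicFloor n x)|) := by
    have h1 : Filter.Tendsto (fun m => dyadicFloor (n + m) x) Filter.atTop
        (nhdsWithin x (Icc 0 1)) := by
      refine tendsto_nhdsWithin_iff.2 ⟨?_, Filter.Eventually.of_forall fun m =>
        ⟨dyadicFloor_nonneg _ _, (dyadicFloor_le hx0).trans hx1⟩⟩
      refine (tendsto_dyadicFloor hx0).comp ?_
      exact Filter.tendsto_atTop_mono (fun m => Nat.le_add_left m n) Filter.tendsto_id
    exact (((hf x ⟨hx0, hx1⟩).tendsto.comp h1).sub_const _).abs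
  refine le_of_tendsto' hlim fun m => (key m).trans (mul_le_mul_of_nonneg_left ?_ hKr)
  have : 0 < r ^ (n + m + 1) := by positivity
  linarith

/-- Chaining along dyadic points: bounds on the dyadic increments give Hölder continuity. -/
theorem holder_of_dyadic_increments {μ : ℝ} (hμ : 0 < μ) (hK : 0 ≤ K)
    (hf : ContinuousOn f (Icc 0 1))
    (hinc : ∀ n k : ℕ, k < 2 ^ n →
      |f (((k : ℝ) + 1) / 2 ^ n) - f (k / 2 ^ n)| ≤ K * ((2 : ℝ) ^ (-μ)) ^ n)
    {x y : ℝ} (hx : x ∈ Icc (0 : ℝ) 1) (hy : y ∈ Icc (0 : ℝ) 1) :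
    |f y - f x| ≤ (1 + 2 / (1 - (2 : ℝ) ^ (-μ))) * 2 ^ μ * K * |y - x| ^ μ := by
  wlog hxy : x ≤ y generalizing x y
  · rw [abs_sub_comm, abs_sub_comm y]
    exact this hy hx (le_of_not_ge hxy)
  set r : ℝ := 2 ^ (-μ) with hr
  have hr0 : 0 < r := by positivity
  have hr1 : r < 1 := Real.rpow_lt_one_of_one_lt_of_neg (by norm_num) (by linarith)
  have h1r : 0 < 1 - r := sub_pos.2 hr1
  rcases hxy.eq_or_lt with rfl | hlt
  · simp [Real.zero_rpow hμ.ne']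
  have hd0 : 0 < y - x := sub_pos.2 hlt
  obtain ⟨n, hn1, hn2⟩ := exists_nat_pow_near_of_lt_one hd0 (by linarith [hx.1, hy.2])
    (by norm_num : (0 : ℝ) < 1 / 2) (by norm_num)
  have a1 := abs_sub_dyadicFloor_le hK hr0 hr1 hf hinc hx.1 hx.2 n
  have a2 := abs_sub_dyadicFloor_le hK hr0 hr1 hf hinc hy.1 hy.2 n
  have a3 : |f (dyadicFloor n y) - f (dyadicFloor n x)| ≤ K * r ^ n := by
    set a := ⌊2 ^ n * x⌋₊ with ha
    have h2n : (0 : ℝ) < 2 ^ n := by positivity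
    have hle : a ≤ ⌊2 ^ n * y⌋₊ := Nat.floor_mono (by gcongr)
    have hlt2 : ⌊2 ^ n * y⌋₊ < a + 2 := by
      rw [Nat.floor_lt (mul_nonneg h2n.le hy.1)]
      have h1 : 2 ^ n * x < a + 1 := Nat.lt_floor_add_one _
      have h2 : 2 ^ n * (y - x) ≤ 1 := by
        calc 2 ^ n * (y - x) ≤ 2 ^ n * (1 / 2) ^ n := by gcongr
          _ = 1 := by rw [← mul_pow]; norm_num
      push_cast
      linarith
    rcases (by omega : ⌊2 ^ n * y⌋₊ = a ∨ ⌊2 ^ n * y⌋₊ = a + 1) with h | h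
    · have : dyadicFloor n y = dyadicFloor n x := by unfold dyadicFloor; rw [h]
      rw [this, sub_self, abs_zero]
      positivity
    · have e1 : dyadicFloor n y = ((a : ℝ) + 1) / 2 ^ n := by
        unfold dyadicFloor; rw [h]; push_cast; rfl
      have e2 : dyadicFloor n x = (a : ℝ) / 2 ^ n := rfl
      rw [e1, e2]
      apply hinc
      have h3 : ((a + 1 : ℕ) : ℝ) ≤ 2 ^ n := by
        rw [← h]
        exact (Nat.floor_le (mul_nonneg h2n.le hy.1)).trans (mul_le_of_le_one_right h2n.le hy.2)
      have : a + 1 ≤ 2 ^ n := by exact_mod_cast h3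
      omega
  have a4 : r ^ n ≤ 2 ^ μ * (y - x) ^ μ := by
    rw [← Real.mul_rpow (by norm_num) hd0.le, hr, Real.rpow_neg (by norm_num),
      ← Real.inv_rpow (by norm_num), ← Real.rpow_natCast, ← Real.rpow_mul (by norm_num), mul_comm,
      Real.rpow_mul (by norm_num), Real.rpow_natCast]
    apply Real.rpow_le_rpow (by positivity) _ hμ.le
    rw [pow_succ] at hn1
    rw [← one_div]
    linarith
  have a5 : |f y - f x| ≤ |f y - f (dyadicFloor n y)| +
      |f (dyadicFloor n y) - f (dyadicFloor n x)| + |f x - f (dyadicFloor n x)| := by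
    have e : f y - f x = (f y - f (dyadicFloor n y)) +
      (f (dyadicFloor n y) - f (dyadicFloor n x)) + -(f x - f (dyadicFloor n x)) := by ring
    rw [e]
    refine (abs_add_three _ _ _).trans (le_of_eq ?_)
    rw [abs_neg]
  have a6 : K / (1 - r) * r ^ (n + 1) ≤ K / (1 - r) * r ^ n := by
    rw [pow_succ]
    exact mul_le_mul_of_nonneg_left (mul_le_of_le_one_right (by positivity) hr1.le)
      (by positivity)
  rw [abs_of_pos hd0]
  calc |f y - f x| ≤ (1 + 2 / (1 - r)) * K * r ^ n := by
        have : (1 + 2 / (1 - r)) * K * r ^ n = K / (1 - r) * r ^ n + K * r ^ n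
          + K / (1 - r) * r ^ n := by field_simp; ring
        linarith
    _ ≤ (1 + 2 / (1 - r)) * K * (2 ^ μ * (y - x) ^ μ) := by gcongr
    _ = _ := by ring

end Chaining

/-! ### Paths of fractional Brownian motion -/

section FBM

variable {Ω : Type*} [MeasurableSpace Ω] {P : Measure Ω} {H : ℝ} {B : ℝ → Ω → ℝ}

lemma IsFBM.hasGaussianLaw_sub (hB : IsFBM P H B) {s t : ℝ} (hs : 0 ≤ s) (ht : 0 ≤ t) :
    HasGaussianLaw (fun ω => B t ω - B s ω) P :=
  hB.gaussian.hasGaussianLaw_fun_sub (s := (⟨t, ht⟩ : ℝ≥0)) (t := ⟨s, hs⟩)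

lemma IsFBM.memLp_two (hB : IsFBM P H B) {t : ℝ} (ht : 0 ≤ t) : MemLp (B t) 2 P :=
  (hB.gaussian.hasGaussianLaw_eval (⟨t, ht⟩ : ℝ≥0)).memLp_two

/-- The increments of a fractional Brownian motion have the law of `N(0, |t - s| ^ (2 H))`. -/
lemma IsFBM.map_sub (hB : IsFBM P H B) (hH : 0 < H) {s t : ℝ} (hs : 0 ≤ s) (ht : 0 ≤ t) :
    P.map (fun ω => B t ω - B s ω) = gaussianReal 0 (|t - s| ^ (2 * H)).toNNReal := by
  have : IsProbabilityMeasure P := hB.gaussian.isProbabilityMeasure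
  have hL := hB.hasGaussianLaw_sub hs ht
  have it := (hB.memLp_two ht).integrable one_le_two
  have is := (hB.memLp_two hs).integrable one_le_two
  have itt : Integrable (fun ω => B t ω * B t ω) P :=
    (hB.memLp_two ht).integrable_mul (hB.memLp_two ht)
  have iss : Integrable (fun ω => B s ω * B s ω) P :=
    (hB.memLp_two hs).integrable_mul (hB.memLp_two hs)
  have its : Integrable (fun ω => B t ω * B s ω) P :=
    (hB.memLp_two ht).integrable_mul (hB.memLp_two hs)
  have hmean : ∫ ω, (B t ω - B s ω) ∂P = 0 := by
    rw [integral_sub it is, hB.centered t ht, hB.centered s hs, sub_zero]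
  have hvar : Var[fun ω => B t ω - B s ω; P] = |t - s| ^ (2 * H) := by
    rw [variance_of_integral_eq_zero hL.aemeasurable hmean]
    have e : ∀ ω, (B t ω - B s ω) ^ 2
        = B t ω * B t ω - 2 * (B t ω * B s ω) + B s ω * B s ω := fun ω => by ring
    simp only [e]
    have its' : Integrable (fun ω => B t ω * B t ω - 2 * (B t ω * B s ω)) P :=
      itt.sub (its.const_mul 2)
    rw [integral_add its' iss, integral_sub itt (its.const_mul 2),
      integral_const_mul, hB.covariance t t ht ht, hB.covariance s t hs ht,
      hB.covariance s s hs hs, sub_self, sub_self, abs_zero,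
      Real.zero_rpow (by positivity)]
    ring
  rw [hL.map_eq_gaussianReal, hmean, hvar]

/-- The absolute moments of the increments, by Gaussian scaling. -/
lemma IsFBM.exists_moment (hB : IsFBM P H B) (hH : 0 < H) (p : ℕ) :
    ∃ c : ℝ≥0∞, c ≠ ∞ ∧ ∀ s t : ℝ, 0 ≤ s → 0 ≤ t →
      ∫⁻ ω, ENNReal.ofReal |B t ω - B s ω| ^ p ∂P = c * ENNReal.ofReal (|t - s| ^ H) ^ p := by
  refine ⟨∫⁻ x, ENNReal.ofReal |x| ^ p ∂(gaussianReal 0 1), ?_, ?_⟩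
  · rcases Nat.eq_zero_or_pos p with rfl | hp
    · simp
    have h1 := (memLp_id_gaussianReal (μ := 0) (v := 1) p).eLpNorm_lt_top
    have h2 := lintegral_rpow_enorm_lt_top_of_eLpNorm_lt_top (by simp; omega) (by simp) h1
    refine ne_of_lt ?_
    convert h2 using 2 with x
    simp [← Real.norm_eq_abs]
  · intro s t hs ht
    have hL := hB.hasGaussianLaw_sub hs ht
    have hmeas : ∀ c : ℝ, Measurable fun x : ℝ => ENNReal.ofReal |c * x| ^ p := by
      intro c; fun_prop
    have e1 : ∫⁻ ω, ENNReal.ofReal |B t ω - B s ω| ^ p ∂P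
        = ∫⁻ x, ENNReal.ofReal |x| ^ p ∂(P.map (fun ω => B t ω - B s ω)) := by
      rw [lintegral_map' (by fun_prop) hL.aemeasurable]
    have e2 : gaussianReal 0 (|t - s| ^ (2 * H)).toNNReal
        = (gaussianReal 0 1).map (fun x => |t - s| ^ H * x) := by
      rw [gaussianReal_map_const_mul, mul_zero, mul_one]
      congr 1
      rw [← NNReal.coe_inj, Real.coe_toNNReal _ (by positivity), NNReal.coe_mk,
        ← Real.rpow_natCast, ← Real.rpow_mul (abs_nonneg _), mul_comm H]
      norm_num
    rw [e1, hB.map_sub hH hs ht, e2, lintegral_map (by fun_prop) (by fun_prop),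
      mul_comm, ← lintegral_const_mul _ (by fun_prop)]
    refine lintegral_congr fun x => ?_
    rw [abs_mul, abs_of_nonneg (by positivity : 0 ≤ |t - s| ^ H),
      ENNReal.ofReal_mul (by positivity), mul_pow]

/-- The paths of a fractional Brownian motion are Hölder continuous of every order `μ < H`, with a
measurable Hölder constant. -/
theorem IsFBM.exists_holder (hB : IsFBM P H B) {μ T : ℝ} (hμ0 : 0 < μ) (hμ : μ < H) (hT : 0 < T) :
    ∃ K : Ω → ℝ, Measurable K ∧ ∀ᵐ ω ∂P, ∀ s ∈ Icc 0 T, ∀ t ∈ Icc 0 T,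
      |B t ω - B s ω| ≤ K ω * |t - s| ^ μ := by
  have hH : 0 < H := hμ0.trans hμ
  -- the moments are chosen so high that the dyadic increments of all levels are summable
  obtain ⟨p, hp⟩ := exists_nat_gt (1 / (H - μ))
  have hHμ : 0 < H - μ := sub_pos.2 hμ
  have hp1 : 1 < p * (H - μ) := by rwa [div_lt_iff₀ hHμ] at hp
  have hp0 : p ≠ 0 := by
    rintro rfl
    norm_num at hp1
  obtain ⟨c, hc, hmom⟩ := hB.exists_moment hH p
  let Δ : ℕ → ℕ → Ω → ℝ := fun n k ω =>
    |B (T * (((k : ℝ) + 1) / 2 ^ n)) ω - B (T * (k / 2 ^ n)) ω|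
  let S : Ω → ℝ≥0∞ := fun ω => ∑' n : ℕ, ∑ k ∈ Finset.range (2 ^ n),
    ENNReal.ofReal (((2 : ℝ) ^ μ) ^ n * Δ n k ω) ^ p
  have hΔm : ∀ n k, AEMeasurable (Δ n k) P := fun n k =>
    (hB.hasGaussianLaw_sub (by positivity) (by positivity)).aemeasurable.norm
  have hterm : ∀ n k, AEMeasurable (fun ω => ENNReal.ofReal (((2 : ℝ) ^ μ) ^ n * Δ n k ω) ^ p) P :=
    fun n k => (((hΔm n k).const_mul _).ennreal_ofReal).pow_const p
  have hSm : AEMeasurable S P :=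
    AEMeasurable.tsum fun n => Finset.aemeasurable_fun_sum _ fun k _ => hterm n k
  have hSint : ∫⁻ ω, S ω ∂P ≠ ∞ := by
    have e1 : ∫⁻ ω, S ω ∂P = ∑' n : ℕ, c * ENNReal.ofReal (T ^ H) ^ p *
        ENNReal.ofReal (2 ^ (1 - p * (H - μ))) ^ n := by
      rw [lintegral_tsum fun n => Finset.aemeasurable_fun_sum _ fun k _ => hterm n k]
      congr 1
      ext n
      rw [lintegral_finsetSum' _ fun k _ => hterm n k]
      have e2 : ∀ k ∈ Finset.range (2 ^ n),
          ∫⁻ ω, ENNReal.ofReal (((2 : ℝ) ^ μ) ^ n * Δ n k ω) ^ p ∂P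
          = c * ENNReal.ofReal (((2 : ℝ) ^ μ) ^ n * (T / 2 ^ n) ^ H) ^ p := by
        intro k _
        have e3 : T * (((k : ℝ) + 1) / 2 ^ n) - T * (k / 2 ^ n) = T / 2 ^ n := by ring
        have h3 := hmom (T * (k / 2 ^ n)) (T * (((k : ℝ) + 1) / 2 ^ n)) (by positivity)
          (by positivity)
        rw [e3, abs_of_pos (by positivity)] at h3
        have e4 : ∀ ω, ENNReal.ofReal (((2 : ℝ) ^ μ) ^ n * Δ n k ω) ^ p
            = ENNReal.ofReal (((2 : ℝ) ^ μ) ^ n) ^ p * ENNReal.ofReal (Δ n k ω) ^ p := by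
          intro ω
          rw [ENNReal.ofReal_mul (by positivity), mul_pow]
        simp only [e4]
        rw [lintegral_const_mul'' _ ((hΔm n k).ennreal_ofReal.pow_const p), h3,
          ENNReal.ofReal_mul (by positivity), mul_pow]
        ring
      rw [Finset.sum_congr rfl e2, Finset.sum_const, Finset.card_range, nsmul_eq_mul]
      have e5 : ((2 ^ n : ℕ) : ℝ≥0∞) = ENNReal.ofReal (2 ^ n) := by
        rw [ENNReal.ofReal_pow (by norm_num)]; simp
      rw [e5, ← ENNReal.ofReal_pow (by positivity), ← ENNReal.ofReal_pow (by positivity),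
        ← ENNReal.ofReal_pow (by positivity), mul_left_comm, mul_assoc,
        ← ENNReal.ofReal_mul (by positivity), ← ENNReal.ofReal_mul (by positivity)]
      congr 2
      have h2 : (0 : ℝ) < 2 := by norm_num
      rw [Real.div_rpow hT.le (by positivity), ← Real.rpow_natCast (2 ^ μ) n,
        ← Real.rpow_natCast 2 n, ← Real.rpow_natCast (2 ^ (1 - p * (H - μ))) n,
        ← Real.rpow_mul h2.le, ← Real.rpow_mul h2.le, ← Real.rpow_mul h2.le,
        mul_div_left_comm, ← Real.rpow_sub h2, mul_pow, mul_left_comm,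
        ← Real.rpow_natCast (2 ^ (μ * n - n * H)) p, ← Real.rpow_mul h2.le, ← Real.rpow_add h2]
      congr 2
      ring
    rw [e1, ENNReal.tsum_mul_left, ENNReal.tsum_geometric]
    refine ENNReal.mul_ne_top (ENNReal.mul_ne_top hc (ENNReal.pow_ne_top ENNReal.ofReal_ne_top)) ?_
    rw [ENNReal.inv_ne_top, ne_eq, tsub_eq_zero_iff_le, not_le, ← ENNReal.ofReal_one]
    exact (ENNReal.ofReal_lt_ofReal_iff one_pos).2
      (Real.rpow_lt_one_of_one_lt_of_neg (by norm_num) (by linarith))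
  have hfin : ∀ᵐ ω ∂P, S ω < ∞ := ae_lt_top' hSm hSint
  refine ⟨fun ω => (1 + 2 / (1 - (2 : ℝ) ^ (-μ))) * 2 ^ μ * (1 + (hSm.mk S ω).toReal) * T ^ (-μ),
    ((hSm.measurable_mk.ennreal_toReal.const_add 1).const_mul _).mul_const _, ?_⟩
  filter_upwards [hfin, hSm.ae_eq_mk, hB.continuous_paths] with ω hω hmk hcont
  rw [← hmk]
  have hinc : ∀ n k : ℕ, k < 2 ^ n → |B (T * (((k : ℝ) + 1) / 2 ^ n)) ω - B (T * (k / 2 ^ n)) ω|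
      ≤ (1 + (S ω).toReal) * ((2 : ℝ) ^ (-μ)) ^ n := by
    intro n k hk
    have h1 : ENNReal.ofReal (((2 : ℝ) ^ μ) ^ n * Δ n k ω) ^ p ≤ S ω :=
      (Finset.single_le_sum (f := fun k => ENNReal.ofReal (((2 : ℝ) ^ μ) ^ n * Δ n k ω) ^ p)
        (fun _ _ => zero_le) (Finset.mem_range.2 hk)).trans (ENNReal.le_tsum n)
    have h0 : 0 ≤ ((2 : ℝ) ^ μ) ^ n * Δ n k ω := mul_nonneg (by positivity) (abs_nonneg _)
    have h2 : (((2 : ℝ) ^ μ) ^ n * Δ n k ω) ^ p ≤ (S ω).toReal := by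
      rw [← ENNReal.ofReal_pow h0] at h1
      exact (ENNReal.ofReal_le_iff_le_toReal hω.ne).1 h1
    have h3 : ((2 : ℝ) ^ μ) ^ n * Δ n k ω ≤ 1 + (S ω).toReal := by
      rcases le_total (((2 : ℝ) ^ μ) ^ n * Δ n k ω) 1 with h | h
      · linarith [ENNReal.toReal_nonneg (a := S ω)]
      · linarith [le_self_pow₀ h hp0]
    rw [Real.rpow_neg (by norm_num), inv_pow, ← div_eq_mul_inv, le_div_iff₀ (by positivity),
      mul_comm]
    exact h3
  intro s hs t ht
  have hcont' : ContinuousOn (fun x => B (T * x) ω) (Icc 0 1) := by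
    refine hcont.comp (by fun_prop) fun x hx => ?_
    exact mul_nonneg hT.le hx.1
  have hdiv : ∀ x ∈ Icc 0 T, x / T ∈ Icc (0 : ℝ) 1 := fun x hx =>
    ⟨div_nonneg hx.1 hT.le, (div_le_one hT).2 hx.2⟩
  have key := holder_of_dyadic_increments hμ0 (by positivity) hcont' hinc (hdiv s hs) (hdiv t ht)
  rw [mul_div_cancel₀ _ hT.ne', mul_div_cancel₀ _ hT.ne', ← sub_div, abs_div, abs_of_pos hT,
    Real.div_rpow (abs_nonneg _) hT.le] at key
  refine key.trans (le_of_eq ?_)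
  rw [Real.rpow_neg hT.le]
  ring

end FBM

/-! ### Equations with Hölder continuous drivers and their Euler approximations -/

section Deterministic

variable {E G : Type*} [NormedAddCommGroup E] [NormedSpace ℝ E]
  [NormedAddCommGroup G] [NormedSpace ℝ G]

/-- Coefficients of an equation driven by a path in `G` with solutions in `E`: `S` is the diffusion
coefficient and `D` the drift. The four-point estimate `four_point` is what the Hölder
continuity of the spatial derivative of `S` is needed for. -/
structure Coeff (T M β γ κ : ℝ) (LD QS : ℝ → ℝ) (S : ℝ → E → G →L[ℝ] E) (D : ℝ → E → E) :
    Prop where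
  S_lip : ∀ t ∈ Icc 0 T, ∀ x y, ‖S t x - S t y‖ ≤ M * ‖x - y‖
  S_time : ∀ s ∈ Icc 0 T, ∀ t ∈ Icc 0 T, ∀ x, ‖S t x - S s x‖ ≤ M * |t - s| ^ β
  S_growth : ∀ t ∈ Icc 0 T, ∀ x, ‖S t x‖ ≤ M * (‖x‖ + 1)
  D_growth : ∀ t ∈ Icc 0 T, ∀ x, ‖D t x‖ ≤ M * (‖x‖ + 1)
  D_lip : ∀ R, 0 < R → ∀ t ∈ Icc 0 T, ∀ x y, ‖x‖ ≤ R → ‖y‖ ≤ R →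
    ‖D t x - D t y‖ ≤ LD R * ‖x - y‖
  D_time : ∀ s ∈ Icc 0 T, ∀ t ∈ Icc 0 T, ∀ x, ‖D t x - D s x‖ ≤ M * |t - s| ^ γ
  four_point : ∀ R, 0 < R → ∀ s ∈ Icc 0 T, ∀ t ∈ Icc 0 T, ∀ x₁ x₂ x₃ x₄ : E,
    ‖x₁‖ ≤ R → ‖x₂‖ ≤ R → ‖x₃‖ ≤ R → ‖x₄‖ ≤ R →
    ‖S t x₁ - S t x₂ - (S s x₃ - S s x₄)‖ ≤ M * ‖x₁ - x₂ - (x₃ - x₄)‖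
      + QS R * ‖x₃ - x₄‖ * (|t - s| ^ β + (‖x₁ - x₃‖ + ‖x₂ - x₄‖) ^ κ)

/-- The local error of the one-step approximation of the path `x` over `[s, t]`. -/
def localError (S : ℝ → E → G →L[ℝ] E) (D : ℝ → E → E) (g : ℝ → G) (x : ℝ → E) (s t : ℝ) : E :=
  x t - x s - S s (x s) (g t - g s) - (t - s) • D s (x s)

/-- `x` solves the equation in the sense of Davie: the local errors are of an order larger than
one, with some constant and exponent. -/
def IsDavieSolution (T : ℝ) (S : ℝ → E → G →L[ℝ] E) (D : ℝ → E → E) (g : ℝ → G) (x : ℝ → E) :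
    Prop :=
  ∃ K θ : ℝ, 1 < θ ∧ ∀ s t, 0 ≤ s → s ≤ t → t ≤ T →
    ‖localError S D g x s t‖ ≤ K * (t - s) ^ θ

/-- `y` is the interpolated Euler approximation on the grid of `N` steps of length `δ`: it has no
local error from a grid point to the points of the following step. -/
def IsEulerPath (δ : ℝ) (N : ℕ) (S : ℝ → E → G →L[ℝ] E) (D : ℝ → E → E) (g : ℝ → G) (y : ℝ → E) :
    Prop :=
  ∀ n < N, ∀ t, n * δ ≤ t → t ≤ (n + 1) * δ → localError S D g y (n * δ) t = 0

lemma rpow_le_mul_rpow {x T a b : ℝ} (hx : 0 ≤ x) (hxT : x ≤ T) (hb : b ≠ 0) (hab : a ≤ b) :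
    x ^ b ≤ T ^ (b - a) * x ^ a := by
  calc x ^ b = x ^ (b - a) * x ^ a := by
        rw [← Real.rpow_add' hx (by rwa [sub_add_cancel]), sub_add_cancel]
    _ ≤ _ := by
        have := Real.rpow_nonneg hx a
        have := sub_nonneg.2 hab
        gcongr

variable {T M β γ κ μ K : ℝ} {LD QS : ℝ → ℝ} {S : ℝ → E → G →L[ℝ] E} {D : ℝ → E → E} {g : ℝ → G}

lemma Coeff.S_incr (hc : Coeff T M β γ κ LD QS S D) (hM : 0 ≤ M) (hμ : 0 < μ) (hμβ : μ ≤ β)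
    {s t : ℝ} (hs : 0 ≤ s) (hst : s ≤ t) (ht : t ≤ T) (x y : E) :
    ‖S t x - S s y‖ ≤ (M + 1) * (1 + T ^ (β - μ)) * (‖x - y‖ + (t - s) ^ μ) := by
  have hT : 0 ≤ T := by linarith
  have h1 := hc.S_lip t ⟨by linarith, ht⟩ x y
  have h2 := hc.S_time s ⟨hs, by linarith⟩ t ⟨by linarith, ht⟩ y
  rw [abs_of_nonneg (sub_nonneg.2 hst)] at h2
  have h3 := rpow_le_mul_rpow (sub_nonneg.2 hst) (by linarith : t - s ≤ T) (by linarith) hμβ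
  have h4 : ‖S t x - S s y‖ ≤ ‖S t x - S t y‖ + ‖S t y - S s y‖ :=
    norm_sub_le_norm_sub_add_norm_sub _ _ _
  have h5 : 0 ≤ T ^ (β - μ) := Real.rpow_nonneg hT _
  have h6 : 0 ≤ (t - s) ^ μ := Real.rpow_nonneg (sub_nonneg.2 hst) _
  have h7 := mul_le_mul_of_nonneg_left h3 hM
  have h8 := norm_nonneg (x - y)
  have : (M + 1) * (1 + T ^ (β - μ)) * (‖x - y‖ + (t - s) ^ μ) - (M * ‖x - y‖
    + M * (T ^ (β - μ) * (t - s) ^ μ)) = ‖x - y‖ * (1 + (M + 1) * T ^ (β - μ)) +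
      (t - s) ^ μ * (M + 1 + T ^ (β - μ)) := by ring
  have : 0 ≤ ‖x - y‖ * (1 + (M + 1) * T ^ (β - μ)) + (t - s) ^ μ * (M + 1 + T ^ (β - μ)) := by
    positivity
  linarith

/-- A solution of the equation, sampled with small local errors, is a solution of a discrete Young
equation with inhomogeneity of size one. -/
lemma Coeff.discreteYoung (hc : Coeff T M β γ κ LD QS S D) (hM : 0 ≤ M) (hμ : 0 < μ) (hμβ : μ ≤ β)
    (hg : ∀ s t, 0 ≤ s → s ≤ t → t ≤ T → ‖g t - g s‖ ≤ K * (t - s) ^ μ) {x : ℝ → E}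
    {a δ : ℝ} {N : ℕ} (ha : 0 ≤ a) (hδ : 0 ≤ δ) (haN : a + N * δ ≤ T)
    (herr : ∀ n < N, ‖localError S D g x (a + n * δ) (a + (n + 1 : ℕ) * δ)‖ ≤ δ) :
    DiscreteYoung μ μ ((M + 1) * (1 + T ^ (β - μ))) K δ N 1 (fun n => x (a + n * δ))
      (fun n => S (a + n * δ) (x (a + n * δ))) (fun n => g (a + n * δ)) := by
  have hT : 0 ≤ T := le_trans (by positivity) haN
  have hTp : 0 ≤ T ^ (β - μ) := Real.rpow_nonneg hT _
  have hM1 : M + 1 ≤ (M + 1) * (1 + T ^ (β - μ)) := by nlinarith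
  have hpos : ∀ n : ℕ, 0 ≤ a + n * δ := fun n => by positivity
  have hle : ∀ n : ℕ, n ≤ N → a + n * δ ≤ T := fun n hn => by
    have : (n : ℝ) ≤ N := by exact_mod_cast hn
    refine le_trans ?_ haN
    gcongr
  have hmono : ∀ i j : ℕ, i ≤ j → a + i * δ ≤ a + j * δ := fun i j hij => by
    have : (i : ℝ) ≤ j := by exact_mod_cast hij
    gcongr
  have hdiff : ∀ i j : ℕ, a + (j : ℝ) * δ - (a + i * δ) = ((j : ℝ) - i) * δ := fun i j => by ring
  refine ⟨?_, ?_, ?_, ?_⟩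
  · intro i j hij hj
    have := hg _ _ (hpos i) (hmono i j hij) (hle j hj)
    rwa [hdiff] at this
  · intro n hn
    have h1 := herr n hn
    have h2 := hc.D_growth (a + n * δ) ⟨hpos n, hle n hn.le⟩ (x (a + n * δ))
    have e : x (a + (n + 1 : ℕ) * δ) - x (a + n * δ)
        - S (a + n * δ) (x (a + n * δ)) (g (a + (n + 1 : ℕ) * δ) - g (a + n * δ))
        = localError S D g x (a + n * δ) (a + (n + 1 : ℕ) * δ)
          + δ • D (a + n * δ) (x (a + n * δ)) := by
      unfold localError
      rw [hdiff]
      push_cast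
      rw [add_sub_cancel_left, one_mul]
      abel
    rw [e]
    refine (norm_add_le _ _).trans ?_
    rw [norm_smul, Real.norm_of_nonneg hδ]
    have h3 := norm_nonneg (x (a + n * δ))
    calc _ ≤ δ + δ * (M * (‖x (a + n * δ)‖ + 1)) := by gcongr
      _ ≤ (M + 1) * (‖x (a + n * δ)‖ + 1) * δ := by nlinarith [mul_nonneg hδ h3]
      _ ≤ _ := by gcongr
  · intro n hn
    refine (hc.S_growth _ ⟨hpos n, hle n hn⟩ _).trans ?_
    gcongr
    linarith
  · intro i j hij hj
    refine (hc.S_incr hM hμ hμβ (hpos i) (hmono i j hij) (hle j hj) _ _).trans ?_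
    rw [hdiff]
    have h3 := norm_nonneg (x (a + i * δ))
    have h4 := Real.rpow_nonneg (grid_nonneg hδ hij) μ
    gcongr
    exact le_mul_of_one_le_left h4 (by linarith)

/-- A priori bounds for solutions and for Euler approximations, on all grids. -/
theorem exists_apriori_bound (hM : 0 ≤ M) (hK : 0 ≤ K) (hT : 0 ≤ T) (hμ : 1 / 2 < μ)
    (hμ1 : μ < 1) (hμβ : μ ≤ β) : ∃ C : ℝ, 1 ≤ C ∧
    ∀ (S : ℝ → E → G →L[ℝ] E) (D : ℝ → E → E) (g : ℝ → G), Coeff T M β γ κ LD QS S D →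
    (∀ s t, 0 ≤ s → s ≤ t → t ≤ T → ‖g t - g s‖ ≤ K * (t - s) ^ μ) →
    (∀ x, IsDavieSolution T S D g x → ∀ s t, 0 ≤ s → s ≤ t → t ≤ T →
      ‖x t‖ + 1 ≤ C * (‖x s‖ + 1) ∧ ‖x t - x s‖ ≤ C * (‖x s‖ + 1) * (t - s) ^ μ) ∧
    ∀ (y : ℝ → E) (δ : ℝ) (N : ℕ), 0 < δ → N * δ ≤ T → IsEulerPath δ N S D g y →
      (∀ n : ℕ, n ≤ N → ‖y (n * δ)‖ + 1 ≤ C * (‖y 0‖ + 1)) ∧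
      ∀ i j : ℕ, i ≤ j → j ≤ N →
        ‖y (j * δ) - y (i * δ)‖ ≤ C * (‖y 0‖ + 1) * (((j : ℝ) - i) * δ) ^ μ := by
  have hTp : 0 ≤ T ^ (β - μ) := Real.rpow_nonneg hT _
  obtain ⟨C, hC1, hC⟩ := DiscreteYoung.exists_bound (E := E) (G := G) (μ := μ) (κ := μ)
    (M := (M + 1) * (1 + T ^ (β - μ))) (K := K) (T := T) hμ1.le (by linarith) le_rfl
    (by linarith) (by positivity) hK hT
  refine ⟨C, hC1, fun S D g hc hg => ⟨?_, ?_⟩⟩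
  · rintro x ⟨K', θ, hθ, hx⟩ s t hs hst ht
    rcases hst.eq_or_lt with rfl | hlt
    · refine ⟨le_mul_of_one_le_left (by positivity) hC1, ?_⟩
      rw [sub_self, sub_self, norm_zero, Real.zero_rpow (by linarith), mul_zero]
    have hd : 0 < t - s := sub_pos.2 hlt
    -- a grid so fine that the unknown constant `K'` of the local errors becomes irrelevant
    obtain ⟨N, hN0, hN⟩ : ∃ N : ℕ, 0 < N ∧ K' * ((t - s) / N) ^ (θ - 1) ≤ 1 := by
      have hlim : Filter.Tendsto (fun N : ℕ => K' * ((t - s) / N) ^ (θ - 1)) Filter.atTop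
          (nhds (K' * 0 ^ (θ - 1))) :=
        ((tendsto_const_div_atTop_nhds_zero_nat (t - s)).rpow_const
          (Or.inr (by linarith))).const_mul K'
      rw [Real.zero_rpow (by linarith), mul_zero] at hlim
      obtain ⟨N, h1, h2⟩ := ((hlim.eventually_le_const one_pos).and
        (Filter.eventually_gt_atTop 0)).exists
      exact ⟨N, h2, h1⟩
    have hN0' : (0 : ℝ) < N := by exact_mod_cast hN0
    have hδ : 0 < (t - s) / N := by positivity
    have hNδ : N * ((t - s) / N) = t - s := by field_simp
    have hdy := hc.discreteYoung (x := x) hM (by linarith) hμβ hg (a := s) (N := N) hs hδ.le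
      (by rw [hNδ]; linarith) (fun n hn => by
        have hn' : ((n + 1 : ℕ) : ℝ) ≤ N := by exact_mod_cast hn
        have h1 := hx (s + n * ((t - s) / N)) (s + (n + 1 : ℕ) * ((t - s) / N)) (by positivity)
          (by push_cast; linarith) (by
            have : ((n + 1 : ℕ) : ℝ) * ((t - s) / N) ≤ N * ((t - s) / N) := by gcongr
            linarith)
        refine h1.trans ?_
        have e : s + ((n + 1 : ℕ) : ℝ) * ((t - s) / N) - (s + n * ((t - s) / N))
          = (t - s) / N := by push_cast; ring
        rw [e]
        calc K' * ((t - s) / N) ^ θ = K' * ((t - s) / N) ^ (θ - 1) * ((t - s) / N) := by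
              rw [mul_assoc, ← Real.rpow_add_one hδ.ne', sub_add_cancel]
          _ ≤ _ := mul_le_of_le_one_left hδ.le hN)
    obtain ⟨h1, h2⟩ := hC _ N 1 _ _ _ hδ (by rw [hNδ]; linarith) zero_le_one hdy
    have h1' := h1 N le_rfl
    have h2' := h2 0 N (Nat.zero_le _) le_rfl
    simp only [hNδ, Nat.cast_zero, zero_mul, add_zero, sub_zero, add_sub_cancel] at h1' h2'
    exact ⟨h1', h2'⟩
  · intro y δ N hδ hN hy
    have hdy := hc.discreteYoung (x := y) hM (by linarith) hμβ hg (a := 0) (N := N) le_rfl hδ.le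
      (by linarith) (fun n hn => by
        have := hy n hn ((n + 1 : ℕ) * δ) (by push_cast; linarith) (by push_cast; linarith)
        rw [zero_add, zero_add, this, norm_zero]
        exact hδ.le)
    obtain ⟨h1, h2⟩ := hC _ N 1 _ _ _ hδ (by linarith) zero_le_one hdy
    simp only [zero_add, Nat.cast_zero, zero_mul] at h1 h2
    exact ⟨h1, h2⟩

/-- For paths with a priori bounds, the local errors are of order `2 μ` with explicit constants. -/
theorem localError_le (hM : 0 ≤ M) (hK : 0 ≤ K) (hT : 0 ≤ T) (hμ : 1 / 2 < μ) (hμ1 : μ < 1)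
    (hμβ : μ ≤ β) (hγ : 2 * μ - 1 ≤ γ) {R : ℝ} (hR : 0 < R) (hLD : 0 ≤ LD R) : ∃ C : ℝ, 0 ≤ C ∧
    ∀ (S : ℝ → E → G →L[ℝ] E) (D : ℝ → E → E) (g : ℝ → G), Coeff T M β γ κ LD QS S D →
    (∀ s t, 0 ≤ s → s ≤ t → t ≤ T → ‖g t - g s‖ ≤ K * (t - s) ^ μ) →
    ∀ x, IsDavieSolution T S D g x → (∀ s, 0 ≤ s → s ≤ T → ‖x s‖ ≤ R) →
      (∀ s t, 0 ≤ s → s ≤ t → t ≤ T → ‖x t - x s‖ ≤ R * (t - s) ^ μ) →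
      ∀ s t, 0 ≤ s → s ≤ t → t ≤ T → ‖localError S D g x s t‖ ≤ C * (t - s) ^ (2 * μ) := by
  have hsc := sewingConst_pos (by linarith : 1 < 2 * μ)
  set W := (M + 1) * (1 + T ^ (β - μ)) * (R + 1) * K
    + (LD R * R * T ^ (1 + μ - 2 * μ) + M * T ^ (1 + γ - 2 * μ)) with hW
  have hTp : ∀ p : ℝ, 0 ≤ T ^ p := fun p => Real.rpow_nonneg hT _
  have hT1 := hTp (β - μ)
  have hT2 := hTp (1 + μ - 2 * μ)
  have hT3 := hTp (1 + γ - 2 * μ)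
  refine ⟨sewingConst (2 * μ) * W, by positivity, ?_⟩
  rintro S D g hc hg x ⟨K', θ, hθ, hx⟩ hxR hxH s t hs hst ht
  refine sewing_bound (by linarith) hθ ?_ hx hs hst ht
  intro s u t hs hsu hut ht
  have e : localError S D g x s t - localError S D g x s u - localError S D g x u t
      = (S u (x u) - S s (x s)) (g t - g u) + (t - u) • (D u (x u) - D s (x s)) := by
    have h1 : S s (x s) (g t - g s) = S s (x s) (g t - g u) + S s (x s) (g u - g s) := by
      rw [← map_add, sub_add_sub_cancel]
    have h2 : (t - s) • D s (x s) = (t - u) • D s (x s) + (u - s) • D s (x s) := by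
      rw [← add_smul, sub_add_sub_cancel]
    unfold localError
    rw [h1, h2, sub_apply, smul_sub]
    abel
  rw [e]
  have x0 := sub_nonneg.2 hsu
  have y0 := sub_nonneg.2 hut
  have z0 : 0 ≤ t - s := by linarith
  have hxu := hxH s u hs hsu (by linarith)
  have huμ : (u - s) ^ μ ≤ (t - s) ^ μ := Real.rpow_le_rpow x0 (by linarith) (by linarith)
  have htμ : (t - u) ^ μ ≤ (t - s) ^ μ := Real.rpow_le_rpow y0 (by linarith) (by linarith)
  have b1 : ‖S u (x u) - S s (x s)‖ ≤ (M + 1) * (1 + T ^ (β - μ)) * (R + 1) * (t - s) ^ μ := by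
    refine (hc.S_incr hM (by linarith) hμβ hs hsu (by linarith) _ _).trans ?_
    rw [mul_assoc _ (R + 1)]
    gcongr
    have : R * (u - s) ^ μ ≤ R * (t - s) ^ μ := by gcongr
    linarith
  have b2 : ‖D u (x u) - D s (x s)‖ ≤ LD R * (R * (t - s) ^ μ) + M * (t - s) ^ γ := by
    have h1 := hc.D_lip R hR u ⟨by linarith, by linarith⟩ (x u) (x s) (hxR u (by linarith)
      (by linarith)) (hxR s hs (by linarith))
    have h2 := hc.D_time s ⟨hs, by linarith⟩ u ⟨by linarith, by linarith⟩ (x s)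
    rw [abs_of_nonneg x0] at h2
    have h3 : (u - s) ^ γ ≤ (t - s) ^ γ := Real.rpow_le_rpow x0 (by linarith) (by linarith)
    have h4 : ‖D u (x u) - D s (x s)‖ ≤ ‖D u (x u) - D u (x s)‖ + ‖D u (x s) - D s (x s)‖ :=
      norm_sub_le_norm_sub_add_norm_sub _ _ _
    have h5 : LD R * ‖x u - x s‖ ≤ LD R * (R * (t - s) ^ μ) := by
      gcongr
      exact hxu.trans (by gcongr)
    have h6 := mul_le_mul_of_nonneg_left h3 hM
    linarith
  have p1 : (t - s) * (t - s) ^ μ ≤ T ^ (1 + μ - 2 * μ) * (t - s) ^ (2 * μ) := by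
    have := rpow_le_mul_rpow z0 (by linarith : t - s ≤ T) (by linarith : 1 + μ ≠ 0)
      (by linarith : 2 * μ ≤ 1 + μ)
    rwa [Real.rpow_add' z0 (by linarith), Real.rpow_one] at this
  have p2 : (t - s) * (t - s) ^ γ ≤ T ^ (1 + γ - 2 * μ) * (t - s) ^ (2 * μ) := by
    have := rpow_le_mul_rpow z0 (by linarith : t - s ≤ T) (by linarith : 1 + γ ≠ 0)
      (by linarith : 2 * μ ≤ 1 + γ)
    rwa [Real.rpow_add' z0 (by linarith), Real.rpow_one] at this
  have p3 : (t - s) ^ (2 * μ) = (t - s) ^ μ * (t - s) ^ μ := by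
    rw [← Real.rpow_add' z0 (by linarith), two_mul]
  refine (norm_add_le _ _).trans ?_
  rw [norm_smul, Real.norm_of_nonneg y0]
  have q1 : ‖(S u (x u) - S s (x s)) (g t - g u)‖
      ≤ (M + 1) * (1 + T ^ (β - μ)) * (R + 1) * K * (t - s) ^ (2 * μ) := by
    refine (ContinuousLinearMap.le_opNorm _ _).trans ?_
    calc _ ≤ ((M + 1) * (1 + T ^ (β - μ)) * (R + 1) * (t - s) ^ μ) * (K * (t - s) ^ μ) :=
          mul_le_mul b1 ((hg u t (by linarith) hut ht).trans (by gcongr)) (norm_nonneg _)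
            ((norm_nonneg _).trans b1)
      _ = _ := by rw [p3]; ring
  have q2 : (t - u) * ‖D u (x u) - D s (x s)‖
      ≤ (LD R * R * T ^ (1 + μ - 2 * μ) + M * T ^ (1 + γ - 2 * μ)) * (t - s) ^ (2 * μ) := by
    calc _ ≤ (t - s) * (LD R * (R * (t - s) ^ μ) + M * (t - s) ^ γ) :=
          mul_le_mul (by linarith) b2 (norm_nonneg _) z0
      _ = LD R * R * ((t - s) * (t - s) ^ μ) + M * ((t - s) * (t - s) ^ γ) := by ring
      _ ≤ LD R * R * (T ^ (1 + μ - 2 * μ) * (t - s) ^ (2 * μ))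
          + M * (T ^ (1 + γ - 2 * μ) * (t - s) ^ (2 * μ)) := by gcongr
      _ = _ := by ring
  rw [hW, add_mul]
  exact add_le_add q1 q2

/-- A path `x` that solves the equation with local errors of order `2 μ`, together with an Euler
approximation `y` on a grid, and a common bound `R` for both and for their Hölder constants. -/
structure EulerPair (T K μ A R : ℝ) (S : ℝ → E → G →L[ℝ] E) (D : ℝ → E → E) (g : ℝ → G)
    (x y : ℝ → E) (δ : ℝ) (N : ℕ) : Prop where
  mesh_pos : 0 < δ
  mesh : N * δ = T
  driver : ∀ s t, 0 ≤ s → s ≤ t → t ≤ T → ‖g t - g s‖ ≤ K * (t - s) ^ μ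
  init : x 0 = y 0
  error : ∀ s t, 0 ≤ s → s ≤ t → t ≤ T → ‖localError S D g x s t‖ ≤ A * (t - s) ^ (2 * μ)
  euler : IsEulerPath δ N S D g y
  x_bound : ∀ s, 0 ≤ s → s ≤ T → ‖x s‖ ≤ R
  x_holder : ∀ s t, 0 ≤ s → s ≤ t → t ≤ T → ‖x t - x s‖ ≤ R * (t - s) ^ μ
  y_bound : ∀ n : ℕ, n ≤ N → ‖y (n * δ)‖ ≤ R
  y_holder : ∀ i j : ℕ, i ≤ j → j ≤ N →
    ‖y (j * δ) - y (i * δ)‖ ≤ R * (((j : ℝ) - i) * δ) ^ μ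

lemma EulerPair.grid_le {A R : ℝ} {x y : ℝ → E} {δ : ℝ} {N : ℕ}
    (h : EulerPair T K μ A R S D g x y δ N) {n : ℕ} (hn : n ≤ N) : n * δ ≤ T := by
  have : (n : ℝ) ≤ N := by exact_mod_cast hn
  rw [← h.mesh]
  have := h.mesh_pos
  gcongr

/-- The difference of the solution and its Euler approximation solves a discrete Young
equation whose inhomogeneity is the local error per unit of time. -/
lemma EulerPair.discreteYoung (hM : 0 ≤ M) (hT : 0 ≤ T) (hμ : 1 / 2 < μ) (hκ : 0 < κ)
    (hκ1 : κ ≤ 1) (hμβ : μ ≤ β) {A R : ℝ} (hA : 0 ≤ A) (hR : 0 < R) (hLD : 0 ≤ LD R)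
    (hQS : 0 ≤ QS R) (hc : Coeff T M β γ κ LD QS S D) {x y : ℝ → E} {δ : ℝ} {N : ℕ}
    (h : EulerPair T K μ A R S D g x y δ N) :
    DiscreteYoung μ (κ * μ) (M + LD R + 1 + QS R * (T ^ (β - κ * μ) + (2 * R) ^ κ)) K δ N
      (A * δ ^ (2 * μ - 1)) (fun n => x (n * δ) - y (n * δ))
      (fun n => S (n * δ) (x (n * δ)) - S (n * δ) (y (n * δ))) (fun n => g (n * δ)) := by
  have hδ := h.mesh_pos
  have hTp : 0 ≤ T ^ (β - κ * μ) := Real.rpow_nonneg hT _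
  have hRp : 0 ≤ (2 * R) ^ κ := by positivity
  have hη : 0 ≤ A * δ ^ (2 * μ - 1) := by positivity
  have hQ : 0 ≤ QS R * (T ^ (β - κ * μ) + (2 * R) ^ κ) := by positivity
  have hpos : ∀ n : ℕ, 0 ≤ (n : ℝ) * δ := fun n => by positivity
  have hmono : ∀ i j : ℕ, i ≤ j → (i : ℝ) * δ ≤ j * δ := fun i j hij => by
    have : (i : ℝ) ≤ j := by exact_mod_cast hij
    gcongr
  have hdiff : ∀ i j : ℕ, (j : ℝ) * δ - i * δ = ((j : ℝ) - i) * δ := fun i j => by ring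
  refine ⟨?_, ?_, ?_, ?_⟩
  · intro i j hij hj
    have := h.driver _ _ (hpos i) (hmono i j hij) (h.grid_le hj)
    rwa [hdiff] at this
  · intro n hn
    have h1 := h.error (n * δ) ((n + 1 : ℕ) * δ) (hpos n) (hmono _ _ (Nat.le_succ n))
      (h.grid_le hn)
    have h2 := h.euler n hn ((n + 1 : ℕ) * δ) (by push_cast; linarith) (by push_cast; linarith)
    have h3 := hc.D_lip R hR (n * δ) ⟨hpos n, h.grid_le hn.le⟩ _ _
      (h.x_bound _ (hpos n) (h.grid_le hn.le)) (h.y_bound n hn.le)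
    have e1 : ((n + 1 : ℕ) : ℝ) * δ - n * δ = δ := by push_cast; ring
    rw [e1] at h1
    unfold localError at h1 h2
    rw [e1] at h1 h2
    have e : x ((n + 1 : ℕ) * δ) - y ((n + 1 : ℕ) * δ) - (x (n * δ) - y (n * δ))
        - (S (n * δ) (x (n * δ)) - S (n * δ) (y (n * δ))) (g ((n + 1 : ℕ) * δ) - g (n * δ))
        = (x ((n + 1 : ℕ) * δ) - x (n * δ)
            - S (n * δ) (x (n * δ)) (g ((n + 1 : ℕ) * δ) - g (n * δ)) - δ • D (n * δ) (x (n * δ)))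
          - (y ((n + 1 : ℕ) * δ) - y (n * δ)
            - S (n * δ) (y (n * δ)) (g ((n + 1 : ℕ) * δ) - g (n * δ)) - δ • D (n * δ) (y (n * δ)))
          + δ • (D (n * δ) (x (n * δ)) - D (n * δ) (y (n * δ))) := by
      rw [sub_apply, smul_sub]
      abel
    rw [e, h2, sub_zero]
    refine (norm_add_le _ _).trans ((add_le_add_left h1 _).trans ?_)
    rw [norm_smul, Real.norm_of_nonneg hδ.le]
    have e2 : A * δ ^ (2 * μ) = A * δ ^ (2 * μ - 1) * δ := by
      rw [mul_assoc, ← Real.rpow_add_one hδ.ne', sub_add_cancel]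
    rw [e2]
    have h5 := norm_nonneg (x (n * δ) - y (n * δ))
    calc _ ≤ A * δ ^ (2 * μ - 1) * δ + δ * (LD R * ‖x (n * δ) - y (n * δ)‖) := by gcongr
      _ = (LD R * ‖x (n * δ) - y (n * δ)‖ + 1 * (A * δ ^ (2 * μ - 1))) * δ := by ring
      _ ≤ ((M + LD R + 1 + QS R * (T ^ (β - κ * μ) + (2 * R) ^ κ)) * ‖x (n * δ) - y (n * δ)‖
          + (M + LD R + 1 + QS R * (T ^ (β - κ * μ) + (2 * R) ^ κ)) * (A * δ ^ (2 * μ - 1)))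
          * δ := by
        gcongr <;> linarith
      _ = _ := by ring
  · intro n hn
    refine (hc.S_lip _ ⟨hpos n, h.grid_le hn⟩ _ _).trans ?_
    have h5 := norm_nonneg (x (n * δ) - y (n * δ))
    gcongr <;> linarith
  · intro i j hij hj
    have hi := hij.trans hj
    have hx0 := grid_nonneg hδ.le hij
    have h1 := hc.four_point R hR (i * δ) ⟨hpos i, h.grid_le hi⟩ (j * δ) ⟨hpos j, h.grid_le hj⟩
      (x (j * δ)) (y (j * δ)) (x (i * δ)) (y (i * δ)) (h.x_bound _ (hpos j) (h.grid_le hj))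
      (h.y_bound j hj) (h.x_bound _ (hpos i) (h.grid_le hi)) (h.y_bound i hi)
    have h2 := h.x_holder _ _ (hpos i) (hmono i j hij) (h.grid_le hj)
    have h3 := h.y_holder i j hij hj
    rw [hdiff] at h1 h2
    rw [abs_of_nonneg hx0] at h1
    have hκμ : κ * μ ≤ β := (mul_le_of_le_one_left (by linarith) hκ1).trans hμβ
    have h4 : (((j : ℝ) - i) * δ) ^ β ≤ T ^ (β - κ * μ) * (((j : ℝ) - i) * δ) ^ (κ * μ) := by
      refine rpow_le_mul_rpow hx0 ?_ (by linarith) hκμ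
      have := h.grid_le hj
      rw [← hdiff]
      linarith [hpos i]
    have h5 : (‖x (j * δ) - x (i * δ)‖ + ‖y (j * δ) - y (i * δ)‖) ^ κ
        ≤ (2 * R) ^ κ * (((j : ℝ) - i) * δ) ^ (κ * μ) := by
      rw [mul_comm κ μ, Real.rpow_mul hx0,
        ← Real.mul_rpow (by positivity) (Real.rpow_nonneg hx0 _)]
      apply Real.rpow_le_rpow (by positivity) _ hκ.le
      linarith
    have h6 := norm_nonneg (x (j * δ) - y (j * δ) - (x (i * δ) - y (i * δ)))
    have h7 := norm_nonneg (x (i * δ) - y (i * δ))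
    have h8 := Real.rpow_nonneg hx0 (κ * μ)
    calc _ ≤ _ := h1
      _ ≤ M * ‖x (j * δ) - y (j * δ) - (x (i * δ) - y (i * δ))‖
        + QS R * ‖x (i * δ) - y (i * δ)‖ * (T ^ (β - κ * μ) * (((j : ℝ) - i) * δ) ^ (κ * μ)
          + (2 * R) ^ κ * (((j : ℝ) - i) * δ) ^ (κ * μ)) := by gcongr
      _ = M * ‖x (j * δ) - y (j * δ) - (x (i * δ) - y (i * δ))‖
        + QS R * (T ^ (β - κ * μ) + (2 * R) ^ κ) * ((‖x (i * δ) - y (i * δ)‖ + 0)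
          * (((j : ℝ) - i) * δ) ^ (κ * μ)) := by ring
      _ ≤ (M + LD R + 1 + QS R * (T ^ (β - κ * μ) + (2 * R) ^ κ))
            * ‖x (j * δ) - y (j * δ) - (x (i * δ) - y (i * δ))‖
          + (M + LD R + 1 + QS R * (T ^ (β - κ * μ) + (2 * R) ^ κ)) * ((‖x (i * δ) - y (i * δ)‖
            + A * δ ^ (2 * μ - 1)) * (((j : ℝ) - i) * δ) ^ (κ * μ)) := by
        gcongr <;> linarith
      _ = _ := by ring

/-- Increments of the error inside one step of the grid. -/
lemma EulerPair.step_le (hM : 0 ≤ M) (hT : 0 ≤ T) (hμ : 1 / 2 < μ) (hμ1 : μ < 1)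
    (hμβ : μ ≤ β) (hγ : 2 * μ - 1 ≤ γ) {A R : ℝ} (hA : 0 ≤ A) (hR : 0 < R) (hLD : 0 ≤ LD R)
    (hc : Coeff T M β γ κ LD QS S D) {x y : ℝ → E} {δ : ℝ} {N : ℕ}
    (h : EulerPair T K μ A R S D g x y δ N) {n : ℕ} (hn : n < N) {η : ℝ}
    (hη : ‖x (n * δ) - y (n * δ)‖ ≤ η * δ ^ (2 * μ - 1))
    {s t : ℝ} (hs : n * δ ≤ s) (hst : s ≤ t) (ht : t ≤ (n + 1) * δ) :
    ‖x t - y t - (x s - y s)‖ ≤ ((M + 1) * (1 + T ^ (β - μ)) * (R + 1) * K * T ^ (1 - μ)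
      + M * η * K + (LD R * R * T ^ (1 - μ) + M * T ^ (γ - (2 * μ - 1)) + LD R * η) * T ^ (1 - μ)
      + A * T ^ (1 - μ)) * δ ^ (2 * μ - 1) * (t - s) ^ μ := by
  have hδ := h.mesh_pos
  set τ : ℝ := n * δ with hτ
  set ε := δ ^ (2 * μ - 1) with hε
  have hε0 : 0 < ε := Real.rpow_pos_of_pos hδ _
  have hη0 : 0 ≤ η := by
    by_contra hneg
    have := (norm_nonneg _).trans hη
    nlinarith
  have hτ0 : 0 ≤ τ := by positivity
  have hτ1 : (n + 1) * δ ≤ T := by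
    have := h.grid_le hn
    push_cast at this
    exact this
  have hτT : τ ≤ T := h.grid_le hn.le
  have hδT : δ ≤ T := by linarith
  have hsτ : s - τ ≤ δ := by linarith
  have hd0 : 0 ≤ t - s := sub_nonneg.2 hst
  have hdδ : t - s ≤ δ := by linarith
  have hTp : ∀ p : ℝ, 0 ≤ T ^ p := fun p => Real.rpow_nonneg hT _
  have hT1 := hTp (β - μ)
  have hT2 := hTp (1 - μ)
  have hT3 := hTp (γ - (2 * μ - 1))
  have hdμ0 : 0 ≤ (t - s) ^ μ := Real.rpow_nonneg hd0 _
  have hsτμ0 : 0 ≤ (s - τ) ^ μ := Real.rpow_nonneg (sub_nonneg.2 hs) _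
  have r1 : (s - τ) ^ μ ≤ T ^ (1 - μ) * ε := by
    have h1 := rpow_le_mul_rpow hδ.le hδT (by linarith : μ ≠ 0) (by linarith : 2 * μ - 1 ≤ μ)
    rw [show μ - (2 * μ - 1) = 1 - μ by ring] at h1
    exact (Real.rpow_le_rpow (sub_nonneg.2 hs) hsτ (by linarith)).trans h1
  have r2 : (s - τ) ^ γ ≤ T ^ (γ - (2 * μ - 1)) * ε :=
    (Real.rpow_le_rpow (sub_nonneg.2 hs) hsτ (by linarith)).trans
      (rpow_le_mul_rpow hδ.le hδT (by linarith) hγ)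
  have r3 : t - s ≤ T ^ (1 - μ) * (t - s) ^ μ := by
    have := rpow_le_mul_rpow hd0 (by linarith : t - s ≤ T) one_ne_zero hμ1.le
    rwa [Real.rpow_one] at this
  have r4 : (t - s) ^ (2 * μ) ≤ T ^ (1 - μ) * ε * (t - s) ^ μ := by
    rw [two_mul, Real.rpow_add' hd0 (by linarith)]
    refine mul_le_mul_of_nonneg_right ?_ hdμ0
    have h1 := rpow_le_mul_rpow hδ.le hδT (by linarith : μ ≠ 0) (by linarith : 2 * μ - 1 ≤ μ)
    rw [show μ - (2 * μ - 1) = 1 - μ by ring] at h1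
    exact (Real.rpow_le_rpow hd0 hdδ (by linarith)).trans h1
  have hyt := h.euler n hn t (by linarith) ht
  have hys := h.euler n hn s hs (by linarith)
  rw [← hτ] at hyt hys
  have e : x t - y t - (x s - y s) = (S s (x s) - S τ (x τ)) (g t - g s)
      + (S τ (x τ) - S τ (y τ)) (g t - g s)
      + (t - s) • ((D s (x s) - D τ (x τ)) + (D τ (x τ) - D τ (y τ)))
      + localError S D g x s t - (localError S D g y τ t - localError S D g y τ s) := by
    have e1 : S τ (y τ) (g t - g s) = S τ (y τ) (g t - g τ) - S τ (y τ) (g s - g τ) := by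
      rw [← map_sub, sub_sub_sub_cancel_right]
    have e2 : (t - s) • D τ (y τ) = (t - τ) • D τ (y τ) - (s - τ) • D τ (y τ) := by
      rw [← sub_smul, sub_sub_sub_cancel_right]
    unfold localError
    simp only [sub_apply, smul_add, smul_sub, e1, e2]
    abel
  rw [e, hyt, hys, sub_zero, sub_zero]
  have hgst := h.driver s t (by linarith) hst (by linarith)
  have hxs := h.x_holder τ s hτ0 hs (by linarith)
  have b1 : ‖(S s (x s) - S τ (x τ)) (g t - g s)‖
      ≤ (M + 1) * (1 + T ^ (β - μ)) * (R + 1) * K * T ^ (1 - μ) * ε * (t - s) ^ μ := by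
    have h1 := hc.S_incr hM (by linarith) hμβ hτ0 hs (by linarith) (x s) (x τ)
    have h2 : ‖S s (x s) - S τ (x τ)‖
        ≤ (M + 1) * (1 + T ^ (β - μ)) * ((R + 1) * (T ^ (1 - μ) * ε)) := by
      refine h1.trans ?_
      have : ‖x s - x τ‖ + (s - τ) ^ μ ≤ (R + 1) * (T ^ (1 - μ) * ε) := by
        have : R * (s - τ) ^ μ ≤ R * (T ^ (1 - μ) * ε) := by gcongr
        linarith
      gcongr
    refine (ContinuousLinearMap.le_opNorm _ _).trans ?_
    refine (mul_le_mul h2 hgst (norm_nonneg _) (by positivity)).trans (le_of_eq ?_)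
    ring
  have b2 : ‖(S τ (x τ) - S τ (y τ)) (g t - g s)‖ ≤ M * η * K * ε * (t - s) ^ μ := by
    have h1 := hc.S_lip τ ⟨hτ0, hτT⟩ (x τ) (y τ)
    refine (ContinuousLinearMap.le_opNorm _ _).trans ?_
    refine (mul_le_mul (h1.trans (mul_le_mul_of_nonneg_left hη hM)) hgst (norm_nonneg _)
      (by positivity)).trans (le_of_eq ?_)
    ring
  have b3 : ‖(t - s) • ((D s (x s) - D τ (x τ)) + (D τ (x τ) - D τ (y τ)))‖
      ≤ (LD R * R * T ^ (1 - μ) + M * T ^ (γ - (2 * μ - 1)) + LD R * η) * T ^ (1 - μ) * ε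
        * (t - s) ^ μ := by
    have hsmem : s ∈ Icc 0 T := ⟨by linarith, by linarith⟩
    have hxsR := h.x_bound s hsmem.1 hsmem.2
    have hxτR := h.x_bound τ hτ0 hτT
    have h1 := hc.D_lip R hR s hsmem (x s) (x τ) hxsR hxτR
    have h2 := hc.D_time τ ⟨hτ0, hτT⟩ s hsmem (x τ)
    rw [abs_of_nonneg (sub_nonneg.2 hs)] at h2
    have h3 := hc.D_lip R hR τ ⟨hτ0, hτT⟩ (x τ) (y τ) hxτR (h.y_bound n hn.le)
    have h4 : ‖D s (x s) - D τ (x τ)‖ ≤ ‖D s (x s) - D s (x τ)‖ + ‖D s (x τ) - D τ (x τ)‖ :=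
      norm_sub_le_norm_sub_add_norm_sub _ _ _
    have h5 : LD R * ‖x s - x τ‖ ≤ LD R * (R * (T ^ (1 - μ) * ε)) := by
      gcongr
      exact hxs.trans (by gcongr)
    have h6 := mul_le_mul_of_nonneg_left r2 hM
    have h7 := mul_le_mul_of_nonneg_left hη hLD
    have h8 : ‖(D s (x s) - D τ (x τ)) + (D τ (x τ) - D τ (y τ))‖
        ≤ (LD R * R * T ^ (1 - μ) + M * T ^ (γ - (2 * μ - 1)) + LD R * η) * ε := by
      refine (norm_add_le _ _).trans ?_
      linarith
    rw [norm_smul, Real.norm_of_nonneg hd0]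
    refine (mul_le_mul r3 h8 (norm_nonneg _) (by positivity)).trans (le_of_eq ?_)
    ring
  have b4 : ‖localError S D g x s t‖ ≤ A * T ^ (1 - μ) * ε * (t - s) ^ μ := by
    refine (h.error s t (by linarith) hst (by linarith)).trans ?_
    refine (mul_le_mul_of_nonneg_left r4 hA).trans (le_of_eq ?_)
    ring
  refine (norm_add_le _ _).trans ((add_le_add_left norm_add₃_le _).trans ?_)
  linarith

/-- The increments of the error over arbitrary intervals: full steps of the grid in the middle,
and parts of one step at both ends. -/
lemma EulerPair.incr_le {A R c₁ c₂ : ℝ} {x y : ℝ → E} {δ : ℝ} {N : ℕ} (hμ : 0 < μ)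
    (h : EulerPair T K μ A R S D g x y δ N) (hc₁ : 0 ≤ c₁)
    (hstep : ∀ n < N, ∀ s t, n * δ ≤ s → s ≤ t → t ≤ (n + 1) * δ →
      ‖x t - y t - (x s - y s)‖ ≤ c₁ * (t - s) ^ μ)
    (hgrid : ∀ i j : ℕ, i ≤ j → j ≤ N →
      ‖x (j * δ) - y (j * δ) - (x (i * δ) - y (i * δ))‖ ≤ c₂ * (((j : ℝ) - i) * δ) ^ μ)
    (hc₂ : 0 ≤ c₂) {s t : ℝ} (hs : 0 ≤ s) (hst : s ≤ t) (ht : t ≤ T) :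
    ‖x t - y t - (x s - y s)‖ ≤ (2 * c₁ + c₂) * (t - s) ^ μ := by
  have hδ := h.mesh_pos
  have hd0 : 0 ≤ t - s := sub_nonneg.2 hst
  have hdμ0 : 0 ≤ (t - s) ^ μ := Real.rpow_nonneg hd0 _
  set i := ⌊s / δ⌋₊ with hi
  set j := ⌊t / δ⌋₊ with hj
  have hi1 : i * δ ≤ s := (le_div_iff₀ hδ).1 (Nat.floor_le (by positivity))
  have hi2 : s < (i + 1) * δ := (div_lt_iff₀ hδ).1 (Nat.lt_floor_add_one _)
  have hj1 : j * δ ≤ t :=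
    (le_div_iff₀ hδ).1 (Nat.floor_le (div_nonneg (hs.trans hst) hδ.le))
  have hj2 : t < (j + 1) * δ := (div_lt_iff₀ hδ).1 (Nat.lt_floor_add_one _)
  have hjN : j ≤ N := by
    have : (j : ℝ) * δ ≤ N * δ := by rw [h.mesh]; linarith
    exact_mod_cast le_of_mul_le_mul_right this hδ
  -- from the last grid point before a time to that time; at `T` there is no following step
  have hright : ∀ s, j * δ ≤ s → s ≤ t →
      ‖x t - y t - (x s - y s)‖ ≤ c₁ * (t - s) ^ μ := by
    intro s hs hst
    rcases hjN.lt_or_eq with hlt | heq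
    · exact hstep j hlt s t hs hst hj2.le
    · have : j * δ = T := by rw [heq, h.mesh]
      have e : s = t := by linarith
      rw [e, sub_self, norm_zero, sub_self]
      positivity
  rcases (Nat.floor_mono (by gcongr : s / δ ≤ t / δ) : i ≤ j).eq_or_lt with hij | hij
  · have hij' : i = j := hij
    refine (hright s (by rw [← hij']; exact hi1) hst).trans ?_
    gcongr
    linarith
  · have hij' : ((i + 1 : ℕ) : ℝ) ≤ j := by exact_mod_cast hij
    have hm : ((i + 1 : ℕ) : ℝ) * δ ≤ j * δ := by gcongr
    have hi3 : s ≤ ((i + 1 : ℕ) : ℝ) * δ := by push_cast; linarith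
    have h1 := hstep i (by omega) s ((i + 1 : ℕ) * δ) hi1 hi3 (by push_cast; linarith)
    have h2 := hgrid (i + 1) j hij hjN
    have h3 := hright (j * δ) le_rfl hj1
    have m1 : (((i + 1 : ℕ) : ℝ) * δ - s) ^ μ ≤ (t - s) ^ μ :=
      Real.rpow_le_rpow (sub_nonneg.2 hi3) (by linarith) hμ.le
    have m2 : (((j : ℝ) - (i + 1 : ℕ)) * δ) ^ μ ≤ (t - s) ^ μ :=
      Real.rpow_le_rpow (grid_nonneg hδ.le hij) (by linarith) hμ.le
    have m3 : (t - j * δ) ^ μ ≤ (t - s) ^ μ :=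
      Real.rpow_le_rpow (sub_nonneg.2 hj1) (by linarith) hμ.le
    have e : x t - y t - (x s - y s) = (x t - y t - (x (j * δ) - y (j * δ)))
        + (x (j * δ) - y (j * δ) - (x ((i + 1 : ℕ) * δ) - y ((i + 1 : ℕ) * δ)))
        + (x ((i + 1 : ℕ) * δ) - y ((i + 1 : ℕ) * δ) - (x s - y s)) := by abel
    rw [e]
    refine norm_add₃_le.trans ?_
    have q1 := mul_le_mul_of_nonneg_left m1 hc₁
    have q2 := mul_le_mul_of_nonneg_left m2 hc₂
    have q3 := mul_le_mul_of_nonneg_left m3 hc₁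
    linarith

/-- The error of the Euler approximation is of order `δ ^ (2 μ - 1)` in the Hölder norm of order
`μ`, with a constant that depends on the driver and the initial value through a bound `K` only. -/
theorem exists_error_bound (hM : 0 ≤ M) (hK : 0 ≤ K) (hT : 0 ≤ T) (hμ : 1 / 2 < μ)
    (hμ1 : μ < 1) (hμβ : μ ≤ β) (hγ : 2 * μ - 1 ≤ γ) (hκ1 : κ ≤ 1)
    (hκμ : 1 < κ * μ + μ) (hLD : ∀ R, 0 ≤ LD R) (hQS : ∀ R, 0 ≤ QS R) : ∃ C : ℝ, 0 ≤ C ∧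
    ∀ (S : ℝ → E → G →L[ℝ] E) (D : ℝ → E → E) (g : ℝ → G) (x y : ℝ → E) (δ : ℝ) (N : ℕ),
      Coeff T M β γ κ LD QS S D →
      (∀ s t, 0 ≤ s → s ≤ t → t ≤ T → ‖g t - g s‖ ≤ K * (t - s) ^ μ) →
      IsDavieSolution T S D g x → 0 < δ → N * δ = T → IsEulerPath δ N S D g y →
      x 0 = y 0 → ‖x 0‖ ≤ K → ∀ s t, 0 ≤ s → s ≤ t → t ≤ T →
      ‖x t - y t - (x s - y s)‖ ≤ C * δ ^ (2 * μ - 1) * (t - s) ^ μ := by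
  obtain ⟨C₀, hC₀1, hC₀⟩ := exists_apriori_bound (E := E) (G := G) (T := T) (M := M) (β := β)
    (γ := γ) (κ := κ) (LD := LD) (QS := QS) hM hK hT hμ hμ1 hμβ
  set R := C₀ * (C₀ * (K + 1)) with hR
  have hR1 : C₀ * (K + 1) ≤ R := le_mul_of_one_le_left (by positivity) hC₀1
  have hR0 : 0 < R := by positivity
  obtain ⟨A, hA0, hA⟩ := localError_le (E := E) (G := G) (κ := κ) (QS := QS) hM hK hT hμ hμ1 hμβ
    hγ hR0 (hLD R)
  have hκ : 0 < κ := by nlinarith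
  have hQ : 0 ≤ QS R * (T ^ (β - κ * μ) + (2 * R) ^ κ) :=
    mul_nonneg (hQS R) (add_nonneg (Real.rpow_nonneg hT _) (by positivity))
  obtain ⟨C₁, hC₁1, hC₁⟩ := DiscreteYoung.exists_bound (E := E) (G := G) (μ := μ) (κ := κ * μ)
    (M := M + LD R + 1 + QS R * (T ^ (β - κ * μ) + (2 * R) ^ κ)) (K := K) (T := T) hμ1.le
    (by positivity) (mul_le_of_le_one_left (by linarith) hκ1) hκμ
    (by have := hLD R; linarith) hK hT
  have hLDR := hLD R
  have hTp : ∀ p : ℝ, 0 ≤ T ^ p := fun p => Real.rpow_nonneg hT _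
  have hT1 := hTp (β - μ)
  have hT2 := hTp (1 - μ)
  have hT3 := hTp (γ - (2 * μ - 1))
  set c := (M + 1) * (1 + T ^ (β - μ)) * (R + 1) * K * T ^ (1 - μ)
      + M * (C₁ * A) * K + (LD R * R * T ^ (1 - μ) + M * T ^ (γ - (2 * μ - 1))
      + LD R * (C₁ * A)) * T ^ (1 - μ) + A * T ^ (1 - μ) with hc_def
  have hc0 : 0 ≤ c := by positivity
  refine ⟨2 * c + C₁ * A, by positivity, ?_⟩
  intro S D g x y δ N hcoef hg hx hδ hN hy h0 hx0
  obtain ⟨hX, hY⟩ := hC₀ S D g hcoef hg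
  obtain ⟨hY1, hY2⟩ := hY y δ N hδ hN.le hy
  have hstart : C₀ * (‖x 0‖ + 1) ≤ C₀ * (K + 1) := by gcongr
  have hxR : ∀ s, 0 ≤ s → s ≤ T → ‖x s‖ + 1 ≤ C₀ * (K + 1) := fun s hs hsT =>
    (hX x hx 0 s le_rfl hs hsT).1.trans hstart
  have pair : EulerPair T K μ A R S D g x y δ N := by
    have xb : ∀ s, 0 ≤ s → s ≤ T → ‖x s‖ ≤ R := fun s hs hsT => by
      have := hxR s hs hsT
      linarith
    have xh : ∀ s t, 0 ≤ s → s ≤ t → t ≤ T → ‖x t - x s‖ ≤ R * (t - s) ^ μ := by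
      intro s t hs hst ht
      refine (hX x hx s t hs hst ht).2.trans ?_
      exact mul_le_mul_of_nonneg_right
        (mul_le_mul_of_nonneg_left (hxR s hs (hst.trans ht)) (by linarith))
        (Real.rpow_nonneg (sub_nonneg.2 hst) μ)
    refine ⟨hδ, hN, hg, h0, hA S D g hcoef hg x hx xb xh, hy, xb, xh, ?_, ?_⟩
    · intro n hn
      have := hY1 n hn
      rw [← h0] at this
      linarith
    · intro i j hij hj
      refine (hY2 i j hij hj).trans ?_
      have := Real.rpow_nonneg (grid_nonneg hδ.le hij) μ
      rw [← h0]
      gcongr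
      linarith
  have hε : 0 ≤ δ ^ (2 * μ - 1) := by positivity
  obtain ⟨hZ1, hZ2⟩ := hC₁ δ N (A * δ ^ (2 * μ - 1)) _ _ _ hδ hN.le (by positivity)
    (pair.discreteYoung hM hT hμ hκ hκ1 hμβ hA0 hR0 hLDR (hQS R) hcoef)
  simp only [Nat.cast_zero, zero_mul, h0, sub_self, norm_zero, zero_add] at hZ1 hZ2
  have hZ1' : ∀ n ≤ N, ‖x (n * δ) - y (n * δ)‖ ≤ C₁ * A * δ ^ (2 * μ - 1) := fun n hn => by
    have h1 := hZ1 n hn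
    have h2 : 0 ≤ A * δ ^ (2 * μ - 1) := by positivity
    rw [mul_assoc]
    linarith
  intro s t hs hst ht
  have key := pair.incr_le (c₁ := c * δ ^ (2 * μ - 1)) (c₂ := C₁ * A * δ ^ (2 * μ - 1))
    (by linarith) (by positivity)
    (fun n hn s t hs hst ht => pair.step_le hM hT hμ hμ1 hμβ hγ hA0 hR0 hLDR hcoef hn
      (hZ1' n hn.le) hs hst ht)
    (fun i j hij hj => by
      have := hZ2 i j hij hj
      rwa [← mul_assoc C₁] at this) (by positivity) hs hst ht
  refine key.trans (le_of_eq ?_)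
  ring

end Deterministic

/-! ### Vector and matrix norms -/

lemma vecNorm_nonneg {d : ℕ} (y : Fin d → ℝ) : 0 ≤ vecNorm y :=
  Finset.sum_nonneg fun _ _ => abs_nonneg _

lemma matNorm_nonneg {d m : ℕ} (A : Fin d → Fin m → ℝ) : 0 ≤ matNorm A :=
  Finset.sum_nonneg fun _ _ => Finset.sum_nonneg fun _ _ => abs_nonneg _

lemma norm_le_vecNorm {d : ℕ} (y : Fin d → ℝ) : ‖y‖ ≤ vecNorm y :=
  (pi_norm_le_iff_of_nonneg (vecNorm_nonneg y)).2 fun i =>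
    Finset.single_le_sum (f := fun i => |y i|) (fun _ _ => abs_nonneg _) (Finset.mem_univ i)

lemma vecNorm_le {d : ℕ} (y : Fin d → ℝ) : vecNorm y ≤ d * ‖y‖ := by
  unfold vecNorm
  calc ∑ i, |y i| ≤ ∑ _i : Fin d, ‖y‖ := Finset.sum_le_sum fun i _ => norm_le_pi_norm y i
    _ = d * ‖y‖ := by simp

lemma abs_le_matNorm {d m : ℕ} (A : Fin d → Fin m → ℝ) (i : Fin d) (j : Fin m) :
    |A i j| ≤ matNorm A :=
  (Finset.single_le_sum (f := fun j => |A i j|) (fun _ _ => abs_nonneg _)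
    (Finset.mem_univ j)).trans (Finset.single_le_sum (f := fun i => ∑ j, |A i j|)
      (fun _ _ => Finset.sum_nonneg fun _ _ => abs_nonneg _) (Finset.mem_univ i))

/-- The linear map of a matrix, as a continuous map between spaces with the supremum norm. -/
noncomputable def matCLM {d m : ℕ} (A : Fin d → Fin m → ℝ) : (Fin m → ℝ) →L[ℝ] (Fin d → ℝ) :=
  ContinuousLinearMap.pi fun i => ∑ j, A i j • ContinuousLinearMap.proj j

lemma matCLM_apply {d m : ℕ} (A : Fin d → Fin m → ℝ) (v : Fin m → ℝ) (i : Fin d) :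
    matCLM A v i = ∑ j, A i j * v j := by
  simp [matCLM]

lemma matCLM_sub {d m : ℕ} (A A' : Fin d → Fin m → ℝ) :
    matCLM A - matCLM A' = matCLM (A - A') := by
  ext v i
  simp only [sub_apply, Pi.sub_apply, matCLM_apply, sub_mul, Finset.sum_sub_distrib]

lemma norm_matCLM_le {d m : ℕ} (A : Fin d → Fin m → ℝ) : ‖matCLM A‖ ≤ matNorm A := by
  refine ContinuousLinearMap.opNorm_le_bound _ (matNorm_nonneg A) fun v => ?_
  refine (pi_norm_le_iff_of_nonneg (mul_nonneg (matNorm_nonneg A) (norm_nonneg v))).2 fun i => ?_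
  rw [matCLM_apply]
  calc ‖∑ j, A i j * v j‖ ≤ ∑ j, |A i j| * ‖v‖ := by
        refine (norm_sum_le _ _).trans (Finset.sum_le_sum fun j _ => ?_)
        rw [norm_mul]
        exact mul_le_mul_of_nonneg_left (norm_le_pi_norm v j) (abs_nonneg _)
    _ = (∑ j, |A i j|) * ‖v‖ := by rw [Finset.sum_mul]
    _ ≤ _ := by
      refine mul_le_mul_of_nonneg_right ?_ (norm_nonneg v)
      exact Finset.single_le_sum (f := fun i => ∑ j, |A i j|)
        (fun _ _ => Finset.sum_nonneg fun _ _ => abs_nonneg _) (Finset.mem_univ i)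

lemma matNorm_le_of_forall {d m : ℕ} {A : Fin d → Fin m → ℝ} {c : ℝ} (h : ∀ i j, |A i j| ≤ c) :
    matNorm A ≤ d * m * c := by
  unfold matNorm
  calc ∑ i, ∑ j, |A i j| ≤ ∑ _i : Fin d, ∑ _j : Fin m, c :=
        Finset.sum_le_sum fun i _ => Finset.sum_le_sum fun j _ => h i j
    _ = d * m * c := by simp [mul_assoc]

/-- The operator norm, for the supremum norm, is bounded by the sum of the partial derivatives. -/
lemma norm_le_sum_partial {d : ℕ} (φ : (Fin d → ℝ) →L[ℝ] ℝ) :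
    ‖φ‖ ≤ ∑ k, |φ (Pi.single k 1)| := by
  refine ContinuousLinearMap.opNorm_le_bound _ (Finset.sum_nonneg fun _ _ => abs_nonneg _)
    fun v => ?_
  have e : φ v = ∑ k, v k * φ (Pi.single k 1) := by
    conv_lhs => rw [← Finset.univ_sum_single v]
    rw [map_sum]
    refine Finset.sum_congr rfl fun k _ => ?_
    rw [← smul_eq_mul, ← map_smul]
    congr 1
    ext i
    by_cases h : i = k
    · subst h; simp
    · simp [h]
  rw [e, Finset.sum_mul]
  refine (norm_sum_le _ _).trans (Finset.sum_le_sum fun k _ => ?_)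
  rw [norm_mul, mul_comm]
  exact mul_le_mul_of_nonneg_left (norm_le_pi_norm v k) (abs_nonneg _)

/-! ### The four-point estimate -/

/-- Second differences of a function whose derivative is locally Hölder continuous. -/
lemma abs_second_difference_le {E : Type*} [NormedAddCommGroup E] [NormedSpace ℝ E] {φ : E → ℝ}
    (hφ : Differentiable ℝ φ) {b q R κ : ℝ} (hq : 0 ≤ q) (hκ : 0 ≤ κ)
    (hb : ∀ x, ‖fderiv ℝ φ x‖ ≤ b)
    (hH : ∀ x y, ‖x‖ ≤ R → ‖y‖ ≤ R → ‖fderiv ℝ φ x - fderiv ℝ φ y‖ ≤ q * ‖x - y‖ ^ κ)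
    {x₁ x₂ x₃ x₄ : E} (h₁ : ‖x₁‖ ≤ R) (h₂ : ‖x₂‖ ≤ R) (h₃ : ‖x₃‖ ≤ R) (h₄ : ‖x₄‖ ≤ R) :
    |φ x₁ - φ x₂ - (φ x₃ - φ x₄)| ≤ b * ‖x₁ - x₂ - (x₃ - x₄)‖
      + q * (‖x₁ - x₃‖ + ‖x₂ - x₄‖) ^ κ * ‖x₃ - x₄‖ := by
  let u : ℝ → E := fun θ => x₂ + θ • (x₁ - x₂)
  let v : ℝ → E := fun θ => x₄ + θ • (x₃ - x₄)
  have hu : ∀ θ, HasDerivAt u (x₁ - x₂) θ := fun θ => by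
    have h := ((hasDerivAt_id θ).smul_const (x₁ - x₂)).const_add x₂
    rwa [one_smul] at h
  have hv : ∀ θ, HasDerivAt v (x₃ - x₄) θ := fun θ => by
    have h := ((hasDerivAt_id θ).smul_const (x₃ - x₄)).const_add x₄
    rwa [one_smul] at h
  have hder : ∀ θ, HasDerivAt (fun θ => φ (u θ) - φ (v θ))
      (fderiv ℝ φ (u θ) (x₁ - x₂) - fderiv ℝ φ (v θ) (x₃ - x₄)) θ := fun θ =>
    ((hφ (u θ)).hasFDerivAt.comp_hasDerivAt θ (hu θ)).sub
      ((hφ (v θ)).hasFDerivAt.comp_hasDerivAt θ (hv θ))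
  have hball : ∀ (θ : ℝ) (a c : E), 0 ≤ θ → θ ≤ 1 → ∀ r, ‖a‖ ≤ r → ‖c‖ ≤ r →
      ‖c + θ • (a - c)‖ ≤ r := by
    intro θ a c h0 h1 r ha hc
    have e : c + θ • (a - c) = (1 - θ) • c + θ • a := by
      rw [smul_sub, sub_smul, one_smul]; abel
    rw [e]
    refine (norm_add_le _ _).trans ?_
    rw [norm_smul, norm_smul, Real.norm_of_nonneg h0, Real.norm_of_nonneg (by linarith)]
    nlinarith
  have key := norm_image_sub_le_of_norm_deriv_le_segment_01'
    (f := fun θ => φ (u θ) - φ (v θ)) (C := b * ‖x₁ - x₂ - (x₃ - x₄)‖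
      + q * (‖x₁ - x₃‖ + ‖x₂ - x₄‖) ^ κ * ‖x₃ - x₄‖)
    (fun θ _ => (hder θ).hasDerivWithinAt) ?_
  · have e : (fun θ => φ (u θ) - φ (v θ)) 1 - (fun θ => φ (u θ) - φ (v θ)) 0
        = φ x₁ - φ x₂ - (φ x₃ - φ x₄) := by
      simp only [u, v, one_smul, zero_smul, add_zero, add_sub_cancel]
      ring
    rw [e] at key
    exact key
  · intro θ hθ
    have e : fderiv ℝ φ (u θ) (x₁ - x₂) - fderiv ℝ φ (v θ) (x₃ - x₄)
        = fderiv ℝ φ (u θ) (x₁ - x₂ - (x₃ - x₄))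
          + (fderiv ℝ φ (u θ) - fderiv ℝ φ (v θ)) (x₃ - x₄) := by
      rw [map_sub (fderiv ℝ φ (u θ)) (x₁ - x₂), sub_apply]
      ring
    rw [e]
    have huv : ‖u θ - v θ‖ ≤ ‖x₁ - x₃‖ + ‖x₂ - x₄‖ := by
      have e2 : u θ - v θ = (x₂ - x₄) + θ • ((x₁ - x₃) - (x₂ - x₄)) := by
        simp only [u, v, smul_sub]; abel
      rw [e2]
      exact hball θ _ _ hθ.1 hθ.2.le _ (le_add_of_nonneg_right (norm_nonneg _))
        (le_add_of_nonneg_left (norm_nonneg _))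
    refine (norm_add_le _ _).trans (add_le_add ?_ ?_)
    · exact (ContinuousLinearMap.le_opNorm _ _).trans
        (mul_le_mul_of_nonneg_right (hb _) (norm_nonneg _))
    · refine (ContinuousLinearMap.le_opNorm _ _).trans
        (mul_le_mul_of_nonneg_right ?_ (norm_nonneg _))
      refine (hH _ _ (hball θ _ _ hθ.1 hθ.2.le _ h₁ h₂) (hball θ _ _ hθ.1 hθ.2.le _ h₃ h₄)).trans ?_
      gcongr

section Coefficients

variable {d m : ℕ} {T M β κ L Cσ Cb γ : ℝ} {ML LL : ℝ → ℝ}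
  {σ : ℝ → (Fin d → ℝ) → Fin d → Fin m → ℝ} {b : ℝ → (Fin d → ℝ) → Fin d → ℝ}

lemma vecNorm_le_of_norm_le {R : ℝ} {x : Fin d → ℝ} (hx : ‖x‖ ≤ R) :
    vecNorm x ≤ d * R + 1 := by
  have h1 := vecNorm_le x
  have h2 : (d : ℝ) * ‖x‖ ≤ d * R := by gcongr
  linarith

lemma CondA.norm_fderiv_le (hA : CondA T M ML β κ σ) {t : ℝ} (ht : t ∈ Icc 0 T) (i : Fin d)
    (j : Fin m) (x : Fin d → ℝ) : ‖fderiv ℝ (fun z => σ t z i j) x‖ ≤ |M| * d := by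
  refine norm_fderiv_le_of_lip' ℝ (by positivity) (Filter.Eventually.of_forall fun y => ?_)
  have h1 := abs_le_matNorm (σ t y - σ t x) i j
  have h2 := hA.lipschitz t ht y x
  have h3 := vecNorm_le (y - x)
  calc ‖σ t y i j - σ t x i j‖ ≤ M * vecNorm (y - x) := h1.trans h2
    _ ≤ |M| * (d * ‖y - x‖) := by
      have := vecNorm_nonneg (y - x)
      have := le_abs_self M
      gcongr
    _ = _ := by ring

lemma CondA.norm_fderiv_sub_le (hA : CondA T M ML β κ σ) (hκ : 0 ≤ κ) {R : ℝ} (hR : 0 < R) {t : ℝ}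
    (ht : t ∈ Icc 0 T) (i : Fin d) (j : Fin m) {x y : Fin d → ℝ} (hx : ‖x‖ ≤ R) (hy : ‖y‖ ≤ R) :
    ‖fderiv ℝ (fun z => σ t z i j) x - fderiv ℝ (fun z => σ t z i j) y‖
      ≤ d * (|ML (d * R + 1)| * d ^ κ) * ‖x - y‖ ^ κ := by
  refine (norm_le_sum_partial _).trans ?_
  calc _ ≤ ∑ _k : Fin d, |ML (d * R + 1)| * d ^ κ * ‖x - y‖ ^ κ := by
        refine Finset.sum_le_sum fun k _ => ?_
        have h1 := abs_le_matNorm (partialX σ k t x - partialX σ k t y) i j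
        have h2 := hA.holder_deriv (d * R + 1) (by positivity) t ht x y
          (vecNorm_le_of_norm_le hx) (vecNorm_le_of_norm_le hy) k
        refine (h1.trans h2).trans ?_
        rw [mul_assoc, ← Real.mul_rpow (by positivity) (norm_nonneg _)]
        have h3 := vecNorm_nonneg (x - y)
        have h4 := le_abs_self (ML (d * R + 1))
        have h5 := vecNorm_le (x - y)
        gcongr
    _ = _ := by simp; ring

lemma CondA.norm_fderiv_time_le (hA : CondA T M ML β κ σ) {s t : ℝ} (hs : s ∈ Icc 0 T)
    (ht : t ∈ Icc 0 T) (i : Fin d) (j : Fin m) (x : Fin d → ℝ) :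
    ‖fderiv ℝ (fun z => σ t z i j - σ s z i j) x‖ ≤ d * (|M| * |t - s| ^ β) := by
  rw [fderiv_fun_sub (hA.differentiable t ht i j x) (hA.differentiable s hs i j x)]
  refine (norm_le_sum_partial _).trans ?_
  calc _ ≤ ∑ _k : Fin d, |M| * |t - s| ^ β := by
        refine Finset.sum_le_sum fun k _ => ?_
        have h1 := abs_le_matNorm (partialX σ k t x - partialX σ k s x) i j
        have h2 := (hA.holder_time s hs t ht x).2 k
        have h3 := matNorm_nonneg (σ t x - σ s x)
        have h4 : M * |t - s| ^ β ≤ |M| * |t - s| ^ β := by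
          have := le_abs_self M
          gcongr
        refine h1.trans ?_
        linarith
    _ = _ := by simp

/-- The four-point estimate for the diffusion coefficient: the spatial second difference is
controlled by the Hölder continuity of the derivative, the time shift by the time regularity of
the derivative. -/
lemma CondA.four_point (hA : CondA T M ML β κ σ) (hκ : 0 ≤ κ) {R : ℝ} (hR : 0 < R) {s t : ℝ}
    (hs : s ∈ Icc 0 T) (ht : t ∈ Icc 0 T) {x₁ x₂ x₃ x₄ : Fin d → ℝ} (h₁ : ‖x₁‖ ≤ R)
    (h₂ : ‖x₂‖ ≤ R) (h₃ : ‖x₃‖ ≤ R) (h₄ : ‖x₄‖ ≤ R) :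
    matNorm (σ t x₁ - σ t x₂ - (σ s x₃ - σ s x₄)) ≤ d * m * (|M| * d) * ‖x₁ - x₂ - (x₃ - x₄)‖
      + d * m * (d * |M| + d * (|ML (d * R + 1)| * d ^ κ)) * ‖x₃ - x₄‖
        * (|t - s| ^ β + (‖x₁ - x₃‖ + ‖x₂ - x₄‖) ^ κ) := by
  set Q := d * (|ML (d * R + 1)| * (d : ℝ) ^ κ) with hQ
  have hQ0 : 0 ≤ Q := by positivity
  have h : ∀ i j, |(σ t x₁ - σ t x₂ - (σ s x₃ - σ s x₄)) i j|
      ≤ |M| * d * ‖x₁ - x₂ - (x₃ - x₄)‖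
        + Q * (‖x₁ - x₃‖ + ‖x₂ - x₄‖) ^ κ * ‖x₃ - x₄‖
        + d * (|M| * |t - s| ^ β) * ‖x₃ - x₄‖ := by
    intro i j
    have e : (σ t x₁ - σ t x₂ - (σ s x₃ - σ s x₄)) i j
        = (σ t x₁ i j - σ t x₂ i j - (σ t x₃ i j - σ t x₄ i j))
          + ((σ t x₃ i j - σ s x₃ i j) - (σ t x₄ i j - σ s x₄ i j)) := by
      simp only [Pi.sub_apply]; ring
    rw [e]
    refine (abs_add_le _ _).trans (add_le_add ?_ ?_)
    · exact abs_second_difference_le (hA.differentiable t ht i j) hQ0 hκ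
        (hA.norm_fderiv_le ht i j) (fun x y hx hy => hA.norm_fderiv_sub_le hκ hR ht i j hx hy)
        h₁ h₂ h₃ h₄
    · have hdiff : Differentiable ℝ fun z => σ t z i j - σ s z i j :=
        (hA.differentiable t ht i j).sub (hA.differentiable s hs i j)
      exact convex_univ.norm_image_sub_le_of_norm_fderiv_le (𝕜 := ℝ)
        (f := fun z => σ t z i j - σ s z i j) (fun x _ => hdiff x)
        (fun x _ => hA.norm_fderiv_time_le hs ht i j x) (mem_univ x₄) (mem_univ x₃)
  refine (matNorm_le_of_forall h).trans ?_
  have n1 := norm_nonneg (x₃ - x₄)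
  have n2 : 0 ≤ (‖x₁ - x₃‖ + ‖x₂ - x₄‖) ^ κ := by positivity
  have n3 : 0 ≤ |t - s| ^ β := by positivity
  have : 0 ≤ (d : ℝ) * m * (d * |M| * (‖x₃ - x₄‖ * (‖x₁ - x₃‖ + ‖x₂ - x₄‖) ^ κ)
      + Q * (‖x₃ - x₄‖ * |t - s| ^ β)) := by positivity
  linarith

/-- The assumptions on the coefficients, in terms of the supremum norm of vectors and the operator
norm of matrices. -/
theorem coeff_of_cond (hκ : 0 ≤ κ) (hA : CondA T M ML β κ σ) (hB : CondB T L LL b)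
    (hC : CondC T Cσ σ) (hD : CondD T Cb γ b) :
    Coeff T ((d * m + 1) * (d + 1) * (|M| + |L| + |Cσ| + |Cb|)) β γ κ
      (fun R => |LL (d * R + 1)| * d)
      (fun R => d * m * (d * |M| + d * (|ML (d * R + 1)| * d ^ κ)))
      (fun t x => matCLM (σ t x)) b := by
  have m1 : ∀ c, 0 ≤ c → c ≤ |M| + |L| + |Cσ| + |Cb| →
      c * (d + 1) ≤ (d * m + 1) * (d + 1) * (|M| + |L| + |Cσ| + |Cb|) := by
    intro c hc h
    calc c * (d + 1) = 1 * (d + 1) * c := by ring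
      _ ≤ _ := by
        gcongr
        have : 0 ≤ (d : ℝ) * m := by positivity
        linarith
  have hM0 := abs_nonneg M
  have hL0 := abs_nonneg L
  have hσ0 := abs_nonneg Cσ
  have hb0 := abs_nonneg Cb
  have m2 : ∀ c, 0 ≤ c → c ≤ |M| + |L| + |Cσ| + |Cb| →
      c ≤ (d * m + 1) * (d + 1) * (|M| + |L| + |Cσ| + |Cb|) := fun c hc h => by
    refine le_trans ?_ (m1 c hc h)
    exact le_mul_of_one_le_right hc (by have := d.cast_nonneg (α := ℝ); linarith)
  have lin : ∀ (c : ℝ) (x : Fin d → ℝ), |c| ≤ |M| + |L| + |Cσ| + |Cb| →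
      c * (1 + vecNorm x) ≤ (d * m + 1) * (d + 1) * (|M| + |L| + |Cσ| + |Cb|) * (‖x‖ + 1) := by
    intro c x hc
    have h1 := vecNorm_nonneg x
    have h2 := vecNorm_le x
    have h3 : 1 + vecNorm x ≤ (d + 1) * (‖x‖ + 1) := by
      have := norm_nonneg x
      have := d.cast_nonneg (α := ℝ)
      nlinarith
    calc c * (1 + vecNorm x) ≤ |c| * ((d + 1) * (‖x‖ + 1)) := by
          have := le_abs_self c
          gcongr
      _ = |c| * (d + 1) * (‖x‖ + 1) := by ring
      _ ≤ _ := by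
        have := m1 |c| (abs_nonneg c) hc
        gcongr
  have tim : ∀ (c r : ℝ), 0 ≤ r → |c| ≤ |M| + |L| + |Cσ| + |Cb| →
      c * r ≤ (d * m + 1) * (d + 1) * (|M| + |L| + |Cσ| + |Cb|) * r := by
    intro c r hr hc
    have := m2 |c| (abs_nonneg c) hc
    have := le_abs_self c
    gcongr
    linarith
  refine ⟨?_, ?_, ?_, ?_, ?_, ?_, ?_⟩
  · intro t ht x y
    rw [matCLM_sub]
    refine (norm_matCLM_le _).trans ((hA.lipschitz t ht x y).trans ?_)
    have h1 := vecNorm_nonneg (x - y)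
    have h2 := vecNorm_le (x - y)
    calc M * vecNorm (x - y) ≤ |M| * ((d + 1) * ‖x - y‖) := by
          have := le_abs_self M
          have := norm_nonneg (x - y)
          gcongr
          linarith
      _ = |M| * (d + 1) * ‖x - y‖ := by ring
      _ ≤ _ := by
        have := m1 |M| hM0 (by linarith)
        gcongr
  · intro s hs t ht x
    rw [matCLM_sub]
    exact (norm_matCLM_le _).trans ((hA.holder_time s hs t ht x).1.trans
      (tim M _ (by positivity) (by linarith)))
  · intro t ht x
    exact (norm_matCLM_le _).trans ((hC t ht x).trans (lin Cσ x (by linarith)))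
  · intro t ht x
    exact (norm_le_vecNorm _).trans ((hB.growth t ht x).trans (lin L x (by linarith)))
  · intro R hR t ht x y hx hy
    refine (norm_le_vecNorm _).trans ((hB.lipschitz (d * R + 1) (by positivity) t ht x y
      (vecNorm_le_of_norm_le hx) (vecNorm_le_of_norm_le hy)).trans ?_)
    have h1 := vecNorm_nonneg (x - y)
    have h2 := vecNorm_le (x - y)
    have h3 := le_abs_self (LL (d * R + 1))
    calc _ ≤ |LL (d * R + 1)| * (d * ‖x - y‖) := by gcongr
      _ = _ := by ring
  · intro s hs t ht x
    exact (norm_le_vecNorm _).trans ((hD s hs t ht x).trans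
      (tim Cb _ (by positivity) (by linarith)))
  · intro R hR s hs t ht x₁ x₂ x₃ x₄ h₁ h₂ h₃ h₄
    rw [matCLM_sub, matCLM_sub, matCLM_sub]
    refine (norm_matCLM_le _).trans ((hA.four_point hκ hR hs ht h₁ h₂ h₃ h₄).trans ?_)
    refine add_le_add_left (mul_le_mul_of_nonneg_right ?_ (norm_nonneg _)) _
    calc (d : ℝ) * m * (|M| * d) ≤ (d * m + 1) * (|M| * (d + 1)) := by
          gcongr <;> linarith
      _ = (d * m + 1) * (d + 1) * |M| := by ring
      _ ≤ _ := by
        gcongr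
        linarith

end Coefficients

/-! ### Solutions of the equation as solutions in the sense of local errors -/

lemma HolderOnIcc.continuousOn {T ν : ℝ} {f : ℝ → ℝ} (hf : HolderOnIcc T ν f) (hν : 0 < ν) :
    ContinuousOn f (Icc 0 T) := by
  obtain ⟨K, hK⟩ := hf
  intro s hs
  rw [ContinuousWithinAt, tendsto_iff_norm_sub_tendsto_zero]
  have h0 : Filter.Tendsto (fun t => K * |t - s| ^ ν) (nhdsWithin s (Icc 0 T)) (nhds 0) := by
    have hc : Continuous fun t => K * |t - s| ^ ν :=
      continuous_const.mul ((continuous_abs.comp (continuous_sub_right s)).rpow_const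
        fun _ => Or.inr hν.le)
    have := hc.tendsto s
    simp only [sub_self, abs_zero, Real.zero_rpow hν.ne', mul_zero] at this
    exact this.mono_left nhdsWithin_le_nhds
  refine squeeze_zero' (Filter.Eventually.of_forall fun _ => norm_nonneg _) ?_ h0
  filter_upwards [self_mem_nhdsWithin] with t ht using hK s hs t ht

lemma abs_integral_sub_le_of_holder {T ν K : ℝ} {f : ℝ → ℝ} (hν : 0 < ν)
    (hf : ∀ s ∈ Icc 0 T, ∀ t ∈ Icc 0 T, |f t - f s| ≤ K * |t - s| ^ ν) {s t : ℝ}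
    (hs : 0 ≤ s) (hst : s ≤ t) (ht : t ≤ T) :
    |(∫ u in (0 : ℝ)..t, f u) - (∫ u in (0 : ℝ)..s, f u) - (t - s) * f s|
      ≤ |K| * (t - s) ^ (1 + ν) := by
  have hc : ContinuousOn f (Icc 0 T) := HolderOnIcc.continuousOn ⟨K, hf⟩ hν
  have hi : ∀ a c, 0 ≤ a → a ≤ c → c ≤ T → IntervalIntegrable f volume a c := fun a c ha hac hcT =>
    (hc.mono (by rw [uIcc_of_le hac]; exact Icc_subset_Icc ha hcT)).intervalIntegrable
  rw [intervalIntegral.integral_interval_sub_left (hi 0 t le_rfl (hs.trans hst) ht)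
    (hi 0 s le_rfl hs (hst.trans ht))]
  have e : (∫ u in s..t, f u) - (t - s) * f s = ∫ u in s..t, (f u - f s) := by
    rw [intervalIntegral.integral_sub (hi s t hs hst ht) intervalIntegrable_const]
    simp
  rw [e]
  have key := intervalIntegral.norm_integral_le_of_norm_le_const
    (f := fun u => f u - f s) (a := s) (b := t) (C := |K| * (t - s) ^ ν) fun u hu => by
      rw [uIoc_of_le hst] at hu
      refine (hf s ⟨hs, hst.trans ht⟩ u ⟨hs.trans hu.1.le, hu.2.trans ht⟩).trans ?_
      have h1 : |u - s| = u - s := abs_of_nonneg (by linarith [hu.1])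
      rw [h1]
      have h2 : 0 ≤ u - s := by linarith [hu.1]
      have h3 := hu.2
      have h4 := le_abs_self K
      gcongr
  rw [abs_of_nonneg (sub_nonneg.2 hst), mul_assoc] at key
  rcases hst.eq_or_lt with rfl | hlt
  · simp [Real.zero_rpow (by linarith : 1 + ν ≠ 0)]
  · rwa [add_comm 1 ν, Real.rpow_add_one (by linarith : t - s ≠ 0)]

section Solution

variable {d m : ℕ} {H T L Cb γ : ℝ} {LL : ℝ → ℝ}
  {σ : ℝ → (Fin d → ℝ) → Fin d → Fin m → ℝ} {b : ℝ → (Fin d → ℝ) → Fin d → ℝ}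
  {x0 : Fin d → ℝ} {B : Fin m → ℝ → ℝ} {x : ℝ → Fin d → ℝ}

lemma IsPathSolution.eq_initial (hT : 0 ≤ T) (hx : IsPathSolution H T σ b x0 B x) : x 0 = x0 := by
  obtain ⟨ν, α, -, -, -, -, -, h⟩ := hx
  ext i
  simpa [pathInt] using h 0 ⟨le_rfl, hT⟩ i

/-- The drift along a Hölder continuous path is Hölder continuous. -/
lemma exists_holder_drift (hT : 0 ≤ T) (hLB : CondB T L LL b) (hD : CondD T Cb γ b) {ν : ℝ}
    (hν : 0 < ν) (hγ : 0 < γ) (hx : ∀ i, HolderOnIcc T ν (fun t => x t i)) (i : Fin d) :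
    HolderOnIcc T (min ν γ) (fun t => b t (x t) i) := by
  choose K hK using hx
  have hKx : ∀ s ∈ Icc 0 T, ∀ t ∈ Icc 0 T, vecNorm (x t - x s) ≤ (∑ i, K i) * |t - s| ^ ν := by
    intro s hs t ht
    rw [Finset.sum_mul]
    exact Finset.sum_le_sum fun i _ => hK i s hs t ht
  set R := vecNorm (x 0) + |∑ i, K i| * T ^ ν + 1 with hR
  have hR0 : 0 < R := by
    have := vecNorm_nonneg (x 0)
    positivity
  have hxR : ∀ t ∈ Icc 0 T, vecNorm (x t) ≤ R := by
    intro t ht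
    have h1 := hKx 0 ⟨le_rfl, hT⟩ t ht
    have h2 : vecNorm (x t) ≤ vecNorm (x 0) + vecNorm (x t - x 0) := by
      unfold vecNorm
      rw [← Finset.sum_add_distrib]
      refine Finset.sum_le_sum fun i _ => ?_
      have := abs_add_le (x 0 i) (x t i - x 0 i)
      simpa using this
    have h3 : (∑ i, K i) * |t - 0| ^ ν ≤ |∑ i, K i| * T ^ ν := by
      rw [sub_zero, abs_of_nonneg ht.1]
      have h4 := le_abs_self (∑ i, K i)
      have h5 := ht.1
      have h6 := ht.2
      gcongr
    linarith
  refine ⟨|LL R| * |∑ i, K i| * T ^ (ν - min ν γ) + |Cb| * T ^ (γ - min ν γ), fun s hs t ht => ?_⟩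
  have e : b t (x t) i - b s (x s) i
      = (b t (x t) i - b t (x s) i) + (b t (x s) i - b s (x s) i) := by
    ring
  have comp : ∀ v : Fin d → ℝ, |v i| ≤ vecNorm v := fun v =>
    (norm_le_pi_norm v i).trans (norm_le_vecNorm v)
  have hts : |t - s| ≤ T := abs_le.2 ⟨by linarith [hs.2, ht.1], by linarith [hs.1, ht.2]⟩
  simp only
  rw [e, add_mul]
  refine (abs_add_le _ _).trans (add_le_add ?_ ?_)
  · refine (comp (b t (x t) - b t (x s))).trans ((hLB.lipschitz R hR0 t ht _ _ (hxR t ht)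
      (hxR s hs)).trans ?_)
    have h1 := hKx s hs t ht
    have h2 := vecNorm_nonneg (x t - x s)
    have h3 := le_abs_self (LL R)
    have h4 := le_abs_self (∑ i, K i)
    calc LL R * vecNorm (x t - x s) ≤ |LL R| * (|∑ i, K i| * |t - s| ^ ν) := by
          gcongr
          refine h1.trans ?_
          gcongr
      _ ≤ |LL R| * (|∑ i, K i| * (T ^ (ν - min ν γ) * |t - s| ^ min ν γ)) := by
          gcongr
          exact rpow_le_mul_rpow (abs_nonneg _) hts hν.ne' (min_le_left _ _)
      _ = _ := by ring
  · refine (comp (b t (x s) - b s (x s))).trans ((hD s hs t ht (x s)).trans ?_)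
    calc Cb * |t - s| ^ γ ≤ |Cb| * (T ^ (γ - min ν γ) * |t - s| ^ min ν γ) := by
          have h1 := le_abs_self Cb
          have h2 := rpow_le_mul_rpow (abs_nonneg _) hts hγ.ne' (min_le_right ν γ)
          gcongr
      _ = _ := by ring

/-- By the Young estimate for the pathwise integral, a solution of the integral equation has local
errors of order larger than one. -/
theorem IsPathSolution.isDavieSolution (hH1 : H < 1) (hT : 0 ≤ T)
    (hB : ∀ lam, 0 < lam → lam < H → ∀ j, HolderOnIcc T lam (B j))
    (hLB : CondB T L LL b) (hγ : 0 < γ) (hD : CondD T Cb γ b)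
    (hx : IsPathSolution H T σ b x0 B x) :
    IsDavieSolution T (fun t x => matCLM (σ t x)) b (fun t j => B j t) x := by
  obtain ⟨ν, α, hα, hαν, hν1, hxν, hσν, heq⟩ := hx
  have hα0 : 0 < α := by linarith
  have hα1 : α < 1 := by linarith
  have hν0 : 0 < ν := by linarith
  obtain ⟨lam, hlam, hlamH⟩ := exists_between (show 1 - α < H by linarith)
  choose K hK using hσν
  choose K' hK' using hB lam (by linarith) hlamH
  choose Kb hKb using exists_holder_drift hT hLB hD hν0 hγ hxν
  have hρ : 0 < min ν γ := lt_min hν0 hγ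
  set θ := min (ν + lam) (1 + min ν γ) with hθ
  have hθ1 : 1 < θ := lt_min (by linarith) (by linarith)
  let c : Fin d → ℝ := fun i =>
    (∑ j, sewingConst (ν + lam) * (max (K i j) 0 * max (K' j) 0)) * T ^ (ν + lam - θ)
      + |Kb i| * T ^ (1 + min ν γ - θ)
  refine ⟨∑ i, |c i|, θ, hθ1, fun s t hs hst ht => ?_⟩
  have hts : 0 ≤ t - s := sub_nonneg.2 hst
  have htsT : t - s ≤ T := by linarith
  have hpow : 0 ≤ (t - s) ^ θ := Real.rpow_nonneg hts _
  refine (pi_norm_le_iff_of_nonneg (mul_nonneg (Finset.sum_nonneg fun _ _ => abs_nonneg _)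
    hpow)).2 fun i => ?_
  suffices h : |localError (fun t x => matCLM (σ t x)) b (fun t j => B j t) x s t i|
      ≤ c i * (t - s) ^ θ by
    refine h.trans (mul_le_mul_of_nonneg_right ((le_abs_self _).trans ?_) hpow)
    exact Finset.single_le_sum (f := fun i => |c i|) (fun _ _ => abs_nonneg _)
      (Finset.mem_univ i)
  have e : localError (fun t x => matCLM (σ t x)) b (fun t j => B j t) x s t i
      = (∑ j, (pathInt α (fun u => σ u (x u) i j) (B j) 0 t
          - pathInt α (fun u => σ u (x u) i j) (B j) 0 s - σ s (x s) i j * (B j t - B j s)))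
        + ((∫ u in (0 : ℝ)..t, b u (x u) i) - (∫ u in (0 : ℝ)..s, b u (x u) i)
          - (t - s) * b s (x s) i) := by
    simp only [localError, Pi.sub_apply, Pi.smul_apply, smul_eq_mul, matCLM_apply,
      Finset.sum_sub_distrib]
    rw [heq t ⟨hs.trans hst, ht⟩ i, heq s ⟨hs, hst.trans ht⟩ i]
    ring
  rw [e, add_mul]
  refine (abs_add_le _ _).trans (add_le_add ?_ ?_)
  · refine (Finset.abs_sum_le_sum_abs _ _).trans ?_
    calc _ ≤ ∑ j, sewingConst (ν + lam) * (max (K i j) 0 * max (K' j) 0) * (t - s) ^ (ν + lam) :=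
          Finset.sum_le_sum fun j _ => young_bound hα0 hα1 hαν hlam hT (hK i j) (hK' j) hs hst ht
      _ = (∑ j, sewingConst (ν + lam) * (max (K i j) 0 * max (K' j) 0)) * (t - s) ^ (ν + lam) := by
          rw [Finset.sum_mul]
      _ ≤ (∑ j, sewingConst (ν + lam) * (max (K i j) 0 * max (K' j) 0))
            * (T ^ (ν + lam - θ) * (t - s) ^ θ) := by
          refine mul_le_mul_of_nonneg_left (rpow_le_mul_rpow hts htsT (by linarith)
            (min_le_left _ _)) (Finset.sum_nonneg fun j _ => ?_)
          have := (sewingConst_pos (show 1 < ν + lam by linarith)).le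
          positivity
      _ = _ := by ring
  · refine (abs_integral_sub_le_of_holder hρ (hKb i) hs hst ht).trans ?_
    rw [mul_assoc]
    exact mul_le_mul_of_nonneg_left (rpow_le_mul_rpow hts htsT (by linarith)
      (min_le_right _ _)) (abs_nonneg _)

lemma euler_zero (δ : ℝ) : euler σ b x0 B δ 0 = x0 := by
  ext i
  simp [euler, gridIndex, gridPoint, eulerGrid]

lemma euler_grid {δ : ℝ} (hδ : 0 < δ) (n : ℕ) :
    euler σ b x0 B δ (n * δ) = eulerGrid σ b x0 B δ n := by
  have h : gridIndex δ (n * δ) = n := by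
    rw [gridIndex, mul_div_cancel_right₀ _ hδ.ne', Nat.floor_natCast]
  ext i
  simp [euler, gridPoint, h]

/-- The interpolated Euler approximation satisfies the Euler recursion on each grid interval; at its
right endpoint the interpolation already uses the next grid point, with the same value. -/
lemma isEulerPath_euler {δ : ℝ} (hδ : 0 < δ) (N : ℕ) :
    IsEulerPath δ N (fun t x => matCLM (σ t x)) b (fun t j => B j t) (euler σ b x0 B δ) := by
  intro n _ t h1 h2
  ext i
  simp only [localError, Pi.sub_apply, Pi.smul_apply, smul_eq_mul, matCLM_apply, Pi.zero_apply]
  rw [euler_grid hδ]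
  rcases h2.eq_or_lt with rfl | h2
  · have e : ((n : ℝ) + 1) * δ = ((n + 1 : ℕ) : ℝ) * δ := by push_cast; ring
    rw [show euler σ b x0 B δ (((n : ℝ) + 1) * δ) = eulerGrid σ b x0 B δ (n + 1) by
      rw [e, euler_grid hδ]]
    simp only [eulerGrid]
    ring
  · have h : gridIndex δ t = n := by
      rw [gridIndex, Nat.floor_eq_iff (div_nonneg (le_trans (by positivity) h1) hδ.le),
        le_div_iff₀ hδ, div_lt_iff₀ hδ]
      exact ⟨h1, h2⟩
    simp only [euler, gridPoint, h]
    ring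

end Solution

/-! ### The error functional -/

lemma gridPoint_le {δ s : ℝ} (hδ : 0 < δ) (hs : 0 ≤ s) : gridPoint δ s ≤ s := by
  rw [gridPoint, gridIndex, ← le_div_iff₀ hδ]
  exact Nat.floor_le (by positivity)

/-- A `μ`-Hölder bound on `x - y`, with `μ > α`, controls the error functional. -/
theorem errorNorm_le {d : ℕ} {α μ T δ c : ℝ} (hα : 0 < α) (hαμ : α < μ) (hT : 0 ≤ T)
    (hδ : 0 < δ) (hc : 0 ≤ c) {x y : ℝ → Fin d → ℝ} (h0 : x 0 = y 0)
    (h : ∀ s t, 0 ≤ s → s ≤ t → t ≤ T → ‖x t - y t - (x s - y s)‖ ≤ c * (t - s) ^ μ) :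
    errorNorm α T δ x y ≤ ENNReal.ofReal (d * (T ^ μ + T ^ (μ - α) / (μ - α)) * c) := by
  refine iSup₂_le fun s hs => ?_
  have hpos : 0 < μ - α := by linarith
  have h1 : vecNorm (x s - y s) ≤ d * T ^ μ * c := by
    have h2 := h 0 s le_rfl hs.1 hs.2
    rw [h0, sub_self, sub_zero, sub_zero] at h2
    refine (vecNorm_le _).trans ?_
    have h3 : s ^ μ ≤ T ^ μ := Real.rpow_le_rpow hs.1 hs.2 (by linarith)
    calc (d : ℝ) * ‖x s - y s‖ ≤ d * (c * T ^ μ) := by gcongr; exact h2.trans (by gcongr)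
      _ = _ := by ring
  have hint : IntervalIntegrable (fun u => (s - u) ^ (μ - α - 1)) volume 0 s :=
    rpow_sub_intervalIntegrable (by linarith) s
  have hval : ∫ u in (0 : ℝ)..s, (s - u) ^ (μ - α - 1) = s ^ (μ - α) / (μ - α) := by
    rw [integral_rpow_sub (by linarith), sub_add_cancel]
  have h2 : ∫⁻ u in Ioo 0 (gridPoint δ s),
      ENNReal.ofReal (vecNorm (x s - y s - x u + y u) * (s - u) ^ (-α - 1))
      ≤ ENNReal.ofReal (d * (T ^ (μ - α) / (μ - α)) * c) := by
    calc _ ≤ ∫⁻ u in Ioc 0 s, ENNReal.ofReal (d * c * (s - u) ^ (μ - α - 1)) := by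
          refine (lintegral_mono_set (Ioo_subset_Ioo_right (gridPoint_le hδ hs.1))).trans ?_
          refine (setLIntegral_mono' measurableSet_Ioo fun u hu => ?_).trans
            (lintegral_mono_set Ioo_subset_Ioc_self)
          refine ENNReal.ofReal_le_ofReal ?_
          have hsu : 0 < s - u := sub_pos.2 hu.2
          have e : x s - y s - x u + y u = x s - y s - (x u - y u) := by abel
          have h3 := h u s hu.1.le hu.2.le hs.2
          rw [e, show μ - α - 1 = μ + (-α - 1) by ring, Real.rpow_add hsu, ← mul_assoc]
          refine mul_le_mul_of_nonneg_right ((vecNorm_le _).trans ?_) (by positivity)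
          rw [mul_assoc]
          gcongr
      _ = ENNReal.ofReal (∫ u in Ioc 0 s, d * c * (s - u) ^ (μ - α - 1)) := by
          rw [ofReal_integral_eq_lintegral_ofReal]
          · exact ((intervalIntegrable_iff_integrableOn_Ioc_of_le hs.1).1 hint).const_mul _
          · filter_upwards [ae_restrict_mem measurableSet_Ioc] with u hu
            have : 0 ≤ s - u := sub_nonneg.2 hu.2
            positivity
      _ ≤ _ := by
          refine ENNReal.ofReal_le_ofReal ?_
          rw [← intervalIntegral.integral_of_le hs.1, intervalIntegral.integral_const_mul, hval]
          have h3 : s ^ (μ - α) ≤ T ^ (μ - α) := Real.rpow_le_rpow hs.1 hs.2 hpos.le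
          calc d * c * (s ^ (μ - α) / (μ - α)) ≤ d * c * (T ^ (μ - α) / (μ - α)) := by gcongr
            _ = _ := by ring
  calc _ ≤ ENNReal.ofReal (d * T ^ μ * c)
        + ENNReal.ofReal (d * (T ^ (μ - α) / (μ - α)) * c) :=
        add_le_add (ENNReal.ofReal_le_ofReal h1) h2
    _ = _ := by
        rw [← ENNReal.ofReal_add (by positivity) (by positivity)]
        congr 1
        ring

/-! ### The rate of convergence -/

/-- The error bound for fixed realizations, with a constant that depends on them only through the
constants of the assumptions and a bound `K` for the Hölder seminorm of the driving path and for the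
initial value. -/
theorem exists_errorNorm_bound {H T M β κ L Cσ Cb γ α μ : ℝ} {ML LL : ℝ → ℝ} (d m : ℕ)
    (hH1 : H < 1) (hT : 0 < T) (hα : 0 < α) (hαμ : α < μ) (hμ : 1 / 2 < μ) (hμ1 : μ < 1)
    (hμβ : μ ≤ β) (hγ : 2 * μ - 1 ≤ γ) (hκ0 : 0 ≤ κ) (hκ1 : κ ≤ 1) (hκμ : 1 < κ * μ + μ)
    {K : ℝ} (hK : 0 ≤ K) :
    ∃ C : ℝ, 0 ≤ C ∧ ∀ (σ : ℝ → (Fin d → ℝ) → Fin d → Fin m → ℝ)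
      (b : ℝ → (Fin d → ℝ) → Fin d → ℝ) (x0 : Fin d → ℝ) (B : Fin m → ℝ → ℝ)
      (x : ℝ → Fin d → ℝ) (N : ℕ),
      CondA T M ML β κ σ → CondB T L LL b → CondC T Cσ σ → CondD T Cb γ b →
      (∀ lam, 0 < lam → lam < H → ∀ j, HolderOnIcc T lam (B j)) →
      (∀ j, ∀ s ∈ Icc 0 T, ∀ t ∈ Icc 0 T, |B j t - B j s| ≤ K * |t - s| ^ μ) →
      vecNorm x0 ≤ K → IsPathSolution H T σ b x0 B x → 0 < N →
      errorNorm α T (T / N) x (euler σ b x0 B (T / N))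
        ≤ ENNReal.ofReal (C * (T / N) ^ (2 * μ - 1)) := by
  obtain ⟨C, hC0, hC⟩ := exists_error_bound (E := Fin d → ℝ) (G := Fin m → ℝ)
    (M := (d * m + 1) * (d + 1) * (|M| + |L| + |Cσ| + |Cb|)) (K := K) (T := T) (β := β) (γ := γ)
    (κ := κ) (μ := μ)
    (LD := fun R => |LL (d * R + 1)| * d)
    (QS := fun R => d * m * (d * |M| + d * (|ML (d * R + 1)| * d ^ κ)))
    (by positivity) hK hT.le hμ hμ1 hμβ hγ hκ1 hκμ (fun R => by positivity) (fun R => by positivity)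
  have hpos : 0 < μ - α := by linarith
  refine ⟨d * (T ^ μ + T ^ (μ - α) / (μ - α)) * C, by positivity, ?_⟩
  intro σ b x0 B x N hA hLB hCσ hD hBH hBμ hx0 hx hN
  have hN' : (0 : ℝ) < N := Nat.cast_pos.2 hN
  have hδ : 0 < T / N := by positivity
  have hg : ∀ s t, 0 ≤ s → s ≤ t → t ≤ T →
      ‖(fun j => B j t) - (fun j => B j s)‖ ≤ K * (t - s) ^ μ := by
    intro s t hs hst ht
    have h0 : 0 ≤ t - s := sub_nonneg.2 hst
    refine (pi_norm_le_iff_of_nonneg (by positivity)).2 fun j => ?_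
    have := hBμ j s ⟨hs, hst.trans ht⟩ t ⟨hs.trans hst, ht⟩
    rwa [abs_of_nonneg h0] at this
  have h := hC (fun t x => matCLM (σ t x)) b (fun t j => B j t) x (euler σ b x0 B (T / N)) (T / N) N
    (coeff_of_cond hκ0 hA hLB hCσ hD) hg
    (hx.isDavieSolution hH1 hT.le hBH hLB (by linarith) hD) hδ (by field_simp)
    (isEulerPath_euler hδ N) (by rw [hx.eq_initial hT.le, euler_zero])
    (by rw [hx.eq_initial hT.le]; exact (norm_le_vecNorm x0).trans hx0)
  refine (errorNorm_le hα hαμ hT.le hδ (by positivity)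
    (by rw [hx.eq_initial hT.le, euler_zero]) h).trans (le_of_eq ?_)
  rw [mul_assoc _ C]

/-- Almost surely, the error is of order `δ ^ (2 * H - 1 - ρ)` for all step sizes `δ = T / N`. -/
theorem exists_ae_errorNorm_le {Ω : Type*} [MeasurableSpace Ω] {P : Measure Ω} {d m : ℕ} {H T : ℝ}
    (hH : H ∈ Ioo (1 / 2 : ℝ) 1) (hT : 0 < T)
    {B : Fin m → ℝ → Ω → ℝ} (hB : ∀ j, IsFBM P H (B j))
    {X0 : Ω → Fin d → ℝ} (hX0 : Measurable X0)
    {σ : Ω → ℝ → (Fin d → ℝ) → Fin d → Fin m → ℝ} {b : Ω → ℝ → (Fin d → ℝ) → Fin d → ℝ}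
    {M : ℝ} {ML : ℝ → ℝ} {β κ : ℝ} (hβ : H < β) (hκ : 1 / H - 1 < κ ∧ κ ≤ 1)
    (hA : ∀ᵐ ω ∂P, CondA T M ML β κ (σ ω))
    {L : ℝ} {LL : ℝ → ℝ} (hLB : ∀ᵐ ω ∂P, CondB T L LL (b ω))
    {Cσ : ℝ} (hC : ∀ᵐ ω ∂P, CondC T Cσ (σ ω))
    {Cb γ : ℝ} (hγ : 2 * H - 1 < γ) (hD : ∀ᵐ ω ∂P, CondD T Cb γ (b ω))
    {X : ℝ → Ω → Fin d → ℝ}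
    (hX : ∀ᵐ ω ∂P, IsPathSolution H T (σ ω) (b ω) (X0 ω) (fun j t => B j t ω) (fun t => X t ω))
    {α : ℝ} (hα : α ∈ Ioo (1 - H) (1 / 2)) {ρ : ℝ} (hρ : ρ ∈ Ioo 0 (2 * H - 1)) :
    ∃ C : Ω → ℝ, Measurable C ∧ ∀ᵐ ω ∂P, ∀ N : ℕ, 0 < N →
      errorNorm α T (T / N) (fun t => X t ω)
          (euler (σ ω) (b ω) (X0 ω) (fun j t => B j t ω) (T / N))
        ≤ ENNReal.ofReal (C ω * (T / N) ^ (2 * H - 1 - ρ)) := by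
  obtain ⟨hH2, hH1⟩ := hH
  have hH0 : 0 < H := by linarith
  have hκH : 1 < (1 + κ) * H := by
    have := (div_lt_iff₀ hH0).1 (by linarith [hκ.1] : 1 / H < 1 + κ)
    exact this
  have hκ0 : 0 ≤ κ := by
    have : 1 < 1 / H := (one_lt_div hH0).2 hH1
    linarith [hκ.1]
  -- an exponent below `H` at which the Young condition `κ * μ + μ > 1` still holds
  obtain ⟨μ, hμ, hμH⟩ : ∃ μ, max (max (1 / 2) (H - ρ / 2)) (1 / (1 + κ)) < μ ∧ μ < H := by
    refine exists_between (max_lt (max_lt hH2 (by linarith [hρ.1])) ?_)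
    rw [div_lt_iff₀ (by linarith)]
    linarith
  obtain ⟨hμ', hμκ⟩ := max_lt_iff.1 hμ
  obtain ⟨hμ2, hμρ⟩ := max_lt_iff.1 hμ'
  rw [div_lt_iff₀ (by linarith)] at hμκ
  have hpw : 2 * H - 1 - ρ ≤ 2 * μ - 1 := by linarith
  choose K hKm hK using fun j => (hB j).exists_holder (show 0 < μ by linarith) hμH hT
  have hHol : ∀ᵐ ω ∂P, ∀ lam, 0 < lam → lam < H → ∀ j, HolderOnIcc T lam (fun t => B j t ω) := by
    -- countably many exponents suffice
    have h1 : ∀ᵐ ω ∂P, ∀ q : ℚ, 0 < (q : ℝ) → (q : ℝ) < H → ∀ j,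
        HolderOnIcc T q (fun t => B j t ω) := by
      rw [ae_all_iff]
      intro q
      by_cases hq : 0 < (q : ℝ) ∧ (q : ℝ) < H
      · have : ∀ᵐ ω ∂P, ∀ j, HolderOnIcc T q (fun t => B j t ω) := by
          rw [ae_all_iff]
          intro j
          obtain ⟨K', -, hK'⟩ := (hB j).exists_holder hq.1 hq.2 hT
          filter_upwards [hK'] with ω h using ⟨K' ω, h⟩
        filter_upwards [this] with ω h _ _ using h
      · exact Filter.Eventually.of_forall fun ω h0 h1 => absurd ⟨h0, h1⟩ hq
    filter_upwards [h1] with ω h lam h0 hlam j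
    obtain ⟨q, hq1, hq2⟩ := exists_rat_btwn hlam
    obtain ⟨K', hK'⟩ := h q (h0.trans hq1) hq2 j
    refine ⟨|K'| * T ^ (q - lam), fun s hs t ht => (hK' s hs t ht).trans ?_⟩
    have hts : |t - s| ≤ T := abs_le.2 ⟨by linarith [hs.2, ht.1], by linarith [hs.1, ht.2]⟩
    rw [mul_assoc]
    exact (mul_le_mul_of_nonneg_right (le_abs_self K') (by positivity)).trans
      (mul_le_mul_of_nonneg_left (rpow_le_mul_rpow (abs_nonneg _) hts (h0.trans hq1).ne' hq1.le)
        (abs_nonneg _))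
  choose C hC0 hCb using fun n : ℕ => exists_errorNorm_bound (M := M) (L := L) (Cσ := Cσ) (Cb := Cb)
    (ML := ML) (LL := LL) d m hH1 hT (show 0 < α by linarith [hα.1]) (show α < μ by linarith [hα.2])
    hμ2 (hμH.trans hH1) (hμH.trans hβ).le (by linarith : 2 * μ - 1 ≤ γ) hκ0 hκ.2
    (by linarith : 1 < κ * μ + μ) (Nat.cast_nonneg (α := ℝ) n)
  -- rounding up the random bound to an integer makes the random constant measurable
  let n : Ω → ℕ := fun ω => ⌈(∑ j, |K j ω|) + vecNorm (X0 ω)⌉₊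
  have hn : Measurable n := by
    refine Nat.measurable_ceil.comp ((Finset.measurable_fun_sum _ fun j _ =>
      (hKm j).abs).add ?_)
    unfold vecNorm
    exact Finset.measurable_fun_sum _ fun i _ => ((measurable_pi_apply i).comp hX0).abs
  refine ⟨fun ω => C (n ω) * T ^ (2 * μ - 1 - (2 * H - 1 - ρ)),
    ((measurable_of_countable C).comp hn).mul_const _, ?_⟩
  filter_upwards [hA, hLB, hC, hD, hX, hHol, ae_all_iff.2 hK] with ω hA hLB hC hD hX hHol hK N hN
  have hle : (∑ j, |K j ω|) + vecNorm (X0 ω) ≤ n ω := Nat.le_ceil _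
  have hKn : ∀ j, K j ω ≤ n ω := fun j => by
    have h1 := Finset.single_le_sum (f := fun j => |K j ω|) (fun _ _ => abs_nonneg _)
      (Finset.mem_univ j)
    have h2 := vecNorm_nonneg (X0 ω)
    have h3 := le_abs_self (K j ω)
    linarith
  have hXn : vecNorm (X0 ω) ≤ n ω := by
    have : 0 ≤ ∑ j, |K j ω| := Finset.sum_nonneg fun _ _ => abs_nonneg _
    linarith
  have hN1 : (1 : ℝ) ≤ N := Nat.one_le_cast.2 hN
  refine (hCb (n ω) (σ ω) (b ω) (X0 ω) (fun j t => B j t ω) (fun t => X t ω) N hA hLB hC hD hHol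
    (fun j s hs t ht => (hK j s hs t ht).trans
      (mul_le_mul_of_nonneg_right (hKn j) (by positivity))) hXn hX hN).trans
    (ENNReal.ofReal_le_ofReal ?_)
  rw [mul_assoc]
  exact mul_le_mul_of_nonneg_left (rpow_le_mul_rpow (by positivity) (div_le_self hT.le hN1)
    (by linarith) hpw) (hC0 _)

end FBMEuler

theorem theorem2 {Ω : Type*} [MeasurableSpace Ω] (P : Measure Ω) [IsProbabilityMeasure P]
    {d m : ℕ} (H T : ℝ) (hH : H ∈ Ioo (1 / 2 : ℝ) 1) (hT : 0 < T)
    -- the driving fractional Brownian motions and the initial value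
    (B : Fin m → ℝ → Ω → ℝ) (hB : ∀ j, FBMEuler.IsFBM P H (B j))
    (X0 : Ω → Fin d → ℝ) (hX0 : Measurable X0)
    -- the coefficients and their assumptions
    (σ : Ω → ℝ → (Fin d → ℝ) → Fin d → Fin m → ℝ)
    (b : Ω → ℝ → (Fin d → ℝ) → Fin d → ℝ)
    (M : ℝ) (ML : ℝ → ℝ) (β κ : ℝ) (hβ : H < β ∧ β ≤ 1) (hκ : 1 / H - 1 < κ ∧ κ ≤ 1)
    (hA : ∀ᵐ ω ∂P, FBMEuler.CondA T M ML β κ (σ ω))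
    (L : ℝ) (LL : ℝ → ℝ) (hLB : ∀ᵐ ω ∂P, FBMEuler.CondB T L LL (b ω))
    (Cσ : ℝ) (hC : ∀ᵐ ω ∂P, FBMEuler.CondC T Cσ (σ ω))
    (Cb γ : ℝ) (hγ : 2 * H - 1 < γ ∧ γ ≤ 1)
    (hD : ∀ᵐ ω ∂P, FBMEuler.CondD T Cb γ (b ω))
    -- the solution
    (X : ℝ → Ω → Fin d → ℝ)
    (hX : ∀ᵐ ω ∂P, FBMEuler.IsPathSolution H T (σ ω) (b ω) (X0 ω)
      (fun j t => B j t ω) (fun t => X t ω))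
    (α : ℝ) (hα : α ∈ Ioo (1 - H) (1 / 2)) :
    (∃ ρ₀ : ℝ, 0 < ρ₀ ∧ ∀ ρ ∈ Ioo 0 ρ₀,
      ∃ C : Ω → ℝ, Measurable C ∧
        ∀ ε : ℝ, 0 < ε → ∃ δ₀ : ℝ, 0 < δ₀ ∧ ∃ A : Set Ω, MeasurableSet A ∧ 1 - ε < P.real A ∧
          ∀ ω ∈ A, ∀ N : ℕ, 0 < N → T / N < δ₀ →
            FBMEuler.errorNorm α T (T / N) (fun t => X t ω)
                (FBMEuler.euler (σ ω) (b ω) (X0 ω) (fun j t => B j t ω) (T / N))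
              ≤ ENNReal.ofReal (C ω * (T / N) ^ (2 * H - 1 - ρ))) ∧
    ((∃ K : ℝ, ∀ᵐ ω ∂P, ∀ t ∈ Icc 0 T, ∀ x,
        FBMEuler.vecNorm (b ω t x) ≤ K ∧ FBMEuler.matNorm (σ ω t x) ≤ K) →
      ∀ ρ ∈ Ioo 0 (2 * H - 1),
        ∃ C : Ω → ℝ, Measurable C ∧
          ∀ᵐ ω ∂P, ∀ N : ℕ, 0 < N →
            FBMEuler.errorNorm α T (T / N) (fun t => X t ω)
                (FBMEuler.euler (σ ω) (b ω) (X0 ω) (fun j t => B j t ω) (T / N))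
              ≤ ENNReal.ofReal (C ω * (T / N) ^ (2 * H - 1 - ρ))) := by
  have key := fun ρ (hρ : ρ ∈ Ioo 0 (2 * H - 1)) =>
    FBMEuler.exists_ae_errorNorm_le hH hT hB hX0 hβ.1 hκ hA hLB hC hγ.1 hD hX hα hρ
  refine ⟨⟨2 * H - 1, by linarith [hH.1], fun ρ hρ => ?_⟩, fun _ => key⟩
  obtain ⟨C, hCm, hbound⟩ := key ρ hρ
  obtain ⟨A, hAsub, hAm, hA0⟩ := exists_measurable_superset_of_null (ae_iff.1 hbound)
  refine ⟨C, hCm, fun ε hε => ⟨1, one_pos, Aᶜ, hAm.compl, ?_, fun ω hω N hN _ => ?_⟩⟩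
  · rw [probReal_compl_eq_one_sub hAm, measureReal_def, hA0]
    simpa using hε
  · by_contra h
    exact hω (hAsub fun h' => h (h' N hN))
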